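/- **Setting.** Let $h\neq 0$ be real. Let $\bar{\mathcal F}$ be the algebra (without constants) of formal nonlocal differential–difference polynomials in a function $\bar u=\bar u(n,\bar x)$: it is generated from $\bar u$ by sums, products, multiplication by polynomials in $\bar x,n,\bar t$, and the operations $\partial=\partial_{\bar x}$, $\partial^{-1}$, $E^{k}$ ($k\in\mathbb Z$; $E\,g(n)=g(n+1)$) and $\Delta^{-1}$, where $\Delta=E-1$, subject to the usual rules (commutative algebra over the polynomials, Leibniz rule for $\partial$, multiplicativity of $E$, $\partial E=E\partial$, $\partial\partial^{-1}=\partial^{-1}\partial=1$, $\Delta\Delta^{-1}=\Delta^{-1}\Delta=1$). Functionals are sums of formal integrals $\sum_n\int f g\,d\bar x$ with $f,g\in\bar{\mathcal F}$, bilinear and depending only on the product $fg$, modulo integration by parts in $\bar x$ and invariance of the sum under the shift of $n$; put $(f,g)=\frac{h^2}{2}\sum_n\int fg\,d\bar x$. Write $f'[g]=\frac{d}{d\varepsilon}f(\bar u+\varepsilon g)|_{\varepsilon=0}$, $\llbracket f,g\rrbracket=f'[g]-g'[f]$, $\tilde\partial_{t}$ for the derivative with respect to the explicitly occurring time $t$,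 and ${}^*$ for the adjoint with respect to $(\cdot,\cdot)$. For $\bar u_t=K$, a symmetry is a $\kappa$ with $\tilde\partial_t\kappa=\llbracket K,\kappa\rrbracket$, a conserved covariant is a $\gamma$ with $-\tilde\partial_t\gamma=\gamma'[K]+K'^*[\gamma]$, and a conserved quantity is a functional $I$ with $\tilde\partial_tI+I'[K]=0$. Consider pseudo-difference operators $\sum_{j\le N}a_j\Delta^j$ composed by $\Delta^s g=\sum_{i\ge0}\binom{s}{i}(\Delta^iE^{s-i}g)\Delta^{s-i}$, whose coefficients are sums of a polynomial in $\bar x,n,\bar t$ (the value at $\bar u=0$) and an element of $\bar{\mathcal F}$. Let $\bar L=h^{-1}\Delta+\bar u+h\bar u_1\Delta^{-1}+h^2\bar u_2\Delta^{-2}+\cdots$ ($\bar u_j\in\bar{\mathcal F}$) be determined by $\bar L_{\bar x}=[\bar A_1,\bar L]$, where $\bar A_m=(\bar L^m)_+$ is the part with non-negative powers of $\Delta$. For $m\ge1$ let $\bar B_m$ be the difference operator of order at most $m$ with $\bar B_m|_{\bar u=0}=h^{-(m-1)}\bar x\Delta^m+h^{-(m-1)}(\bar x+hn)\Delta^{m-1}$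 for which $[\bar B_m,\bar L]+h\bar L^m+\bar L^{m-1}$ has no positive powers of $\Delta$. Put $$\bar K_m=\bar A_{m,\bar x}-[\bar A_1,\bar A_m],\quad \bar\sigma_m=\bar B_{m,\bar x}-[\bar A_1,\bar B_m],\quad \bar\gamma_m=\partial^{-1}\bar K_m,\quad \bar\omega_m=\partial^{-1}\bar\sigma_m\qquad(m\ge1),$$ and $\bar K_0=\bar\gamma_0=0$. Let $\bar H_0=0$, $\bar H_1=\frac12(\bar u,\bar u)$, $\bar H_m=\frac1h\bigl(\frac1{m-1}(\bar\gamma_{m-1},\bar\sigma_2)-\bar H_{m-1}\bigr)$ for $m>1$; $\bar J_1=\frac h2(\bar x\bar u,\bar u)$, $\bar J_3=\int_0^1(\bar\omega_3(\lambda\bar u),\bar u)\,d\lambda$, $\bar J_m=\frac1h\bigl(\frac1{m-3}(\bar\omega_{m-1},\bar\sigma_2)-\bar J_{m-1}\bigr)$ for $m>1$, $m\ne3$. For $s,r\ge1$ put, with $\bar t_s$ the time of the equation $\bar u_{\bar t_s}=\bar K_s$, $$\bar\tau^s_r=s\bar t_s(h\bar K_{s+r-1}+\bar K_{s+r-2})+\bar\sigma_r,\qquad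 \bar\vartheta^s_r=\partial^{-1}\bar\tau^s_r,\qquad \bar I^s_r=s\bar t_s(h\bar H_{s+r-1}+\bar H_{s+r-2})+\bar J_r,$$ and $\bar I^s_0=0$. **Theorem.** The operators $\bar L$ and $\bar B_m$ ($m\ge1$) exist and are unique, the right-hand sides defining $\bar K_m$ and $\bar\sigma_m$ are operators of multiplication by elements of $\bar{\mathcal F}$, and the integral defining $\bar J_3$ exists. For each equation $\bar u_{\bar t_s}=\bar K_s$, $s\ge1$, of the isospectral D$\Delta$KP hierarchy and all $l,r\ge1$: $\bar K_l$ and $\bar\tau^s_r$ are symmetries; $\bar\gamma_l$ and $\bar\vartheta^s_r=s\bar t_s(h\bar\gamma_{s+r-1}+\bar\gamma_{s+r-2})+\bar\omega_r$ are conserved covariants; $\bar H_l$ and $\bar I^s_r$ are conserved quantities; and $$(\bar K_l,\bar\gamma_r)=0,$$ $$(\bar K_l,\bar\vartheta^s_r)=-(\bar\tau^s_r,\bar\gamma_l)=-l\,(h\bar H_{l+r-1}+\bar H_{l+r-2}),$$ $$(\bar\tau^s_l,\bar\vartheta^s_r)=-(l-r)(h\bar I^s_{l+r-1}+\bar I^s_{l+r-2}).$$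 -/

import Mathlib

open scoped TensorProduct

namespace DDKP

noncomputable section

/-! ## Coefficients

Polynomials in the explicit independent variables: the continuous variable `x`, the discrete
variable `n`, and the time `t` of the evolution equation under consideration. -/

inductive Var
  | x | n | t

abbrev Coef : Type := MvPolynomial Var ℝ

abbrev cx : Coef := MvPolynomial.X Var.x
abbrev cn : Coef := MvPolynomial.X Var.n
abbrev ct : Coef := MvPolynomial.X Var.t

/-- `∂ / ∂x` on coefficients. -/
def coefDx : Derivation ℝ Coef Coef := MvPolynomial.pderiv Var.x

/-- `∂ / ∂t` on coefficients. -/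
def coefDt : Derivation ℝ Coef Coef := MvPolynomial.pderiv Var.t

/-- What the variables become under `n ↦ n + k`. -/
def shiftVar (k : ℤ) : Var → Coef
  | Var.x => cx
  | Var.n => cn + MvPolynomial.C (k : ℝ)
  | Var.t => ct

/-- `E ^ k` on coefficients. -/
def coefShift (k : ℤ) : Coef →ₐ[ℝ] Coef := MvPolynomial.aeval (shiftVar k)

theorem coefDt_dx (c : Coef) : coefDt (coefDx c) = coefDx (coefDt c) := by
  classical
  have h : ⁅coefDt, coefDx⁆ = (0 : Derivation ℝ Coef Coef) := by
    refine MvPolynomial.derivation_ext fun i => ?_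
    cases i <;> simp [Derivation.commutator_apply, coefDt, coefDx, MvPolynomial.pderiv_X]
  have h2 := congrArg (fun d : Derivation ℝ Coef Coef => d c) h
  simpa [Derivation.commutator_apply, sub_eq_zero] using h2

theorem coefDt_shift (k : ℤ) (c : Coef) : coefDt (coefShift k c) = coefShift k (coefDt c) := by
  classical
  induction c using MvPolynomial.induction_on with
  | C a => simp [coefDt, coefShift, MvPolynomial.algebraMap_eq]
  | add p q hp hq => simp [hp, hq]
  | mul_X p i hp =>
    rw [map_mul, Derivation.leibniz, hp, Derivation.leibniz, map_add, smul_eq_mul, smul_eq_mul,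
      smul_eq_mul, smul_eq_mul, map_mul, map_mul]
    congr 2
    cases i <;> simp [coefDt, coefShift, shiftVar, MvPolynomial.pderiv_X]

/-! ## Nonlocal differential-difference polynomials

`Expr` lists the expressions in the field variable `u` that can be formed with sums, products,
multiplication by coefficients, `∂ = ∂ / ∂x`, `∂⁻¹`, the shifts `E ^ k` and `Δ⁻¹`, where
`Δ = E - 1`. There are no constants, so every expression vanishes at `u = 0`. -/

inductive Expr
  | u : Expr
  | zero : Expr
  | add : Expr → Expr → Expr
  | smul : Coef → Expr → Expr
  | mul : Expr → Expr → Expr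
  | dx : Expr → Expr
  | dxInv : Expr → Expr
  | shift : ℤ → Expr → Expr
  | deltaInv : Expr → Expr

/-- Equality of expressions: the rules of a commutative algebra over the coefficients, the
Leibniz rule for `∂`, multiplicativity of `E`, `∂ E = E ∂`, and
`∂ ∂⁻¹ = ∂⁻¹ ∂ = 1`, `Δ Δ⁻¹ = Δ⁻¹ Δ = 1`. -/
inductive Expr.Rel : Expr → Expr → Prop
  | refl (a) : Rel a a
  | symm {a b} : Rel a b → Rel b a
  | trans {a b c} : Rel a b → Rel b c → Rel a c
  | add_congr {a a' b b'} : Rel a a' → Rel b b' → Rel (add a b) (add a' b')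
  | smul_congr (c) {a a'} : Rel a a' → Rel (smul c a) (smul c a')
  | mul_congr {a a' b b'} : Rel a a' → Rel b b' → Rel (mul a b) (mul a' b')
  | dx_congr {a a'} : Rel a a' → Rel (dx a) (dx a')
  | dxInv_congr {a a'} : Rel a a' → Rel (dxInv a) (dxInv a')
  | shift_congr (k) {a a'} : Rel a a' → Rel (shift k a) (shift k a')
  | deltaInv_congr {a a'} : Rel a a' → Rel (deltaInv a) (deltaInv a')
  | add_assoc (a b c) : Rel (add (add a b) c) (add a (add b c))
  | add_comm (a b) : Rel (add a b) (add b a)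
  | zero_add (a) : Rel (add zero a) a
  | zero_smul (a) : Rel (smul 0 a) zero
  | one_smul (a) : Rel (smul 1 a) a
  | mul_smul (c d a) : Rel (smul (c * d) a) (smul c (smul d a))
  | add_smul (c d a) : Rel (smul (c + d) a) (add (smul c a) (smul d a))
  | smul_add (c a b) : Rel (smul c (add a b)) (add (smul c a) (smul c b))
  | mul_assoc (a b c) : Rel (mul (mul a b) c) (mul a (mul b c))
  | mul_comm (a b) : Rel (mul a b) (mul b a)
  | add_mul (a b c) : Rel (mul (add a b) c) (add (mul a c) (mul b c))
  | smul_mul (c a b) : Rel (mul (smul c a) b) (smul c (mul a b))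
  | dx_add (a b) : Rel (dx (add a b)) (add (dx a) (dx b))
  | dx_smul (c a) : Rel (dx (smul c a)) (add (smul (coefDx c) a) (smul c (dx a)))
  | dx_mul (a b) : Rel (dx (mul a b)) (add (mul (dx a) b) (mul a (dx b)))
  | shift_zero (a) : Rel (shift 0 a) a
  | shift_shift (j k a) : Rel (shift (j + k) a) (shift j (shift k a))
  | shift_add (k a b) : Rel (shift k (add a b)) (add (shift k a) (shift k b))
  | shift_smul (k c a) : Rel (shift k (smul c a)) (smul (coefShift k c) (shift k a))
  | shift_mul (k a b) : Rel (shift k (mul a b)) (mul (shift k a) (shift k b))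
  | shift_dx (k a) : Rel (shift k (dx a)) (dx (shift k a))
  | dx_dxInv (a) : Rel (dx (dxInv a)) a
  | dxInv_dx (a) : Rel (dxInv (dx a)) a
  | delta_deltaInv (a) :
      Rel (add (shift 1 (deltaInv a)) (smul (-1) (deltaInv a))) a
  | deltaInv_delta (a) : Rel (deltaInv (add (shift 1 a) (smul (-1) a))) a

instance Expr.setoid : Setoid Expr :=
  ⟨Expr.Rel, ⟨Expr.Rel.refl, Expr.Rel.symm, Expr.Rel.trans⟩⟩

/-- The function set `𝓕`: nonlocal differential-difference polynomials in `u`. -/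
def Fn : Type := Quotient Expr.setoid

namespace Fn

def mk (a : Expr) : Fn := Quotient.mk Expr.setoid a

theorem sound {a b : Expr} (h : Expr.Rel a b) : mk a = mk b := Quotient.sound h

/-- The field variable. -/
def u : Fn := mk Expr.u

instance : Zero Fn := ⟨mk Expr.zero⟩

instance : Add Fn :=
  ⟨Quotient.map₂ Expr.add fun _ _ h _ _ h' => Expr.Rel.add_congr h h'⟩

instance : Mul Fn :=
  ⟨Quotient.map₂ Expr.mul fun _ _ h _ _ h' => Expr.Rel.mul_congr h h'⟩

instance : SMul Coef Fn :=
  ⟨fun c => Quotient.map (Expr.smul c) fun _ _ h => Expr.Rel.smul_congr c h⟩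

instance : Neg Fn := ⟨fun f => (-1 : Coef) • f⟩

/-- `∂`. -/
def dx : Fn → Fn := Quotient.map Expr.dx fun _ _ h => Expr.Rel.dx_congr h

/-- `∂⁻¹`. -/
def dxInv : Fn → Fn := Quotient.map Expr.dxInv fun _ _ h => Expr.Rel.dxInv_congr h

/-- `E ^ k`. -/
def shift (k : ℤ) : Fn → Fn := Quotient.map (Expr.shift k) fun _ _ h => Expr.Rel.shift_congr k h

/-- `Δ⁻¹`. -/
def deltaInv : Fn → Fn := Quotient.map Expr.deltaInv fun _ _ h => Expr.Rel.deltaInv_congr h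

theorem ind {p : Fn → Prop} (h : ∀ a, p (mk a)) (f : Fn) : p f := Quotient.ind h f

theorem neg_def (f : Fn) : -f = (-1 : Coef) • f := rfl

protected theorem zero_add (f : Fn) : 0 + f = f :=
  ind (p := fun f => 0 + f = f) (fun a => sound (Expr.Rel.zero_add a)) f

protected theorem add_comm (f g : Fn) : f + g = g + f :=
  Quotient.inductionOn₂ f g fun a b => sound (Expr.Rel.add_comm a b)

protected theorem mul_comm (f g : Fn) : f * g = g * f :=
  Quotient.inductionOn₂ f g fun a b => sound (Expr.Rel.mul_comm a b)

protected theorem add_mul (f g k : Fn) : (f + g) * k = f * k + g * k :=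
  Quotient.inductionOn₃ f g k fun a b c => sound (Expr.Rel.add_mul a b c)

protected theorem zero_smul (f : Fn) : (0 : Coef) • f = 0 :=
  Quotient.inductionOn f fun a => sound (Expr.Rel.zero_smul a)

protected theorem one_smul (f : Fn) : (1 : Coef) • f = f :=
  Quotient.inductionOn f fun a => sound (Expr.Rel.one_smul a)

protected theorem add_smul (c d : Coef) (f : Fn) : (c + d) • f = c • f + d • f :=
  Quotient.inductionOn f fun a => sound (Expr.Rel.add_smul c d a)

protected theorem mul_smul (c d : Coef) (f : Fn) : (c * d) • f = c • d • f :=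
  Quotient.inductionOn f fun a => sound (Expr.Rel.mul_smul c d a)

protected theorem smul_add (c : Coef) (f g : Fn) : c • (f + g) = c • f + c • g :=
  Quotient.inductionOn₂ f g fun a b => sound (Expr.Rel.smul_add c a b)

protected theorem smul_mul (c : Coef) (f g : Fn) : (c • f) * g = c • (f * g) :=
  Quotient.inductionOn₂ f g fun a b => sound (Expr.Rel.smul_mul c a b)

protected theorem zero_mul (f : Fn) : 0 * f = 0 := by
  rw [← Fn.zero_smul 0, Fn.smul_mul, Fn.zero_smul, Fn.zero_smul]

instance : NonUnitalCommRing Fn where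
  add_assoc f g k := Quotient.inductionOn₃ f g k fun a b c => sound (Expr.Rel.add_assoc a b c)
  zero_add := Fn.zero_add
  add_zero f := by rw [Fn.add_comm, Fn.zero_add]
  add_comm := Fn.add_comm
  neg_add_cancel f := by
    rw [neg_def]
    nth_rewrite 2 [← Fn.one_smul f]
    rw [← Fn.add_smul, neg_add_cancel, Fn.zero_smul]
  nsmul := nsmulRec
  zsmul := zsmulRec
  mul_assoc f g k := Quotient.inductionOn₃ f g k fun a b c => sound (Expr.Rel.mul_assoc a b c)
  mul_comm := Fn.mul_comm
  right_distrib := Fn.add_mul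
  left_distrib f g k := by
    rw [Fn.mul_comm, Fn.add_mul, Fn.mul_comm g, Fn.mul_comm k]
  zero_mul := Fn.zero_mul
  mul_zero f := by rw [Fn.mul_comm, Fn.zero_mul]

instance : Module Coef Fn where
  one_smul := Fn.one_smul
  mul_smul := Fn.mul_smul
  smul_add := Fn.smul_add
  smul_zero c := by rw [← Fn.zero_smul 0, ← Fn.mul_smul, mul_zero]
  add_smul := Fn.add_smul
  zero_smul := Fn.zero_smul

instance : IsScalarTower Coef Fn Fn := ⟨Fn.smul_mul⟩

instance : SMulCommClass Coef Fn Fn :=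
  ⟨fun c f g => by
    change c • (f * g) = f * (c • g)
    rw [mul_comm f (c • g), Fn.smul_mul, mul_comm]⟩

instance : Module ℝ Fn := Module.compHom Fn (MvPolynomial.C : ℝ →+* Coef)

theorem real_smul_def (r : ℝ) (f : Fn) : r • f = (MvPolynomial.C r : Coef) • f := rfl

theorem dx_add (f g : Fn) : dx (f + g) = dx f + dx g :=
  Quotient.inductionOn₂ f g fun a b => sound (Expr.Rel.dx_add a b)

theorem dx_smul (c : Coef) (f : Fn) : dx (c • f) = coefDx c • f + c • dx f :=
  Quotient.inductionOn f fun a => sound (Expr.Rel.dx_smul c a)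

theorem dx_mul (f g : Fn) : dx (f * g) = dx f * g + f * dx g :=
  Quotient.inductionOn₂ f g fun a b => sound (Expr.Rel.dx_mul a b)

theorem shift_zero (f : Fn) : shift 0 f = f :=
  Quotient.inductionOn f fun a => sound (Expr.Rel.shift_zero a)

theorem shift_shift (j k : ℤ) (f : Fn) : shift (j + k) f = shift j (shift k f) :=
  Quotient.inductionOn f fun a => sound (Expr.Rel.shift_shift j k a)

theorem shift_add (k : ℤ) (f g : Fn) : shift k (f + g) = shift k f + shift k g :=
  Quotient.inductionOn₂ f g fun a b => sound (Expr.Rel.shift_add k a b)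

theorem shift_smul (k : ℤ) (c : Coef) (f : Fn) : shift k (c • f) = coefShift k c • shift k f :=
  Quotient.inductionOn f fun a => sound (Expr.Rel.shift_smul k c a)

theorem shift_mul (k : ℤ) (f g : Fn) : shift k (f * g) = shift k f * shift k g :=
  Quotient.inductionOn₂ f g fun a b => sound (Expr.Rel.shift_mul k a b)

theorem shift_dx (k : ℤ) (f : Fn) : shift k (dx f) = dx (shift k f) :=
  Quotient.inductionOn f fun a => sound (Expr.Rel.shift_dx k a)

theorem dx_dxInv (f : Fn) : dx (dxInv f) = f :=
  Quotient.inductionOn f fun a => sound (Expr.Rel.dx_dxInv a)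

theorem dxInv_dx (f : Fn) : dxInv (dx f) = f :=
  Quotient.inductionOn f fun a => sound (Expr.Rel.dxInv_dx a)

theorem delta_deltaInv (f : Fn) : shift 1 (deltaInv f) + (-1 : Coef) • deltaInv f = f :=
  Quotient.inductionOn f fun a => sound (Expr.Rel.delta_deltaInv a)

theorem deltaInv_delta (f : Fn) : deltaInv (shift 1 f + (-1 : Coef) • f) = f :=
  Quotient.inductionOn f fun a => sound (Expr.Rel.deltaInv_delta a)

/-! ### Substitution -/

/-- Substituting the function `v` for `u` in an expression. -/
def substExpr (v : Fn) : Expr → Fn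
  | Expr.u => v
  | Expr.zero => 0
  | Expr.add a b => substExpr v a + substExpr v b
  | Expr.smul c a => c • substExpr v a
  | Expr.mul a b => substExpr v a * substExpr v b
  | Expr.dx a => dx (substExpr v a)
  | Expr.dxInv a => dxInv (substExpr v a)
  | Expr.shift k a => shift k (substExpr v a)
  | Expr.deltaInv a => deltaInv (substExpr v a)

theorem substExpr_congr (v : Fn) {a b : Expr} (h : Expr.Rel a b) :
    substExpr v a = substExpr v b := by
  induction h with
  | refl => rfl
  | symm _ ih => exact ih.symm
  | trans _ _ ih ih' => exact ih.trans ih'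
  | add_congr _ _ ih ih' => simp only [substExpr, ih, ih']
  | smul_congr _ _ ih => simp only [substExpr, ih]
  | mul_congr _ _ ih ih' => simp only [substExpr, ih, ih']
  | dx_congr _ ih => simp only [substExpr, ih]
  | dxInv_congr _ ih => simp only [substExpr, ih]
  | shift_congr _ _ ih => simp only [substExpr, ih]
  | deltaInv_congr _ ih => simp only [substExpr, ih]
  | add_assoc => exact add_assoc _ _ _
  | add_comm => exact add_comm _ _
  | zero_add => exact zero_add _
  | zero_smul => exact zero_smul _ _
  | one_smul => exact one_smul _ _
  | mul_smul => exact mul_smul _ _ _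
  | add_smul => exact add_smul _ _ _
  | smul_add => exact smul_add _ _ _
  | mul_assoc => exact mul_assoc _ _ _
  | mul_comm => exact mul_comm _ _
  | add_mul => exact add_mul _ _ _
  | smul_mul => exact smul_mul_assoc _ _ _
  | dx_add => exact dx_add _ _
  | dx_smul => exact dx_smul _ _
  | dx_mul => exact dx_mul _ _
  | shift_zero => exact shift_zero _
  | shift_shift => exact shift_shift _ _ _
  | shift_add => exact shift_add _ _ _
  | shift_smul => exact shift_smul _ _ _
  | shift_mul => exact shift_mul _ _ _
  | shift_dx => exact shift_dx _ _
  | dx_dxInv => exact dx_dxInv _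
  | dxInv_dx => exact dxInv_dx _
  | delta_deltaInv => exact delta_deltaInv _
  | deltaInv_delta => exact deltaInv_delta _

/-- `subst v f` is `f(v)`: the function `f = f(u)` with `v` in place of `u`. The coefficients,
that is the explicit dependence on `x`, `n`, `t`, stay as they are. -/
def subst (v : Fn) : Fn → Fn := Quotient.lift (substExpr v) fun _ _ h => substExpr_congr v h

/-! ### Derivatives with respect to `u` and to the explicit time -/

/-- The derivative of an expression `f(t, u)` at `ε = 0` along `t ↦ t + ε b`, `u ↦ u + ε g`. -/
def alongExpr (b : ℝ) (g : Fn) : Expr → Fn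
  | Expr.u => g
  | Expr.zero => 0
  | Expr.add p q => alongExpr b g p + alongExpr b g q
  | Expr.smul c p => (b • coefDt c) • mk p + c • alongExpr b g p
  | Expr.mul p q => alongExpr b g p * mk q + mk p * alongExpr b g q
  | Expr.dx p => dx (alongExpr b g p)
  | Expr.dxInv p => dxInv (alongExpr b g p)
  | Expr.shift k p => shift k (alongExpr b g p)
  | Expr.deltaInv p => deltaInv (alongExpr b g p)

theorem alongExpr_congr (b : ℝ) (g : Fn) {p q : Expr} (h : Expr.Rel p q) :
    alongExpr b g p = alongExpr b g q := by
  have mk_add : ∀ p q, mk (Expr.add p q) = mk p + mk q := fun _ _ => rfl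
  have mk_mul : ∀ p q, mk (Expr.mul p q) = mk p * mk q := fun _ _ => rfl
  have mk_smul : ∀ c p, mk (Expr.smul c p) = c • mk p := fun _ _ => rfl
  have mk_dx : ∀ p, mk (Expr.dx p) = dx (mk p) := fun _ => rfl
  have mk_shift : ∀ k p, mk (Expr.shift k p) = shift k (mk p) := fun _ _ => rfl
  have hm1 : coefDt (-1) = 0 := by simp
  induction h with
  | refl => rfl
  | symm _ ih => exact ih.symm
  | trans _ _ ih ih' => exact ih.trans ih'
  | add_congr _ _ ih ih' => simp only [alongExpr, ih, ih']
  | smul_congr _ h ih => simp only [alongExpr, ih, sound h]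
  | mul_congr h h' ih ih' => simp only [alongExpr, ih, ih', sound h, sound h']
  | dx_congr _ ih => simp only [alongExpr, ih]
  | dxInv_congr _ ih => simp only [alongExpr, ih]
  | shift_congr _ _ ih => simp only [alongExpr, ih]
  | deltaInv_congr _ ih => simp only [alongExpr, ih]
  | add_assoc => exact add_assoc _ _ _
  | add_comm => exact add_comm _ _
  | zero_add => exact zero_add _
  | zero_smul => simp [alongExpr]
  | one_smul => simp [alongExpr]
  | mul_smul c d a =>
    simp only [alongExpr, mk_smul, Derivation.leibniz, smul_add, smul_eq_mul, add_smul, mul_smul]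
    rw [smul_comm c (b • coefDt d), ← mul_smul (b • coefDt d) c, ← mul_smul (b • coefDt c) d,
      smul_mul_assoc, smul_mul_assoc, mul_comm (coefDt c), mul_comm (coefDt d)]
    abel
  | add_smul => simp only [alongExpr, map_add, smul_add, add_smul]; abel
  | smul_add => simp only [alongExpr, mk_add, smul_add]; abel
  | mul_assoc => simp only [alongExpr, mk_mul, mul_add, add_mul, mul_assoc, add_assoc]
  | mul_comm p q =>
    simp only [alongExpr]
    rw [mul_comm (mk p), mul_comm (mk q), add_comm]
  | add_mul => simp only [alongExpr, mk_add, add_mul]; abel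
  | smul_mul =>
    simp only [alongExpr, mk_smul, mk_mul, add_mul, smul_add, smul_mul_assoc]; abel
  | dx_add => exact dx_add _ _
  | dx_smul c a =>
    have e : coefDx (b • coefDt c) = b • coefDt (coefDx c) := by
      rw [coefDt_dx, Derivation.map_smul]
    simp only [alongExpr, mk_dx, dx_add, dx_smul, e]; abel
  | dx_mul => simp only [alongExpr, mk_dx, dx_add, dx_mul]; abel
  | shift_zero => exact shift_zero _
  | shift_shift => exact shift_shift _ _ _
  | shift_add => exact shift_add _ _ _
  | shift_smul k c a =>
    have e : coefShift k (b • coefDt c) = b • coefDt (coefShift k c) := by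
      rw [coefDt_shift, map_smul]
    simp only [alongExpr, mk_shift, shift_add, shift_smul, e]
  | shift_mul => simp only [alongExpr, mk_shift, shift_add, shift_mul]
  | shift_dx => exact shift_dx _ _
  | dx_dxInv => exact dx_dxInv _
  | dxInv_dx => exact dxInv_dx _
  | delta_deltaInv =>
    simp only [alongExpr, hm1, smul_zero, zero_smul, zero_add]; exact delta_deltaInv _
  | deltaInv_delta =>
    simp only [alongExpr, hm1, smul_zero, zero_smul, zero_add]; exact deltaInv_delta _

/-- The derivative of `f(t, u)` at `ε = 0` along `t ↦ t + ε b`, `u ↦ u + ε g`. -/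
def along (b : ℝ) (g : Fn) : Fn →ₗ[ℝ] Fn where
  toFun := Quotient.lift (alongExpr b g) fun _ _ h => alongExpr_congr b g h
  map_add' f k := Quotient.inductionOn₂ f k fun _ _ => rfl
  map_smul' r f := Quotient.inductionOn f fun p => by
    change (b • coefDt (MvPolynomial.C r)) • mk p + _ = _
    have e : coefDt (MvPolynomial.C r) = 0 := Derivation.map_algebraMap coefDt r
    rw [e, smul_zero, zero_smul, zero_add]
    rfl

/-- The Gateaux derivative `f'[g]`. -/
def gateaux (f g : Fn) : Fn := along 0 g f

/-- The derivative of `f` with respect to the time contained explicitly in `f`. -/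
def explicitDt (f : Fn) : Fn := along 1 0 f

/-- The Lie product `⟦f, g⟧ = f'[g] - g'[f]`. -/
def lie (f g : Fn) : Fn := gateaux f g - gateaux g f

end Fn

/-! ## Functionals

A functional is a sum of integrals `∑ₙ ∫ f g dx` of products of two elements of `𝓕`. These symbols
are bilinear, depend only on the product `f g`, and obey integration by parts in `x` and
summation by parts in `n`. -/

inductive FunctionalRel : Fn ⊗[ℝ] Fn → Prop
  | symm (f g : Fn) : FunctionalRel (f ⊗ₜ g - g ⊗ₜ f)
  | mul (f g k : Fn) : FunctionalRel ((f * g) ⊗ₜ k - f ⊗ₜ (g * k))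
  | smul (c : Coef) (f g : Fn) : FunctionalRel ((c • f) ⊗ₜ g - f ⊗ₜ (c • g))
  | byParts (f g : Fn) : FunctionalRel (Fn.dx f ⊗ₜ g + f ⊗ₜ Fn.dx g)
  | shift (k : ℤ) (f g : Fn) : FunctionalRel (Fn.shift k f ⊗ₜ Fn.shift k g - f ⊗ₜ g)

def functionalRelations : Submodule ℝ (Fn ⊗[ℝ] Fn) := Submodule.span ℝ {z | FunctionalRel z}

/-- The space of functionals. -/
abbrev Functional : Type := (Fn ⊗[ℝ] Fn) ⧸ functionalRelations

/-- The integral `∑ₙ ∫ f g dx`. -/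
def integral (f g : Fn) : Functional := functionalRelations.mkQ (f ⊗ₜ g)

/-- The inner product `(f, g) = (h² / 2) ∑ₙ ∫ f g dx`. -/
def inner (h : ℝ) (f g : Fn) : Functional := (h ^ 2 / 2) • integral f g

namespace Fn

theorem along_dx (b : ℝ) (g f : Fn) : along b g (dx f) = dx (along b g f) :=
  Quotient.inductionOn f fun _ => rfl

theorem along_shift (b : ℝ) (g : Fn) (k : ℤ) (f : Fn) :
    along b g (shift k f) = shift k (along b g f) :=
  Quotient.inductionOn f fun _ => rfl

theorem along_smul (b : ℝ) (g : Fn) (c : Coef) (f : Fn) :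
    along b g (c • f) = (b • coefDt c) • f + c • along b g f :=
  Quotient.inductionOn f fun _ => rfl

theorem along_mul (b : ℝ) (g f k : Fn) :
    along b g (f * k) = along b g f * k + f * along b g k :=
  Quotient.inductionOn₂ f k fun _ _ => rfl

/-- Multiplication by the time. -/
def timeMul : Fn →ₗ[ℝ] Fn where
  toFun f := ct • f
  map_add' := smul_add _
  map_smul' r f := by
    simp only [real_smul_def, RingHom.id_apply]
    rw [smul_comm]

end Fn

namespace Functional

open Fn in
/-- The derivative of a functional at `ε = 0` along `t ↦ t + ε b`, `u ↦ u + ε g`, determined by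
`∑ₙ ∫ f k dx ↦ ∑ₙ ∫ (f' k + f k') dx`. -/
def along (b : ℝ) (g : Fn) : Functional →ₗ[ℝ] Functional :=
  Submodule.mapQ _ _
    (TensorProduct.map (Fn.along b g) LinearMap.id +
      TensorProduct.map LinearMap.id (Fn.along b g)) (by
    refine Submodule.span_le.2 ?_
    have mem : ∀ {z}, FunctionalRel z → z ∈ functionalRelations := fun h => Submodule.subset_span h
    rintro z (⟨f, k⟩ | ⟨f, k, l⟩ | ⟨c, f, k⟩ | ⟨f, k⟩ | ⟨j, f, k⟩) <;>
      simp only [Submodule.comap_coe, Set.mem_preimage, SetLike.mem_coe, map_sub, map_add,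
        LinearMap.add_apply, TensorProduct.map_tmul, LinearMap.id_apply]
    · convert add_mem (mem (.symm (Fn.along b g f) k)) (mem (.symm f (Fn.along b g k))) using 1
      abel
    · convert add_mem (add_mem (mem (.mul (Fn.along b g f) k l)) (mem (.mul f (Fn.along b g k) l)))
        (mem (.mul f k (Fn.along b g l))) using 1
      simp only [along_mul, TensorProduct.add_tmul, TensorProduct.tmul_add]
      abel
    · convert add_mem (add_mem (mem (.smul (b • coefDt c) f k)) (mem (.smul c (Fn.along b g f) k)))
        (mem (.smul c f (Fn.along b g k))) using 1
      simp only [along_smul, TensorProduct.add_tmul, TensorProduct.tmul_add]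
      abel
    · convert add_mem (mem (.byParts (Fn.along b g f) k)) (mem (.byParts f (Fn.along b g k)))
        using 1
      simp only [along_dx]
      abel
    · convert add_mem (mem (.shift j (Fn.along b g f) k)) (mem (.shift j f (Fn.along b g k)))
        using 1
      simp only [along_shift]
      abel)

/-- The Gateaux derivative `I'[g]` of a functional. -/
def gateaux (I : Functional) (g : Fn) : Functional := along 0 g I

/-- The derivative of a functional with respect to the time contained explicitly in it. -/
def explicitDt (I : Functional) : Functional := along 1 0 I

open Fn in
/-- Multiplication of functionals by the time. -/
def timeMul : Functional →ₗ[ℝ] Functional :=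
  Submodule.mapQ _ _ (TensorProduct.map Fn.timeMul LinearMap.id) (by
    refine Submodule.span_le.2 ?_
    have mem : ∀ {z}, FunctionalRel z → z ∈ functionalRelations := fun h => Submodule.subset_span h
    have hx : coefDx ct = 0 := by
      simp [coefDx]
    have hs : ∀ j, coefShift j ct = ct := by
      intro j; simp [coefShift, shiftVar]
    have tm : ∀ f, Fn.timeMul f = ct • f := fun _ => rfl
    rintro z (⟨f, k⟩ | ⟨f, k, l⟩ | ⟨c, f, k⟩ | ⟨f, k⟩ | ⟨j, f, k⟩) <;>
      simp only [Submodule.comap_coe, Set.mem_preimage, SetLike.mem_coe, map_sub, map_add,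
        TensorProduct.map_tmul, LinearMap.id_apply, tm]
    · convert sub_mem (mem (.symm (ct • f) k)) (mem (.smul ct k f)) using 1
      abel
    · rw [← smul_mul_assoc]
      exact mem (.mul _ _ _)
    · rw [smul_comm]
      exact mem (.smul _ _ _)
    · have e : ct • dx f = dx (ct • f) := by rw [dx_smul, hx, zero_smul, zero_add]
      rw [e]
      exact mem (.byParts _ _)
    · have e : ct • shift j f = shift j (ct • f) := by rw [shift_smul, hs]
      rw [e]
      exact mem (.shift _ _ _))

/-- `v` is the integral over `[0, 1]` of a path `φ` of functionals. -/
def IsIntegral01 (φ : ℝ → Functional) (v : Functional) : Prop :=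
  ∀ ℓ : Functional →ₗ[ℝ] ℝ,
    IntervalIntegrable (fun r => ℓ (φ r)) MeasureTheory.volume 0 1 ∧
      ∫ r in (0 : ℝ)..1, ℓ (φ r) = ℓ v

/-- `v` is the functional `∫₀¹ (f(λ u), u) dλ`. -/
def IsPotential (h : ℝ) (f : Fn) (v : Functional) : Prop :=
  IsIntegral01 (fun r => inner h (Fn.subst (r • Fn.u) f) Fn.u) v

/-- The functional `∫₀¹ (f(λ u), u) dλ`. -/
def potential (h : ℝ) (f : Fn) : Functional := Classical.epsilon (IsPotential h f)

end Functional

/-! ## Symmetries, conserved covariants and conserved quantities of `u_t = K` -/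

/-- `κ` is a symmetry of `u_t = K`. -/
def IsSymmetry (K κ : Fn) : Prop := Fn.explicitDt κ = Fn.lie K κ

/-- `S` is an adjoint of the operator `T` with respect to the inner product. -/
def IsAdjoint (h : ℝ) (T S : Fn → Fn) : Prop := ∀ f g, inner h (T f) g = inner h f (S g)

/-- `γ` is a conserved covariant of `u_t = K`. -/
def IsConservedCovariant (h : ℝ) (K γ : Fn) : Prop :=
  ∃ S : Fn →ₗ[ℝ] Fn, IsAdjoint h (Fn.gateaux K) S ∧
    -Fn.explicitDt γ = Fn.gateaux γ K + S γ

/-- `I` is a conserved quantity of `u_t = K`: its total derivative with respect to `t` vanishes. -/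
def IsConserved (K : Fn) (I : Functional) : Prop :=
  Functional.explicitDt I + Functional.gateaux I K = 0

/-! ## Pseudo-difference operators -/

/-- Coefficients of operators: `c + f` with `c` a polynomial in `x`, `n`, `t` and `f ∈ 𝓕`. The
polynomial `c` is the value at `u = 0`. -/
abbrev OpCoef : Type := Unitization Coef Fn

namespace OpCoef

def dx (a : OpCoef) : OpCoef := Unitization.inl (coefDx a.fst) + Unitization.inr (Fn.dx a.snd)

def shift (k : ℤ) (a : OpCoef) : OpCoef :=
  Unitization.inl (coefShift k a.fst) + Unitization.inr (Fn.shift k a.snd)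

def delta (a : OpCoef) : OpCoef := shift 1 a - a

end OpCoef

/-- `a` stands for the operator `∑ₖ a(k) Δ ^ k`. Only operators whose order is bounded above
occur below. -/
def PDO : Type := ℤ → OpCoef

namespace PDO

instance : AddCommGroup PDO := inferInstanceAs (AddCommGroup (ℤ → OpCoef))

/-- The composition, which extends
`Δ ^ s b = ∑ᵢ C(s, i) (Δ ^ i E ^ (s - i) b) Δ ^ (s - i)`. -/
def comp (a b : PDO) : PDO := fun k =>
  ∑ᶠ p : ℤ × ℕ, Ring.choose p.1 p.2 •
    (a p.1 * OpCoef.delta^[p.2] (OpCoef.shift (p.1 - p.2) (b (k - p.1 + p.2))))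

def comm (a b : PDO) : PDO := comp a b - comp b a

/-- The operator of multiplication by `a`. -/
def ofCoef (a : OpCoef) : PDO := fun k => if k = 0 then a else 0

def pow (a : PDO) : ℕ → PDO
  | 0 => ofCoef 1
  | m + 1 => comp (pow a m) a

/-- The difference part `( )₊`. -/
def pos (a : PDO) : PDO := fun k => if 0 ≤ k then a k else 0

/-- The derivative of the coefficients with respect to `x`. -/
def dx (a : PDO) : PDO := fun k => OpCoef.dx (a k)

def realSmul (r : ℝ) (a : PDO) : PDO := fun k => (MvPolynomial.C r : Coef) • a k

end PDO

/-! ## The two hierarchies -/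

/-- `A_m = (L ^ m)₊`. -/
def opA (L : PDO) (m : ℕ) : PDO := PDO.pos (PDO.pow L m)

/-- `L = h⁻¹ Δ + u + h u₁ Δ⁻¹ + h² u₂ Δ⁻² + ⋯` with all `u_j ∈ 𝓕`, and `L_x = [A₁, L]`. -/
structure IsLax (h : ℝ) (L : PDO) : Prop where
  order : ∀ k : ℤ, 1 < k → L k = 0
  lead : L 1 = Unitization.inl (MvPolynomial.C h⁻¹)
  zeroth : L 0 = Unitization.inr Fn.u
  lower : ∀ k : ℤ, k < 0 → (L k).fst = 0
  lax : PDO.dx L = PDO.comm (opA L 1) L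

/-- `B` is a difference operator of order at most `m` with
`B|_{u = 0} = h^{-(m-1)} x Δ ^ m + h^{-(m-1)} (x + h n) Δ ^ (m - 1)` such that
`L_t = [B, L] + h L ^ m + L ^ (m - 1)` has, as `L_t` must, no positive powers of `Δ`. -/
structure IsNonisospectral (h : ℝ) (L : PDO) (m : ℕ) (B : PDO) : Prop where
  order : ∀ k : ℤ, (m : ℤ) < k → B k = 0
  difference : ∀ k : ℤ, k < 0 → B k = 0
  asymptotic : ∀ k : ℤ, (B k).fst =
    if k = m then MvPolynomial.C ((h⁻¹) ^ (m - 1)) * cx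
    else if k = (m : ℤ) - 1 then
      MvPolynomial.C ((h⁻¹) ^ (m - 1)) * (cx + MvPolynomial.C h * cn)
    else 0
  lax : ∀ k : ℤ, 0 < k →
    (PDO.comm B L + PDO.realSmul h (PDO.pow L m) + PDO.pow L (m - 1)) k = 0

/-- `B_x - [A₁, B]`. -/
def curvature (L B : PDO) : PDO := PDO.dx B - PDO.comm (opA L 1) B

/-- The isospectral flows `K_m = A_{m,x} - [A₁, A_m]`, with `K₀ = 0`. -/
def flowK (L : PDO) : ℕ → Fn
  | 0 => 0
  | m + 1 => (curvature L (opA L (m + 1)) 0).snd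

/-- The non-isospectral flows `σ_m = B_{m,x} - [A₁, B_m]`, with `σ₀ = 0`. -/
def flowSigma (L : PDO) (B : ℕ → PDO) : ℕ → Fn
  | 0 => 0
  | m + 1 => (curvature L (B (m + 1)) 0).snd

/-- `γ_m = ∂⁻¹ K_m`. -/
def gam (L : PDO) (m : ℕ) : Fn := Fn.dxInv (flowK L m)

/-- `ω_m = ∂⁻¹ σ_m`. -/
def omg (L : PDO) (B : ℕ → PDO) (m : ℕ) : Fn := Fn.dxInv (flowSigma L B m)

/-- The Hamiltonians `H_m` of the isospectral hierarchy, with `H₀ = 0`. -/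
def hamH (h : ℝ) (L : PDO) (B : ℕ → PDO) : ℕ → Functional
  | 0 => 0
  | 1 => (1 / 2 : ℝ) • inner h Fn.u Fn.u
  | m + 2 => h⁻¹ •
      ((1 / ((m : ℝ) + 1)) • inner h (gam L (m + 1)) (flowSigma L B 2) - hamH h L B (m + 1))

/-- The Hamiltonians `J_m` of the non-isospectral hierarchy. For `m > 1`, `m ≠ 3`,
`J_m = h⁻¹ ((m - 3)⁻¹ (ω_{m-1}, σ₂) - J_{m-1})`. -/
def hamJ (h : ℝ) (L : PDO) (B : ℕ → PDO) : ℕ → Functional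
  | 0 => 0
  | 1 => (h / 2) • inner h (cx • Fn.u) Fn.u
  | 2 => h⁻¹ • ((1 / ((2 : ℝ) - 3)) • inner h (omg L B 1) (flowSigma L B 2) - hamJ h L B 1)
  | 3 => Functional.potential h (omg L B 3)
  | m + 4 => h⁻¹ •
      ((1 / ((m : ℝ) + 1)) • inner h (omg L B (m + 3)) (flowSigma L B 2) - hamJ h L B (m + 3))

/-- `τ^s_r = s t (h K_{s+r-1} + K_{s+r-2}) + σ_r`, with `τ^s_0 = 0`. -/
def tau (h : ℝ) (L : PDO) (B : ℕ → PDO) (s : ℕ) : ℕ → Fn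
  | 0 => 0
  | r + 1 => (s : ℝ) • ct • (h • flowK L (s + (r + 1) - 1) + flowK L (s + (r + 1) - 2))
      + flowSigma L B (r + 1)

/-- `ϑ^s_r = ∂⁻¹ τ^s_r`. -/
def theta (h : ℝ) (L : PDO) (B : ℕ → PDO) (s r : ℕ) : Fn := Fn.dxInv (tau h L B s r)

/-- `I^s_r = s t (h H_{s+r-1} + H_{s+r-2}) + J_r`, with `I^s_0 = 0`. -/
def conI (h : ℝ) (L : PDO) (B : ℕ → PDO) (s : ℕ) : ℕ → Functional
  | 0 => 0
  | r + 1 => (s : ℝ) • Functional.timeMul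
        (h • hamH h L B (s + (r + 1) - 1) + hamH h L B (s + (r + 1) - 2))
      + hamJ h L B (r + 1)

end

end DDKP

namespace DDKP
noncomputable section

/-! ## Operations on coefficients -/

/-! Rewriting operators in powers of `E` instead of `Δ` respects products, difference parts,
coefficient derivations and vanishing at `u = 0` (`ofDelta_compDelta`, `ofDelta_posPart`). In powers
of `E` everything comes from the derivation `[∂ - A₁, ·]` with `A₁ = h⁻¹ Δ + u` (`mder`). Its
component of order `k` contains the coefficient of order `k - 1` only through `h⁻¹ Δ`, and `Δ` is
bijective on `𝓕`. So on operators that vanish at `u = 0` it is invertible, and the inverse lowers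
the order by one (`exists_mder_eq`, `eq_zero_of_mder_eq_zero`). An operator that commutes with `∂ -
A₁` is therefore determined by its value at `u = 0`.

This principle produces `L` from `h⁻¹ Δ` and an Orlov-Schulman operator `Γ` from `x E + h n`. It
also gives `[L, Γ] = h L + 1`, since both sides commute with `∂ - A₁` and agree at `u = 0`. Then
`A_m = (L^m)₊` and `B_m = (Γ L^(m-1))₊`.

If `C` commutes with `∂ - A₁` and `C|_{u = 0}` is a difference operator, then `[∂ - A₁, C₊] = -[∂ -
A₁, C₋]`. The left side has no negative orders and the right side no positive ones, so both are
multiplication by `K_C = ∂ γ_C`, with `γ_C` the `𝓕`-part of the coefficient of `E ^ 0`. Varying `u`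
in the direction `g` changes `C` by `[X, C]`, where `[∂ - A₁, X] = g`; for `g = K_D` one takes `X =
-D₋`. Hence `γ_C'[K_D] - γ_D'[K_C] = γ_[C,D]` and `⟦K_C, K_D⟧ = K_[C,D]` (`gateaux_covariant_sub`,
`lie_flow`). The trace pairing `∑ₙ ∫ (A B)₀ dx` makes `[∂ - A₁, ·]` skew, which gives
self-adjointness of `γ_C'`.

Self-adjointness makes `γ_[D,C]` the gradient of `(K_C, γ_D)` (`isGradient_inner_flow`). There are
no constants, so the Euler operator has only positive eigenvalues and a functional is determined by
its gradient (`IsGradient.unique`). Thus `H_m` and `J_m` are identified by their gradients `γ_m` and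
`ω_m`, and all the relations reduce to commutators of `L^l` and `Γ L^r`. The terms with explicit
time are then linear bookkeeping. -/

theorem coefShift_zero (c : Coef) : coefShift 0 c = c := by
  have : coefShift 0 = AlgHom.id ℝ Coef := by
    refine MvPolynomial.algHom_ext fun i => ?_
    cases i <;> simp [coefShift, shiftVar]
  rw [this]; rfl

theorem coefShift_add (j k : ℤ) (c : Coef) :
    coefShift (j + k) c = coefShift j (coefShift k c) := by
  have : coefShift (j + k) = (coefShift j).comp (coefShift k) := by
    refine MvPolynomial.algHom_ext fun i => ?_
    cases i
    · simp [coefShift, shiftVar]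
    · simp only [coefShift, shiftVar, MvPolynomial.aeval_X, AlgHom.comp_apply, map_add,
        MvPolynomial.aeval_C, MvPolynomial.algebraMap_eq]
      push_cast
      rw [map_add]; ring
    · simp [coefShift, shiftVar]
  rw [this]; rfl

theorem coefDx_shift (k : ℤ) (c : Coef) : coefDx (coefShift k c) = coefShift k (coefDx c) := by
  classical
  induction c using MvPolynomial.induction_on with
  | C a => simp [coefDx, coefShift, MvPolynomial.algebraMap_eq]
  | add p q hp hq => simp [hp, hq]
  | mul_X p i hp =>
    rw [map_mul, Derivation.leibniz, hp, Derivation.leibniz, map_add, smul_eq_mul, smul_eq_mul,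
      smul_eq_mul, smul_eq_mul, map_mul, map_mul]
    congr 2
    cases i <;> simp [coefDx, coefShift, shiftVar, MvPolynomial.pderiv_X]

namespace Fn

theorem dx_zero : dx 0 = 0 := by
  have h := dx_add 0 0
  rw [add_zero] at h
  exact left_eq_add.1 h

theorem shift_map_zero (k : ℤ) : shift k 0 = 0 := by
  have h := shift_add k 0 0
  rw [add_zero] at h
  exact left_eq_add.1 h

theorem along_u (b : ℝ) (g : Fn) : along b g u = g := rfl

theorem along_dxInv (b : ℝ) (g f : Fn) : along b g (dxInv f) = dxInv (along b g f) :=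
  Quotient.inductionOn f fun _ => rfl

theorem along_deltaInv (b : ℝ) (g f : Fn) :
    along b g (deltaInv f) = deltaInv (along b g f) :=
  Quotient.inductionOn f fun _ => rfl

theorem dx_injective : Function.Injective dx := Function.LeftInverse.injective dxInv_dx

theorem shift_one_sub_deltaInv (f : Fn) : shift 1 (deltaInv f) - deltaInv f = f := by
  have h := delta_deltaInv f
  rwa [← neg_def, ← sub_eq_add_neg] at h

/-- The rule `Δ⁻¹ Δ = 1` leaves no constants of summation. All uniqueness statements for operators
rest on this. -/
theorem eq_zero_of_shift_one_sub {f : Fn} (h : shift 1 f - f = 0) : f = 0 := by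
  have h1 := deltaInv_delta f
  rw [← neg_def, ← sub_eq_add_neg, h] at h1
  have h2 := deltaInv_delta 0
  rw [shift_map_zero, smul_zero, add_zero] at h2
  rw [← h1, h2]

/-- `∂` as an additive map. -/
def dxHom : Fn →+ Fn := ⟨⟨dx, dx_zero⟩, dx_add⟩

theorem dx_neg (f : Fn) : dx (-f) = -dx f := map_neg dxHom f

theorem dx_sub (f g : Fn) : dx (f - g) = dx f - dx g := map_sub dxHom f g

theorem shift_neg (k : ℤ) (f : Fn) : shift k (-f) = -shift k f := by
  rw [neg_def, shift_smul, map_neg, map_one, ← neg_def]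

theorem shift_sub (k : ℤ) (f g : Fn) : shift k (f - g) = shift k f - shift k g := by
  rw [sub_eq_add_neg, shift_add, shift_neg, sub_eq_add_neg]

end Fn

/-! ### Shifts and derivations of operator coefficients -/

namespace OpCoef

theorem ext {a b : OpCoef} (h1 : a.fst = b.fst) (h2 : a.snd = b.snd) : a = b :=
  Unitization.ext h1 h2

@[simp] theorem fst_sub (a b : OpCoef) : (a - b).fst = a.fst - b.fst := by
  rw [sub_eq_add_neg, Unitization.fst_add, Unitization.fst_neg, sub_eq_add_neg]

@[simp] theorem snd_sub (a b : OpCoef) : (a - b).snd = a.snd - b.snd := by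
  rw [sub_eq_add_neg, Unitization.snd_add, Unitization.snd_neg, sub_eq_add_neg]

/-- `E ^ k` as a ring homomorphism. -/
def sh (k : ℤ) : OpCoef →+* OpCoef where
  toFun := shift k
  map_one' := ext (by simp [shift]) (by simp [shift, Fn.shift_map_zero])
  map_zero' := ext (by simp [shift]) (by simp [shift, Fn.shift_map_zero])
  map_add' a b := ext (by simp [shift]) (by simp [shift, Fn.shift_add])
  map_mul' a b := ext (by simp [shift])
    (by simp [shift, Fn.shift_add, Fn.shift_smul, Fn.shift_mul])

theorem shift_eq (k : ℤ) (a : OpCoef) : shift k a = sh k a := rfl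

@[simp] theorem sh_fst (k : ℤ) (a : OpCoef) : (sh k a).fst = coefShift k a.fst := by
  simp [sh, shift]

@[simp] theorem sh_snd (k : ℤ) (a : OpCoef) : (sh k a).snd = Fn.shift k a.snd := by
  simp [sh, shift]

@[simp] theorem sh_zero (a : OpCoef) : sh 0 a = a :=
  ext (by simp [coefShift_zero]) (by simp [Fn.shift_zero])

theorem sh_add (j k : ℤ) (a : OpCoef) : sh (j + k) a = sh j (sh k a) :=
  ext (by simp [coefShift_add]) (by simp [Fn.shift_shift])

theorem sh_sh (j k : ℤ) (a : OpCoef) : sh j (sh k a) = sh (j + k) a := (sh_add j k a).symm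

theorem sh_finsum {ι : Type*} (k : ℤ) {f : ι → OpCoef} (hf : (Function.support f).Finite) :
    sh k (∑ᶠ i, f i) = ∑ᶠ i, sh k (f i) :=
  AddMonoidHom.map_finsum (sh k).toAddMonoidHom hf

/-- A derivation of the coefficients that commutes with the shifts. -/
structure ShiftDerivation where
  toHom : OpCoef →+ OpCoef
  leibniz : ∀ a b, toHom (a * b) = toHom a * b + a * toHom b
  comm_shift : ∀ k a, toHom (sh k a) = sh k (toHom a)

/-- `∂`. -/
def dxDer : ShiftDerivation where
  toHom :=
    { toFun := dx
      map_zero' := ext (by simp [dx]) (by simp [dx, Fn.dx_zero])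
      map_add' := fun a b => ext (by simp [dx]) (by simp [dx, Fn.dx_add]) }
  leibniz a b := ext (by simp [dx, mul_comm]; ring) (by
    simp [dx, Fn.dx_add, Fn.dx_smul, Fn.dx_mul]; abel)
  comm_shift k a := ext (by simp [dx, coefDx_shift, sh, shift])
    (by simp [dx, Fn.shift_dx, sh, shift])

@[simp] theorem dxDer_fst (a : OpCoef) : (dxDer.toHom a).fst = coefDx a.fst := by
  simp [dxDer, dx]

@[simp] theorem dxDer_snd (a : OpCoef) : (dxDer.toHom a).snd = Fn.dx a.snd := by
  simp [dxDer, dx]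

/-- The derivative along `t ↦ t + ε b`, `u ↦ u + ε g`. -/
def alongDer (b : ℝ) (g : Fn) : ShiftDerivation where
  toHom :=
    { toFun := fun a => Unitization.inl (b • coefDt a.fst) + Unitization.inr (Fn.along b g a.snd)
      map_zero' := ext (by simp) (by simp)
      map_add' := fun a b => ext (by simp) (by simp) }
  leibniz a c := ext (by
      simp only [AddMonoidHom.coe_mk, ZeroHom.coe_mk, Unitization.fst_mul, Unitization.fst_add,
        Unitization.fst_inl, Unitization.fst_inr, add_zero, Derivation.leibniz, smul_add,
        smul_eq_mul, mul_smul_comm, smul_mul_assoc]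
      ring_nf) (by
      simp only [AddMonoidHom.coe_mk, ZeroHom.coe_mk, Unitization.snd_mul, Unitization.snd_add,
        Unitization.fst_add, Unitization.fst_mul,
        Unitization.fst_inl, Unitization.fst_inr, Unitization.snd_inl, Unitization.snd_inr,
        add_zero, zero_add, map_add, Fn.along_smul, Fn.along_mul]
      abel)
  comm_shift k a := ext (by simp [coefDt_shift, sh, shift])
    (by simp [Fn.along_shift, sh, shift])

@[simp] theorem alongDer_fst (b : ℝ) (g : Fn) (a : OpCoef) :
    ((alongDer b g).toHom a).fst = b • coefDt a.fst := by
  simp [alongDer]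

@[simp] theorem alongDer_snd (b : ℝ) (g : Fn) (a : OpCoef) :
    ((alongDer b g).toHom a).snd = Fn.along b g a.snd := by
  simp [alongDer]

theorem alongDer_dxDer (b : ℝ) (g : Fn) (a : OpCoef) :
    (alongDer b g).toHom (dxDer.toHom a) = dxDer.toHom ((alongDer b g).toHom a) :=
  ext (by rw [alongDer_fst, dxDer_fst, dxDer_fst, alongDer_fst, coefDt_dx, Derivation.map_smul])
    (by simp [Fn.along_dx])

end OpCoef

/-! ## The ring of shift operators -/

/-- Reindexing of a double convolution by `(i, j) ↦ (j, i - j)`. It serves both the associativity of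
the product and the trace pairing. -/
theorem finsum_finsum_sub {A : Type*} [AddCommMonoid A] (F : ℤ → ℤ → A)
    (hF : (Function.support fun p : ℤ × ℤ => F p.1 p.2).Finite) :
    ∑ᶠ i, ∑ᶠ j, F j (i - j) = ∑ᶠ j, ∑ᶠ l, F j l := by
  let e : ℤ × ℤ ≃ ℤ × ℤ :=
    { toFun := fun p => (p.2, p.1 - p.2)
      invFun := fun p => (p.1 + p.2, p.1)
      left_inv := fun p => by simp
      right_inv := fun p => by simp }
  rw [← finsum_curry (fun p : ℤ × ℤ => F p.1 p.2) hF,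
    ← finsum_curry (fun p : ℤ × ℤ => F p.2 (p.1 - p.2))]
  · exact finsum_comp_equiv e (f := fun p : ℤ × ℤ => F p.1 p.2)
  · exact hF.preimage (f := e) e.injective.injOn

/-- `A : Op` stands for the operator `∑ₖ A k E ^ k`, of order bounded above. -/
structure Op where
  toFun : ℤ → OpCoef
  exists_bound' : ∃ N : ℤ, ∀ k, N < k → toFun k = 0

namespace Op

open OpCoef

instance : CoeFun Op fun _ => ℤ → OpCoef := ⟨toFun⟩

theorem exists_bound (A : Op) : ∃ N : ℤ, ∀ k, N < k → A k = 0 := A.exists_bound'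

@[ext] theorem ext {A B : Op} (h : ∀ k, A k = B k) : A = B := by
  cases A; cases B; congr; exact funext h

instance : Zero Op := ⟨⟨fun _ => 0, 0, fun _ _ => rfl⟩⟩

instance : Add Op := ⟨fun A B => ⟨fun k => A k + B k, by
  obtain ⟨N, hN⟩ := A.exists_bound
  obtain ⟨N', hN'⟩ := B.exists_bound
  refine ⟨max N N', fun k hk => ?_⟩
  rw [hN k (lt_of_le_of_lt (le_max_left _ _) hk),
    hN' k (lt_of_le_of_lt (le_max_right _ _) hk), add_zero]⟩⟩

instance : Neg Op := ⟨fun A => ⟨fun k => -A k, by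
  obtain ⟨N, hN⟩ := A.exists_bound
  exact ⟨N, fun k hk => by rw [hN k hk, neg_zero]⟩⟩⟩

@[simp] theorem add_apply (A B : Op) (k : ℤ) : (A + B) k = A k + B k := rfl
@[simp] theorem neg_apply (A : Op) (k : ℤ) : (-A) k = -A k := rfl
@[simp] theorem zero_apply (k : ℤ) : (0 : Op) k = 0 := rfl

instance : AddCommGroup Op where
  add_assoc A B C := by ext1 k; exact add_assoc _ _ _
  zero_add A := by ext1 k; exact zero_add _
  add_zero A := by ext1 k; exact add_zero _
  add_comm A B := by ext1 k; exact add_comm _ _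
  neg_add_cancel A := by ext1 k; exact neg_add_cancel _
  zsmul := zsmulRec
  nsmul := nsmulRec

@[simp] theorem sub_apply (A B : Op) (k : ℤ) : (A - B) k = A k - B k := by
  rw [sub_eq_add_neg, add_apply, neg_apply, sub_eq_add_neg]

/-- The coefficients of the product. -/
def mulFun (A B : Op) (k : ℤ) : OpCoef := ∑ᶠ j, A j * sh j (B (k - j))

theorem mul_term_eq_zero {A B : Op} {N N' : ℤ} (hA : ∀ k, N < k → A k = 0)
    (hB : ∀ k, N' < k → B k = 0) {k j : ℤ} (hj : j ∉ Set.Icc (k - N') N) :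
    A j * sh j (B (k - j)) = 0 := by
  rw [Set.mem_Icc, not_and_or, not_le, not_le] at hj
  rcases hj with hj | hj
  · rw [hB (k - j) (by omega), map_zero, mul_zero]
  · rw [hA j hj, zero_mul]

theorem mul_finite (A B : Op) (k : ℤ) :
    (Function.support fun j => A j * sh j (B (k - j))).Finite := by
  obtain ⟨N, hN⟩ := A.exists_bound
  obtain ⟨N', hN'⟩ := B.exists_bound
  refine (Set.finite_Icc (k - N') N).subset fun j hj => ?_
  by_contra h
  exact hj (mul_term_eq_zero hN hN' h)

theorem mulFun_eq_zero {A B : Op} {N N' : ℤ} (hA : ∀ k, N < k → A k = 0)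
    (hB : ∀ k, N' < k → B k = 0) {k : ℤ} (hk : N + N' < k) : mulFun A B k = 0 := by
  rw [mulFun, finsum_eq_zero_of_forall_eq_zero]
  intro j
  refine mul_term_eq_zero hA hB fun h => ?_
  have := h.1.trans h.2
  omega

instance : Mul Op := ⟨fun A B => ⟨mulFun A B, by
  obtain ⟨N, hN⟩ := A.exists_bound
  obtain ⟨N', hN'⟩ := B.exists_bound
  exact ⟨N + N', fun k hk => mulFun_eq_zero hN hN' hk⟩⟩⟩

theorem mul_apply (A B : Op) (k : ℤ) : (A * B) k = ∑ᶠ j, A j * sh j (B (k - j)) := rfl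

/-- The operator `a E ^ j`. -/
def mono (j : ℤ) (a : OpCoef) : Op :=
  ⟨fun k => if k = j then a else 0, j, fun _ hk => if_neg hk.ne'⟩

theorem mono_apply (j : ℤ) (a : OpCoef) (k : ℤ) : mono j a k = if k = j then a else 0 := rfl

theorem mono_mul_apply (j : ℤ) (a : OpCoef) (A : Op) (k : ℤ) :
    (mono j a * A) k = a * sh j (A (k - j)) := by
  rw [mul_apply, finsum_eq_single _ j, mono_apply, if_pos rfl]
  intro i hi
  rw [mono_apply, if_neg hi, zero_mul]

theorem mul_mono_apply (j : ℤ) (a : OpCoef) (A : Op) (k : ℤ) :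
    (A * mono j a) k = A (k - j) * sh (k - j) a := by
  rw [mul_apply, finsum_eq_single _ (k - j), mono_apply, if_pos (by ring)]
  intro i hi
  rw [mono_apply, if_neg (by omega), map_zero, mul_zero]

instance : One Op := ⟨mono 0 1⟩

theorem one_def : (1 : Op) = mono 0 1 := rfl

/-- The orders of the three factors are bounded above and add up to `k`, so each is bounded below as
well. The target `M` is arbitrary because the summands are coefficients in one use and functionals
in another. -/
theorem triple_finite {M : Type*} [Zero M] (A B C : Op) (k : ℤ) (T : ℤ → ℤ → M)
    (hA : ∀ j l, A j = 0 → T j l = 0) (hB : ∀ j l, B l = 0 → T j l = 0)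
    (hC : ∀ j l, C (k - (j + l)) = 0 → T j l = 0) :
    (Function.support fun p : ℤ × ℤ => T p.1 p.2).Finite := by
  obtain ⟨N, hN⟩ := A.exists_bound
  obtain ⟨N', hN'⟩ := B.exists_bound
  obtain ⟨N'', hN''⟩ := C.exists_bound
  refine ((Set.finite_Icc (k - N' - N'') N).prod (Set.finite_Icc (k - N - N'') N')).subset ?_
  rintro ⟨i, l⟩ hp
  have h1 : i ≤ N := by
    by_contra h
    exact hp (hA i l (hN i (by omega)))
  have h2 : l ≤ N' := by
    by_contra h
    exact hp (hB i l (hN' l (by omega)))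
  have h3 : k - (i + l) ≤ N'' := by
    by_contra h
    exact hp (hC i l (hN'' _ (by omega)))
  exact ⟨⟨by omega, h1⟩, ⟨by omega, h2⟩⟩

protected theorem mul_assoc (A B C : Op) : A * B * C = A * (B * C) := by
  ext1 k
  have e1 : (A * B * C) k = ∑ᶠ i, ∑ᶠ j, A j * sh j (B (i - j)) * sh (j + (i - j))
      (C (k - (j + (i - j)))) := by
    rw [mul_apply]
    refine finsum_congr fun i => ?_
    rw [mul_apply, finsum_mul' _ _ (mul_finite A B i)]
    refine finsum_congr fun j => ?_
    rw [add_sub_cancel]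
  have e2 : (A * (B * C)) k = ∑ᶠ j, ∑ᶠ l, A j * sh j (B l) * sh (j + l) (C (k - (j + l))) := by
    rw [mul_apply]
    refine finsum_congr fun j => ?_
    rw [mul_apply, sh_finsum j (mul_finite B C _),
      mul_finsum' _ _ ((mul_finite B C (k - j)).subset fun l hl h => hl (by
        simp only [h, map_zero]))]
    refine finsum_congr fun l => ?_
    rw [map_mul, sh_sh, mul_assoc, sub_sub]
  rw [e1, e2]
  let T : ℤ → ℤ → OpCoef := fun j l => A j * sh j (B l) * sh (j + l) (C (k - (j + l)))
  exact finsum_finsum_sub T (triple_finite A B C k T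
    (fun j l h => by simp only [T]; rw [h, zero_mul, zero_mul])
    (fun j l h => by simp only [T]; rw [h, map_zero, mul_zero, zero_mul])
    (fun j l h => by simp only [T]; rw [h, map_zero, mul_zero]))

instance : Ring Op where
  mul_assoc := Op.mul_assoc
  one_mul A := by ext1 k; rw [one_def, mono_mul_apply, one_mul, sh_zero, sub_zero]
  mul_one A := by ext1 k; rw [one_def, mul_mono_apply, map_one, mul_one, sub_zero]
  zero_mul A := by ext1 k; simp [mul_apply]
  mul_zero A := by ext1 k; simp [mul_apply]
  left_distrib A B C := by
    ext1 k
    rw [add_apply, mul_apply, mul_apply, mul_apply,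
      ← finsum_add_distrib (mul_finite A B k) (mul_finite A C k)]
    exact finsum_congr fun j => by rw [add_apply, map_add, mul_add]
  right_distrib A B C := by
    ext1 k
    rw [add_apply, mul_apply, mul_apply, mul_apply,
      ← finsum_add_distrib (mul_finite A C k) (mul_finite B C k)]
    exact finsum_congr fun j => by rw [add_apply, add_mul]
  neg_add_cancel := neg_add_cancel
  sub_eq_add_neg := sub_eq_add_neg
  zsmul := zsmulRec
  nsmul := nsmulRec

/-- A derivation of the coefficients applied to all coefficients of an operator. -/
def der (δ : ShiftDerivation) : Op →+ Op where
  toFun A := ⟨fun k => δ.toHom (A k), by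
    obtain ⟨N, hN⟩ := A.exists_bound
    exact ⟨N, fun k hk => by rw [hN k hk, map_zero]⟩⟩
  map_zero' := by ext1 k; exact map_zero _
  map_add' A B := by ext1 k; exact map_add _ _ _

@[simp] theorem der_apply (δ : ShiftDerivation) (A : Op) (k : ℤ) :
    der δ A k = δ.toHom (A k) := rfl

theorem der_mul (δ : ShiftDerivation) (A B : Op) : der δ (A * B) = der δ A * B + A * der δ B := by
  ext1 k
  rw [der_apply, mul_apply, AddMonoidHom.map_finsum _ (mul_finite A B k), add_apply, mul_apply,
    mul_apply, ← finsum_add_distrib (mul_finite _ _ k) (mul_finite _ _ k)]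
  exact finsum_congr fun j => by
    rw [δ.leibniz, δ.comm_shift, der_apply, der_apply]

theorem der_mono (δ : ShiftDerivation) (j : ℤ) (a : OpCoef) :
    der δ (mono j a) = mono j (δ.toHom a) := by
  ext1 k
  rw [der_apply, mono_apply, mono_apply]
  split_ifs <;> simp

end Op

end
end DDKP

namespace DDKP
noncomputable section

namespace Op

open OpCoef

/-! ### Operators that vanish at `u = 0` -/

/-- The operators that vanish at `u = 0`. -/
def vanishing : AddSubgroup Op where
  carrier := {A | ∀ k, (A k).fst = 0}
  zero_mem' _ := rfl
  add_mem' {A B} hA hB k := by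
    rw [add_apply, Unitization.fst_add, hA k, hB k, add_zero]
  neg_mem' {A} hA k := by rw [neg_apply, Unitization.fst_neg, hA k, neg_zero]

theorem mem_vanishing {A : Op} : A ∈ vanishing ↔ ∀ k, (A k).fst = 0 := Iff.rfl

theorem fst_finsum {ι : Type*} {f : ι → OpCoef} (hf : (Function.support f).Finite) :
    (∑ᶠ i, f i).fst = ∑ᶠ i, (f i).fst :=
  AddMonoidHom.map_finsum (Unitization.fstHom Coef Fn : OpCoef →+ Coef) hf

theorem mul_mem_vanishing_left {A : Op} (hA : A ∈ vanishing) (B : Op) : A * B ∈ vanishing := by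
  intro k
  rw [mul_apply, fst_finsum (mul_finite A B k), finsum_eq_zero_of_forall_eq_zero]
  intro j
  rw [Unitization.fst_mul, hA j, zero_mul]

theorem mul_mem_vanishing_right (A : Op) {B : Op} (hB : B ∈ vanishing) : A * B ∈ vanishing := by
  intro k
  rw [mul_apply, fst_finsum (mul_finite A B k), finsum_eq_zero_of_forall_eq_zero]
  intro j
  rw [Unitization.fst_mul, sh_fst, hB, map_zero, mul_zero]

theorem mul_sub_mul_mem_vanishing {A A' B B' : Op} (hA : A - A' ∈ vanishing)
    (hB : B - B' ∈ vanishing) : A * B - A' * B' ∈ vanishing := by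
  have e : A * B - A' * B' = (A - A') * B + A' * (B - B') := by noncomm_ring
  rw [e]
  exact add_mem (mul_mem_vanishing_left hA B) (mul_mem_vanishing_right A' hB)

theorem pow_sub_pow_mem_vanishing {A A' : Op} (hA : A - A' ∈ vanishing) (m : ℕ) :
    A ^ m - A' ^ m ∈ vanishing := by
  induction m with
  | zero => simp [zero_mem]
  | succ m ih => rw [pow_succ, pow_succ]; exact mul_sub_mul_mem_vanishing ih hA

theorem mono_inr_mem_vanishing (j : ℤ) (f : Fn) :
    mono j (Unitization.inr f) ∈ vanishing := by
  intro k
  rw [mono_apply]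
  split_ifs <;> simp

theorem mono_zero (j : ℤ) : mono j 0 = 0 := by
  ext1 k
  rw [mono_apply, ite_self, zero_apply]

theorem mono_add (j : ℤ) (a b : OpCoef) : mono j (a + b) = mono j a + mono j b := by
  ext1 k
  rw [add_apply, mono_apply, mono_apply, mono_apply]
  split_ifs <;> simp

theorem mono_sub (j : ℤ) (a b : OpCoef) : mono j (a - b) = mono j a - mono j b := by
  ext1 k
  rw [sub_apply, mono_apply, mono_apply, mono_apply]
  split_ifs <;> simp

theorem mono_mul_mono (j k : ℤ) (a b : OpCoef) :
    mono j a * mono k b = mono (j + k) (a * sh j b) := by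
  ext1 i
  rw [mono_mul_apply, mono_apply, mono_apply]
  by_cases h : i = j + k
  · rw [if_pos (by omega), if_pos h]
  · rw [if_neg (by omega), if_neg h, map_zero, mul_zero]

/-! ### Difference part -/

/-- The difference part `( )₊`. -/
def posPart (A : Op) : Op := ⟨fun k => if 0 ≤ k then A k else 0, by
  obtain ⟨N, hN⟩ := A.exists_bound
  exact ⟨N, fun k hk => by rw [hN k hk, ite_self]⟩⟩

theorem posPart_apply (A : Op) (k : ℤ) : posPart A k = if 0 ≤ k then A k else 0 := rfl

/-- The part of negative order. -/
def negPart (A : Op) : Op := A - posPart A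

theorem negPart_apply (A : Op) (k : ℤ) : negPart A k = if 0 ≤ k then 0 else A k := by
  rw [negPart, sub_apply, posPart_apply]
  split_ifs <;> simp

theorem posPart_add_negPart (A : Op) : posPart A + negPart A = A := add_sub_cancel _ _

theorem mul_apply_eq_zero_of_nonneg {A B : Op} (hA : ∀ k < 0, A k = 0) (hB : ∀ k < 0, B k = 0)
    {k : ℤ} (hk : k < 0) : (A * B) k = 0 := by
  rw [mul_apply, finsum_eq_zero_of_forall_eq_zero]
  intro j
  rcases lt_or_ge j 0 with h | h
  · rw [hA j h, zero_mul]
  · rw [hB (k - j) (by omega), map_zero, mul_zero]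

theorem pow_apply_eq_zero_of_nonneg {A : Op} (hA : ∀ k < 0, A k = 0) (m : ℕ) :
    ∀ k < 0, (A ^ m) k = 0 := by
  induction m with
  | zero => intro k hk; rw [pow_zero, one_def, mono_apply, if_neg hk.ne]
  | succ m ih => intro k hk; rw [pow_succ]; exact mul_apply_eq_zero_of_nonneg ih hA hk

/-- Nonnegative orders add up to zero only as `0 + 0`. Since coefficients commute, a commutator of
difference parts has no term of order zero. -/
theorem posPart_mul_posPart_apply_zero (A B : Op) :
    (posPart A * posPart B) 0 = A 0 * B 0 := by
  rw [mul_apply, finsum_eq_single _ 0]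
  · simp [posPart_apply]
  · intro j hj
    rw [posPart_apply, posPart_apply]
    rcases lt_or_ge j 0 with h | h
    · rw [if_neg (by omega), zero_mul]
    · rw [if_neg (by omega : ¬ 0 ≤ 0 - j), map_zero, mul_zero]

theorem negPart_mul_negPart_apply_zero (A B : Op) : (negPart A * negPart B) 0 = 0 := by
  rw [mul_apply, finsum_eq_zero_of_forall_eq_zero]
  intro j
  rw [negPart_apply, negPart_apply]
  rcases lt_or_ge j 0 with h | h
  · rw [if_pos (by omega : 0 ≤ 0 - j), map_zero, mul_zero]
  · rw [if_pos h, zero_mul]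

theorem posPart_eq_self {A : Op} (hA : ∀ k < 0, A k = 0) : posPart A = A := by
  ext1 k
  rw [posPart_apply]
  split_ifs with hk
  · rfl
  · exact (hA k (not_le.1 hk)).symm

theorem mul_apply_of_lt {A B : Op} {N N' : ℤ} (hA : ∀ k, N < k → A k = 0)
    (hB : ∀ k, N' < k → B k = 0) {k : ℤ} (hk : N + N' < k) : (A * B) k = 0 :=
  mulFun_eq_zero hA hB hk

theorem pow_apply_of_lt {A : Op} (hA : ∀ k, 1 < k → A k = 0) (m : ℕ) :
    ∀ k : ℤ, (m : ℤ) < k → (A ^ m) k = 0 := by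
  induction m with
  | zero => intro k hk; rw [pow_zero, one_def, mono_apply, if_neg (by simpa using hk.ne')]
  | succ m ih =>
    intro k hk
    rw [pow_succ]
    exact mul_apply_of_lt ih hA (by push_cast at hk; exact hk)

/-! ### Commutation with `∂ - A₁` -/

/-- The real number `r` as a coefficient. -/
def const (r : ℝ) : OpCoef := Unitization.inl (MvPolynomial.C r)

@[simp] theorem const_fst (r : ℝ) : (const r).fst = MvPolynomial.C r := rfl
@[simp] theorem const_snd (r : ℝ) : (const r).snd = 0 := rfl

theorem sh_const (k : ℤ) (r : ℝ) : sh k (const r) = const r :=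
  OpCoef.ext (by simp [coefShift, MvPolynomial.algebraMap_eq]) (by simp [Fn.shift_map_zero])

theorem alongDer_const (b : ℝ) (g : Fn) (r : ℝ) : (alongDer b g).toHom (const r) = 0 :=
  OpCoef.ext (by simp [coefDt]) (by simp)

theorem dxDer_const (r : ℝ) : dxDer.toHom (const r) = 0 :=
  OpCoef.ext (by simp [coefDx]) (by simp [Fn.dx_zero])

/-- `h⁻¹ Δ`. -/
def freeLax (h : ℝ) : Op := mono 1 (const h⁻¹) - mono 0 (const h⁻¹)

/-- `A₁ = h⁻¹ Δ + u`. -/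
def lam (h : ℝ) : Op := freeLax h + mono 0 (Unitization.inr Fn.u)

/-- `A ↦ [∂ - A₁, A]`. -/
def mder (h : ℝ) : Op →+ Op where
  toFun A := der dxDer A - (lam h * A - A * lam h)
  map_zero' := by simp
  map_add' A B := by rw [map_add]; noncomm_ring

theorem mder_def (h : ℝ) (A : Op) : mder h A = der dxDer A - (lam h * A - A * lam h) := rfl

theorem mder_mul (h : ℝ) (A B : Op) : mder h (A * B) = mder h A * B + A * mder h B := by
  rw [mder_def, mder_def, mder_def, der_mul]; noncomm_ring

theorem mder_comm (h : ℝ) (A B : Op) :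
    mder h (A * B - B * A) =
      (mder h A * B - B * mder h A) + (A * mder h B - mder h B * A) := by
  rw [map_sub, mder_mul, mder_mul]; noncomm_ring

theorem mder_one (h : ℝ) : mder h 1 = 0 := by
  have e := mder_mul h 1 1
  rw [mul_one, one_mul, mul_one] at e
  exact left_eq_add.1 e

theorem mder_mul_eq_zero (h : ℝ) {A B : Op} (hA : mder h A = 0) (hB : mder h B = 0) :
    mder h (A * B) = 0 := by
  rw [mder_mul, hA, hB, zero_mul, mul_zero, add_zero]

/-- This is the triangular form of `[∂ - A₁, ·]`: besides the coefficient of order `k` it contains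
only `h⁻¹ Δ` of the coefficient of order `k - 1`. The constant `-h⁻¹` in `A₁` drops out of the
commutator. -/
theorem mder_apply (h : ℝ) (A : Op) (k : ℤ) :
    mder h A k = dxDer.toHom (A k) - const h⁻¹ * (sh 1 (A (k - 1)) - A (k - 1)) -
      (Unitization.inr Fn.u - sh k (Unitization.inr Fn.u)) * A k := by
  rw [mder_def, lam, freeLax, sub_apply, sub_apply, der_apply, add_mul, sub_mul, mul_add, mul_sub,
    add_apply, add_apply, sub_apply, sub_apply, mono_mul_apply, mono_mul_apply, mono_mul_apply,
    mul_mono_apply, mul_mono_apply, mul_mono_apply, sh_const, sh_const]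
  simp only [sub_zero, sh_zero]
  ring

theorem mder_snd_apply (h : ℝ) {A : Op} (hA : A ∈ vanishing) (k : ℤ) :
    (mder h A k).snd = Fn.dx (A k).snd -
      h⁻¹ • (Fn.shift 1 (A (k - 1)).snd - (A (k - 1)).snd) -
      (Fn.u - Fn.shift k Fn.u) * (A k).snd := by
  rw [mder_apply]
  have h0 : (A k).fst = 0 := hA k
  simp [h0, Fn.real_smul_def]

theorem mder_mem_vanishing (h : ℝ) {A : Op} (hA : A ∈ vanishing) : mder h A ∈ vanishing := by
  intro k
  rw [mder_apply]
  have h0 : (A k).fst = 0 := hA k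
  have h1 : (A (k - 1)).fst = 0 := hA (k - 1)
  simp [h0, h1]

/-- Descent from the top order: once the coefficient of order `k` is zero, the component of order
`k` says that `Δ` annihilates the next one. Vanishing at `u = 0` is essential, because `Δ` is
injective on `𝓕` but not on polynomials. -/
theorem eq_zero_of_mder_eq_zero {h : ℝ} (hh : h ≠ 0) {A : Op} (hA : A ∈ vanishing)
    (h0 : mder h A = 0) : A = 0 := by
  obtain ⟨N, hN⟩ := A.exists_bound
  have step : ∀ k, A k = 0 → A (k - 1) = 0 := by
    intro k hk
    have e := mder_snd_apply h hA k
    rw [h0, hk] at e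
    simp only [zero_apply, Unitization.snd_zero, Fn.dx_zero, mul_zero, sub_zero, zero_sub] at e
    have e2 := Fn.eq_zero_of_shift_one_sub
      ((smul_eq_zero_iff_right (inv_ne_zero hh)).1 (neg_eq_zero.1 e.symm))
    exact OpCoef.ext (hA _) e2
  have all : ∀ n : ℕ, A (N + 1 - n) = 0 := by
    intro n
    induction n with
    | zero => exact hN _ (by simp)
    | succ n ih =>
      have := step _ ih
      rwa [show N + 1 - ((n + 1 : ℕ) : ℤ) = N + 1 - n - 1 by push_cast; ring]
  ext1 k
  rcases lt_or_ge N k with hk | hk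
  · exact hN k hk
  · have := all (N + 1 - k).toNat
    rwa [show N + 1 - ((N + 1 - k).toNat : ℤ) = k by omega] at this

theorem eq_of_mder_eq {h : ℝ} (hh : h ≠ 0) {A B : Op} (hA : A ∈ vanishing) (hB : B ∈ vanishing)
    (e : mder h A = mder h B) : A = B :=
  sub_eq_zero.1 (eq_zero_of_mder_eq_zero hh (sub_mem hA hB) (by rw [map_sub, e, sub_self]))

/-- The coefficients of the solution of `[∂ - A₁, Y] = G`, from the order `N` of `G` downwards. -/
def solveCoeff (h : ℝ) (N : ℤ) (G : Op) : ℕ → Fn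
  | 0 => 0
  | n + 1 => h • Fn.deltaInv (Fn.dx (solveCoeff h N G n) -
      (Fn.u - Fn.shift (N - n) Fn.u) * solveCoeff h N G n - (G (N - n)).snd)

/-- The component of order `k` is solved for `Δ Y_(k-1)`, and `Δ⁻¹` is available in `𝓕`. The
solution therefore starts one order below `G`; this gain leaves the top coefficients of `L` and `Γ`
equal to their free values. -/
theorem exists_mder_eq {h : ℝ} (hh : h ≠ 0) {G : Op} (hG : G ∈ vanishing) {N : ℤ}
    (hN : ∀ k, N < k → G k = 0) :
    ∃ Y ∈ vanishing, (∀ k, N ≤ k → Y k = 0) ∧ mder h Y = G := by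
  let Y : Op := ⟨fun k => if N < k then 0 else Unitization.inr (solveCoeff h N G (N - k).toNat),
    N, fun k hk => if_pos hk⟩
  have Y_apply : ∀ n : ℕ, Y (N - n) = Unitization.inr (solveCoeff h N G n) := by
    intro n
    change (if N < N - n then _ else _) = _
    rw [if_neg (by omega)]
    congr 2
    omega
  have hY : Y ∈ vanishing := by
    intro k
    change (if N < k then (0 : OpCoef) else _).fst = _
    split_ifs <;> simp
  have hY0 : ∀ k, N ≤ k → Y k = 0 := by
    intro k hk
    rcases hk.eq_or_lt with rfl | hk
    · have := Y_apply 0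
      rw [Nat.cast_zero, sub_zero] at this
      rw [this, solveCoeff, Unitization.inr_zero]
    · exact if_pos hk
  refine ⟨Y, hY, hY0, ?_⟩
  ext1 k
  refine OpCoef.ext (by rw [mder_mem_vanishing h hY, hG]) ?_
  rw [mder_snd_apply h hY]
  rcases lt_or_ge N k with hk | hk
  · rw [hY0 k hk.le, hY0 (k - 1) (by omega), hN k hk]
    simp [Fn.dx_zero, Fn.shift_map_zero]
  · obtain ⟨n, rfl⟩ : ∃ n : ℕ, k = N - n := ⟨(N - k).toNat, by omega⟩
    have e : N - (n : ℤ) - 1 = N - ((n + 1 : ℕ) : ℤ) := by push_cast; ring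
    rw [e, Y_apply, Y_apply, Unitization.snd_inr, Unitization.snd_inr, solveCoeff]
    set F := Fn.dx (solveCoeff h N G n) -
      (Fn.u - Fn.shift (N - n) Fn.u) * solveCoeff h N G n - (G (N - n)).snd with hF
    have e2 : Fn.shift 1 (h • Fn.deltaInv F) = h • Fn.shift 1 (Fn.deltaInv F) := by
      rw [Fn.real_smul_def, Fn.shift_smul, Fn.real_smul_def]
      simp [coefShift, MvPolynomial.algebraMap_eq]
    rw [e2, ← smul_sub, Fn.shift_one_sub_deltaInv, smul_smul, inv_mul_cancel₀ hh, one_smul, hF]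
    abel

end Op

end
end DDKP

namespace DDKP
noncomputable section

namespace Op

open OpCoef

/-! ### The Lax operator and the Orlov-Schulman operator -/

theorem mder_freeLax (h : ℝ) : mder h (freeLax h) =
    mono 1 (const h⁻¹ * (sh 1 (Unitization.inr Fn.u) - Unitization.inr Fn.u)) := by
  have e : der dxDer (freeLax h) = 0 := by
    rw [freeLax, map_sub, der_mono, der_mono, dxDer_const, mono_zero, mono_zero, sub_self]
  rw [mder_def, e, lam, freeLax]
  simp only [add_mul, mul_add, sub_mul, mul_sub, mono_mul_mono, sh_const, sh_zero, add_zero,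
    zero_add]
  simp only [mono_sub, mul_comm (Unitization.inr Fn.u : OpCoef)]
  abel

theorem freeLax_apply_eq_zero (h : ℝ) {k : ℤ} (hk : k < 0 ∨ 1 < k) : freeLax h k = 0 := by
  rw [freeLax, sub_apply, mono_apply, mono_apply, if_neg (by omega), if_neg (by omega), sub_self]

/-- The defect `[∂ - A₁, h⁻¹ Δ]` comes only from `u` and has order one, so a correction of order at
most zero removes it. -/
theorem exists_lax {h : ℝ} (hh : h ≠ 0) :
    ∃ L : Op, L - freeLax h ∈ vanishing ∧ (∀ k, 0 < k → L k = freeLax h k) ∧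
      mder h L = 0 := by
  have hG : -mder h (freeLax h) ∈ vanishing := by
    intro k
    rw [neg_apply, mder_freeLax, mono_apply]
    split_ifs <;> simp
  obtain ⟨Y, hY, hY0, e⟩ := exists_mder_eq hh (N := 1) hG (fun k hk => by
    rw [neg_apply, mder_freeLax, mono_apply, if_neg hk.ne', neg_zero])
  refine ⟨freeLax h + Y, by rwa [add_sub_cancel_left], fun k hk => ?_, ?_⟩
  · rw [add_apply, hY0 k hk, add_zero]
  · rw [map_add, e, add_neg_cancel]

/-- The coefficient of `E ^ 0` of the Lax operator. -/
theorem lax_zeroth {h : ℝ} (hh : h ≠ 0) {L : Op} (hL : L - freeLax h ∈ vanishing)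
    (hpos : ∀ k, 0 < k → L k = freeLax h k) (h0 : mder h L = 0) : (L 0).snd = Fn.u := by
  have e : mder h (L - freeLax h) = -mono 1 (const h⁻¹ *
      (sh 1 (Unitization.inr Fn.u) - Unitization.inr Fn.u)) := by
    rw [map_sub, h0, mder_freeLax, zero_sub]
  -- The component of order one of `[∂ - A₁, L] = 0` equates `Δ` of the zeroth coefficient with `Δ
  -- u`.
  have e1 := mder_snd_apply h hL 1
  rw [e, neg_apply, mono_apply, if_pos rfl, sub_apply, hpos 1 one_pos, sub_self, sub_self] at e1
  have h1 : (freeLax h 0).snd = 0 := by simp [freeLax, mono_apply]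
  simp only [Unitization.snd_neg, Unitization.snd_mul, const_fst, const_snd, sub_apply, fst_sub,
    snd_sub, sh_fst, sh_snd, Unitization.fst_inr, Unitization.snd_inr, map_zero, sub_zero,
    smul_zero, add_zero, zero_mul, mul_zero, Unitization.snd_zero, Fn.dx_zero, zero_sub,
    ← Fn.real_smul_def, h1] at e1
  have e2 := smul_right_injective Fn (inv_ne_zero hh) (neg_injective e1)
  have e3 : Fn.shift 1 ((L 0).snd - Fn.u) - ((L 0).snd - Fn.u) = 0 := by
    rw [Fn.shift_sub, sub_sub_sub_comm, ← e2, sub_self]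
  exact sub_eq_zero.1 (Fn.eq_zero_of_shift_one_sub e3)

/-- `x E + h n`, which commutes with `∂ - h⁻¹ Δ`. -/
def freeOrlov (h : ℝ) : Op :=
  mono 1 (Unitization.inl cx) + mono 0 (Unitization.inl (MvPolynomial.C h * cn))

theorem freeOrlov_apply_eq_zero (h : ℝ) {k : ℤ} (hk : k < 0 ∨ 1 < k) : freeOrlov h k = 0 := by
  rw [freeOrlov, add_apply, mono_apply, mono_apply, if_neg (by omega), if_neg (by omega), add_zero]

theorem der_freeOrlov (h : ℝ) : der dxDer (freeOrlov h) = mono 1 1 := by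
  rw [freeOrlov, map_add, der_mono, der_mono]
  have e1 : dxDer.toHom (Unitization.inl cx) = 1 := OpCoef.ext (by simp [coefDx])
    (by simp [Fn.dx_zero])
  have e2 : dxDer.toHom (Unitization.inl (MvPolynomial.C h * cn)) = 0 := OpCoef.ext
    (by simp [coefDx]) (by simp [Fn.dx_zero])
  rw [e1, e2, mono_zero, add_zero]

theorem sh_cx (k : ℤ) : sh k (Unitization.inl cx) = Unitization.inl cx :=
  OpCoef.ext (by simp [coefShift, shiftVar]) (by simp [Fn.shift_map_zero])

theorem sh_one_cn (h : ℝ) : sh 1 (Unitization.inl (MvPolynomial.C h * cn)) =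
    Unitization.inl (MvPolynomial.C h * cn) + const h :=
  OpCoef.ext (by simp [coefShift, shiftVar, MvPolynomial.algebraMap_eq]; ring)
    (by simp [Fn.shift_map_zero])

/-- `[h⁻¹ Δ, x E + h n] = E`. -/
theorem freeLax_comm_freeOrlov {h : ℝ} (hh : h ≠ 0) :
    freeLax h * freeOrlov h - freeOrlov h * freeLax h = mono 1 1 := by
  rw [freeLax, freeOrlov]
  simp only [add_mul, mul_add, sub_mul, mul_sub, mono_mul_mono, sh_const, sh_zero, add_zero,
    zero_add, sh_cx, sh_one_cn]
  have e : const h⁻¹ * const h = 1 := by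
    rw [const, const, ← Unitization.inl_mul, ← map_mul, inv_mul_cancel₀ hh, map_one,
      Unitization.inl_one]
  simp only [e, mono_add, mul_comm (const h⁻¹)]
  abel

theorem lam_comm_sub_mem_vanishing (h : ℝ) (A : Op) :
    (lam h * A - A * lam h) - (freeLax h * A - A * freeLax h) ∈ vanishing := by
  have e : lam h * A - A * lam h - (freeLax h * A - A * freeLax h) =
      mono 0 (Unitization.inr Fn.u) * A - A * mono 0 (Unitization.inr Fn.u) := by
    rw [lam]; noncomm_ring
  rw [e]
  exact sub_mem (mul_mem_vanishing_left (mono_inr_mem_vanishing _ _) _)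
    (mul_mem_vanishing_right _ (mono_inr_mem_vanishing _ _))

/-- At `u = 0` the two terms cancel: both `∂ (x E + h n)` and `[h⁻¹ Δ, x E + h n]` are `E`. -/
theorem mder_freeOrlov_mem_vanishing {h : ℝ} (hh : h ≠ 0) :
    mder h (freeOrlov h) ∈ vanishing := by
  have e : mder h (freeOrlov h) = -((lam h * freeOrlov h - freeOrlov h * lam h) -
      (freeLax h * freeOrlov h - freeOrlov h * freeLax h)) := by
    rw [mder_def, der_freeOrlov, freeLax_comm_freeOrlov hh]; abel
  rw [e]
  exact neg_mem (lam_comm_sub_mem_vanishing h _)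

theorem exists_orlov {h : ℝ} (hh : h ≠ 0) :
    ∃ G : Op, G - freeOrlov h ∈ vanishing ∧ (∀ k, 0 < k → G k = freeOrlov h k) ∧
      mder h G = 0 := by
  obtain ⟨Y, hY, hY0, e⟩ := exists_mder_eq hh (N := 1)
    (neg_mem (mder_freeOrlov_mem_vanishing hh)) (fun k hk => by
      rw [neg_apply, mder_apply, freeOrlov_apply_eq_zero h (Or.inr hk), neg_eq_zero]
      -- Above order one only `Δ` of the coefficient of order `k - 1 ≥ 1` could contribute. That
      -- coefficient is `x` for `k = 2` and zero beyond, and `Δ x = 0`.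
      have e1 : freeOrlov h (k - 1) - Unitization.inl (if k = 2 then cx else 0) = 0 := by
        rw [freeOrlov, add_apply, mono_apply, mono_apply, if_neg (by omega : ¬ k - 1 = 0), add_zero]
        by_cases h2 : k = 2
        · rw [if_pos (by omega), if_pos h2, sub_self]
        · rw [if_neg (by omega), if_neg h2, Unitization.inl_zero, sub_zero]
      rw [sub_eq_zero.1 e1]
      split_ifs <;> simp [sh_cx])
  refine ⟨freeOrlov h + Y, by rwa [add_sub_cancel_left], fun k hk => ?_, ?_⟩
  · rw [add_apply, hY0 k (by omega), add_zero]
  · rw [map_add, e, add_neg_cancel]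

theorem freeLax_smul_add_one {h : ℝ} (hh : h ≠ 0) :
    mono 0 (const h) * freeLax h + 1 = mono 1 1 := by
  have e : const h * const h⁻¹ = 1 := by
    rw [const, const, ← Unitization.inl_mul, ← map_mul, mul_inv_cancel₀ hh, map_one,
      Unitization.inl_one]
  rw [freeLax, mul_sub, mono_mul_mono, mono_mul_mono, sh_const, e, one_def, zero_add,
    add_zero, sub_add_cancel]

theorem mder_const (h r : ℝ) : mder h (mono 0 (const r)) = 0 := by
  rw [mder_def, der_mono, dxDer_const, mono_zero]
  have : lam h * mono 0 (const r) = mono 0 (const r) * lam h := by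
    ext1 k
    rw [mul_mono_apply, mono_mul_apply, sh_const, sh_zero, mul_comm]
  rw [this, sub_self, sub_self]

theorem const_mul_comm (r : ℝ) (A : Op) : mono 0 (const r) * A = A * mono 0 (const r) := by
  ext1 k
  rw [mul_mono_apply, mono_mul_apply, sh_const, sh_zero, mul_comm]

/-- `[L, Γ] = h L + 1`. -/
theorem lax_comm_orlov {h : ℝ} (hh : h ≠ 0) {L G : Op} (hL : L - freeLax h ∈ vanishing)
    (hL0 : mder h L = 0) (hG : G - freeOrlov h ∈ vanishing) (hG0 : mder h G = 0) :
    L * G - G * L = mono 0 (const h) * L + 1 := by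
  -- The difference of the two sides vanishes at `u = 0`, by the free relation, and commutes with `∂
  -- - A₁`; hence it is zero.
  refine sub_eq_zero.1 (eq_zero_of_mder_eq_zero hh ?_ ?_ (h := h))
  · have e : L * G - G * L - (mono 0 (const h) * L + 1) =
        (L * G - freeLax h * freeOrlov h) - (G * L - freeOrlov h * freeLax h) -
          mono 0 (const h) * (L - freeLax h) + ((freeLax h * freeOrlov h -
            freeOrlov h * freeLax h) - (mono 0 (const h) * freeLax h + 1)) := by noncomm_ring
    rw [e, freeLax_comm_freeOrlov hh, freeLax_smul_add_one hh, sub_self, add_zero]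
    exact sub_mem (sub_mem (mul_sub_mul_mem_vanishing hL hG) (mul_sub_mul_mem_vanishing hG hL))
      (mul_mem_vanishing_right _ hL)
  · rw [map_sub, mder_comm, hL0, hG0, map_add, mder_mul, mder_one, mder_const, hL0]
    simp

end Op

end
end DDKP

namespace DDKP
noncomputable section

namespace Op

open OpCoef

/-! ### Flows of operators that commute with `∂ - A₁` -/

/-- `C` commutes with `∂ - A₁`, and `C|_{u = 0}` is a difference operator that does not contain
the time. -/
structure IsAdmissible (h : ℝ) (C : Op) : Prop where
  mder_eq : mder h C = 0
  fst_neg : ∀ k < 0, (C k).fst = 0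
  fst_time : ∀ k, coefDt (C k).fst = 0

/-- The covariant `γ_C`, the coefficient of `E ^ 0` of `C`. -/
def covariant (C : Op) : Fn := (C 0).snd

/-- The flow `K_C = ∂ γ_C`. -/
def flow (C : Op) : Fn := Fn.dx (covariant C)

theorem covariant_add (C D : Op) : covariant (C + D) = covariant C + covariant D := rfl

theorem covariant_const_mul (r : ℝ) (C : Op) :
    covariant (mono 0 (const r) * C) = r • covariant C := by
  rw [covariant, mono_mul_apply, sub_zero, sh_zero, Unitization.snd_mul, const_fst, const_snd,
    smul_zero, zero_mul, add_zero, add_zero, Fn.real_smul_def]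
  rfl

theorem covariant_sub (C D : Op) : covariant (C - D) = covariant C - covariant D := by
  rw [covariant, sub_apply, snd_sub]; rfl

variable {h : ℝ} {C D : Op}

theorem IsAdmissible.negPart_mem (hC : IsAdmissible h C) : negPart C ∈ vanishing := by
  intro k
  rw [negPart_apply]
  split_ifs with hk
  · rfl
  · exact hC.fst_neg k (not_le.1 hk)

theorem mder_negPart (C : Op) (hC : mder h C = 0) : mder h (negPart C) = -mder h (posPart C) := by
  rw [negPart, map_sub, hC, zero_sub]

/-- Commuting with `∂ - A₁` makes this equal to `-[∂ - A₁, C₋]`. One expression has only nonnegative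
orders, the other only orders at most `-1 + 1 = 0`, so only order zero is left; there `C₊`
contributes `∂` of its zeroth coefficient. -/
theorem IsAdmissible.mder_posPart (hC : IsAdmissible h C) :
    mder h (posPart C) = mono 0 (Unitization.inr (flow C)) := by
  ext1 k
  rw [mono_apply]
  rcases lt_trichotomy k 0 with hk | rfl | hk
  · rw [mder_apply, posPart_apply, posPart_apply, if_neg (by omega), if_neg (by omega),
      if_neg (by omega)]
    simp
  · rw [if_pos rfl]
    refine OpCoef.ext ?_ ?_
    · have e := mder_mem_vanishing h hC.negPart_mem 0
      rw [mder_negPart C hC.mder_eq, neg_apply, Unitization.fst_neg, neg_eq_zero] at e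
      rw [e]; rfl
    · rw [mder_apply, posPart_apply, posPart_apply, if_pos le_rfl, if_neg (by omega)]
      simp only [map_zero, sub_self, mul_zero, sub_zero, sh_zero, zero_mul, dxDer_snd]
      rfl
  · rw [if_neg hk.ne', ← neg_neg (mder h (posPart C)), ← mder_negPart C hC.mder_eq, neg_apply,
      mder_apply, negPart_apply, negPart_apply, if_pos hk.le, if_pos (by omega)]
    simp

theorem mul_fst (C D : Op) (k : ℤ) :
    ((C * D) k).fst = ∑ᶠ j, (C j).fst * coefShift j (D (k - j)).fst := by
  rw [mul_apply, fst_finsum (mul_finite C D k)]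
  simp only [Unitization.fst_mul, sh_fst]

theorem IsAdmissible.one : IsAdmissible h 1 where
  mder_eq := mder_one h
  fst_neg k hk := by rw [one_def, mono_apply, if_neg hk.ne]; rfl
  fst_time k := by rw [one_def, mono_apply]; split_ifs <;> simp

theorem IsAdmissible.mul (hC : IsAdmissible h C) (hD : IsAdmissible h D) :
    IsAdmissible h (C * D) where
  mder_eq := mder_mul_eq_zero h hC.mder_eq hD.mder_eq
  fst_neg k hk := by
    rw [mul_fst]
    refine finsum_eq_zero_of_forall_eq_zero fun j => ?_
    rcases lt_or_ge j 0 with hj | hj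
    · rw [hC.fst_neg j hj, zero_mul]
    · rw [hD.fst_neg (k - j) (by omega), map_zero, mul_zero]
  fst_time k := by
    have e2 := AddMonoidHom.map_finsum (coefDt : Coef →+ Coef)
      (f := fun j => (C j).fst * coefShift j (D (k - j)).fst)
      ((mul_finite C D k).subset fun j hj h0 => hj (by
        have := congrArg (fun a : OpCoef => a.fst) h0
        simpa only [Unitization.fst_mul, sh_fst, Unitization.fst_zero] using this))
    rw [mul_fst]
    refine e2.trans (finsum_eq_zero_of_forall_eq_zero fun j => ?_)
    change coefDt (_ * _) = 0
    rw [Derivation.leibniz, coefDt_shift, hC.fst_time, hD.fst_time]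
    simp

theorem IsAdmissible.pow (hC : IsAdmissible h C) (m : ℕ) : IsAdmissible h (C ^ m) := by
  induction m with
  | zero => rw [pow_zero]; exact IsAdmissible.one
  | succ m ih => rw [pow_succ]; exact ih.mul hC

/-! ### Variations -/

/-- `X` generates the change of every operator that commutes with `∂ - A₁` when `u` moves in the
direction `f`, as an infinitesimal conjugation. -/
theorem exists_variation (hh : h ≠ 0) (f : Fn) :
    ∃ X ∈ vanishing, (∀ k, 0 ≤ k → X k = 0) ∧ mder h X = mono 0 (Unitization.inr f) :=
  exists_mder_eq hh (mono_inr_mem_vanishing 0 f) fun k hk => by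
    rw [mono_apply, if_neg hk.ne']

theorem der_along_lam (b : ℝ) (g : Fn) :
    der (alongDer b g) (lam h) = mono 0 (Unitization.inr g) := by
  have e : (alongDer b g).toHom (Unitization.inr Fn.u) = Unitization.inr g :=
    OpCoef.ext (by simp) (by simp [Fn.along_u])
  rw [lam, freeLax, map_add, map_sub, der_mono, der_mono, der_mono, alongDer_const, mono_zero,
    mono_zero, sub_self, zero_add, e]

/-- The derivative fails to commute with `[∂ - A₁, ·]` because `A₁` contains `u`; the correction is
the commutator with the direction `g`. -/
theorem der_along_mder (b : ℝ) (g : Fn) (A : Op) :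
    der (alongDer b g) (mder h A) = mder h (der (alongDer b g) A) -
      (mono 0 (Unitization.inr g) * A - A * mono 0 (Unitization.inr g)) := by
  have e : der (alongDer b g) (der dxDer A) = der dxDer (der (alongDer b g) A) := by
    ext1 k; exact alongDer_dxDer b g (A k)
  rw [mder_def, mder_def, map_sub, map_sub, der_mul, der_mul, der_along_lam, e]
  abel

/-- The derivative of an admissible operator. -/
theorem IsAdmissible.der_along (hh : h ≠ 0) (hC : IsAdmissible h C) (b : ℝ) {g : Fn} {X : Op}
    (hX : X ∈ vanishing) (e : mder h X = mono 0 (Unitization.inr g)) :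
    der (alongDer b g) C = X * C - C * X := by
  -- Both sides vanish at `u = 0`, the left one because `C|_{u = 0}` is free of time, and both have
  -- image `[g, C]` under `[∂ - A₁, ·]`.
  refine eq_of_mder_eq hh ?_ (sub_mem (mul_mem_vanishing_left hX C)
    (mul_mem_vanishing_right C hX)) ?_
  · intro k
    rw [der_apply, alongDer_fst, hC.fst_time, smul_zero]
  · have e2 := der_along_mder (h := h) b g C
    rw [hC.mder_eq, map_zero] at e2
    rw [mder_comm, e, hC.mder_eq, mul_zero, zero_mul, sub_self, add_zero, sub_eq_zero.1 e2.symm]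

theorem IsAdmissible.along_covariant (hh : h ≠ 0) (hC : IsAdmissible h C) (b : ℝ) {g : Fn}
    {X : Op} (hX : X ∈ vanishing) (e : mder h X = mono 0 (Unitization.inr g)) :
    Fn.along b g (covariant C) = ((X * C - C * X) 0).snd := by
  rw [← hC.der_along hh b hX e, der_apply, alongDer_snd, covariant]

/-- Moving only the time does not change `A₁`, so `X = 0` is the generator of the variation. -/
theorem IsAdmissible.explicitDt_covariant (hh : h ≠ 0) (hC : IsAdmissible h C) :
    Fn.explicitDt (covariant C) = 0 := by
  rw [Fn.explicitDt, hC.along_covariant hh 1 (zero_mem vanishing)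
    (by rw [map_zero, Unitization.inr_zero, mono_zero])]
  simp

theorem IsAdmissible.explicitDt_flow (hh : h ≠ 0) (hC : IsAdmissible h C) :
    Fn.explicitDt (flow C) = 0 := by
  rw [flow, Fn.explicitDt, Fn.along_dx, ← Fn.explicitDt, hC.explicitDt_covariant hh, Fn.dx_zero]

theorem gateaux_dx (f g : Fn) : Fn.gateaux (Fn.dx f) g = Fn.dx (Fn.gateaux f g) :=
  Fn.along_dx 0 g f

/-- The variation along `K_C` is generated by `-C₋`. Splitting `[C, D]` into difference and negative
parts, the commutators of equal types contribute nothing at order zero, and what remains are the two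
variations. -/
theorem gateaux_covariant_sub (hh : h ≠ 0) (hC : IsAdmissible h C) (hD : IsAdmissible h D) :
    Fn.gateaux (covariant C) (flow D) - Fn.gateaux (covariant D) (flow C) =
      covariant (C * D - D * C) := by
  have aux : ∀ {C}, IsAdmissible h C →
      mder h (-negPart C) = mono 0 (Unitization.inr (flow C)) := fun {C} hC => by
    rw [map_neg, mder_negPart C hC.mder_eq, neg_neg, hC.mder_posPart]
  rw [Fn.gateaux, Fn.gateaux, hC.along_covariant hh 0 (neg_mem hD.negPart_mem) (aux hD),
    hD.along_covariant hh 0 (neg_mem hC.negPart_mem) (aux hC), ← snd_sub, ← sub_apply]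
  -- Substituting `C₊ = C - C₋` and `D₊ = D - D₋` makes this an identity of associative algebra.
  have e : -negPart D * C - C * -negPart D - (-negPart C * D - D * -negPart C) =
      (C * D - D * C) - (posPart C * posPart D - posPart D * posPart C) +
        (negPart C * negPart D - negPart D * negPart C) := by
    have e1 : posPart C = C - negPart C := eq_sub_of_add_eq (posPart_add_negPart C)
    have e2 : posPart D = D - negPart D := eq_sub_of_add_eq (posPart_add_negPart D)
    rw [e1, e2]; noncomm_ring
  rw [e, add_apply, sub_apply, sub_apply (posPart C * _), sub_apply (negPart C * _),
    posPart_mul_posPart_apply_zero, posPart_mul_posPart_apply_zero,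
    negPart_mul_negPart_apply_zero, negPart_mul_negPart_apply_zero, mul_comm (D 0), sub_self,
    sub_self, sub_zero, add_zero, covariant]

/-- The flows represent the commutator. -/
theorem lie_flow (hh : h ≠ 0) (hC : IsAdmissible h C) (hD : IsAdmissible h D) :
    Fn.lie (flow C) (flow D) = flow (C * D - D * C) := by
  rw [Fn.lie, flow, flow, gateaux_dx, gateaux_dx, ← Fn.dx_sub]
  exact congrArg Fn.dx (gateaux_covariant_sub hh hC hD)

/-! ### The trace pairing -/

/-- `∑ₙ ∫ a b dx` for coefficients that vanish at `u = 0`. -/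
def coefIntegral (a b : OpCoef) : Functional := integral a.snd b.snd

/-- `∑ₙ ∫ (A B)₀ dx` for operators that vanish at `u = 0`, with `( )₀` the coefficient of `E ^ 0`. -/
def pairing (A B : Op) : Functional := ∑ᶠ j, coefIntegral (A j) (sh j (B (-j)))

end Op

theorem integral_comm (f g : Fn) : integral f g = integral g f := by
  rw [← sub_eq_zero, integral, integral, ← map_sub]
  exact (Submodule.Quotient.mk_eq_zero _).2 (Submodule.subset_span (FunctionalRel.symm f g))

theorem integral_mul (f g k : Fn) : integral (f * g) k = integral f (g * k) := by
  rw [← sub_eq_zero, integral, integral, ← map_sub]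
  exact (Submodule.Quotient.mk_eq_zero _).2 (Submodule.subset_span (FunctionalRel.mul f g k))

theorem integral_smul (c : Coef) (f g : Fn) : integral (c • f) g = integral f (c • g) := by
  rw [← sub_eq_zero, integral, integral, ← map_sub]
  exact (Submodule.Quotient.mk_eq_zero _).2 (Submodule.subset_span (FunctionalRel.smul c f g))

theorem integral_dx (f g : Fn) : integral (Fn.dx f) g = -integral f (Fn.dx g) := by
  rw [← add_eq_zero_iff_eq_neg, integral, integral, ← map_add]
  exact (Submodule.Quotient.mk_eq_zero _).2 (Submodule.subset_span (FunctionalRel.byParts f g))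

theorem integral_shift (k : ℤ) (f g : Fn) :
    integral (Fn.shift k f) (Fn.shift k g) = integral f g := by
  rw [← sub_eq_zero, integral, integral, ← map_sub]
  exact (Submodule.Quotient.mk_eq_zero _).2 (Submodule.subset_span (FunctionalRel.shift k f g))

theorem integral_add_left (f f' g : Fn) : integral (f + f') g = integral f g + integral f' g := by
  rw [integral, TensorProduct.add_tmul, map_add]; rfl

theorem integral_add_right (f g g' : Fn) : integral f (g + g') = integral f g + integral f g' := by
  rw [integral, TensorProduct.tmul_add, map_add]; rfl

theorem integral_real_smul_left (r : ℝ) (f g : Fn) : integral (r • f) g = r • integral f g := by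
  rw [integral, ← TensorProduct.smul_tmul', map_smul]; rfl

theorem integral_real_smul_right (r : ℝ) (f g : Fn) : integral f (r • g) = r • integral f g := by
  rw [integral_comm, integral_real_smul_left, integral_comm]

/-- The integral as an additive map in the first argument. -/
def integralHom (g : Fn) : Fn →+ Functional :=
  AddMonoidHom.mk' (fun f => integral f g) fun f f' => integral_add_left f f' g

theorem integral_zero_left (g : Fn) : integral 0 g = 0 := map_zero (integralHom g)

theorem integral_zero_right (f : Fn) : integral f 0 = 0 := by
  rw [integral_comm, integral_zero_left]

theorem integral_neg_left (f g : Fn) : integral (-f) g = -integral f g := map_neg (integralHom g) f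

theorem integral_neg_right (f g : Fn) : integral f (-g) = -integral f g := by
  rw [integral_comm, integral_neg_left, integral_comm]

namespace Op

open OpCoef

theorem coefIntegral_comm (a b : OpCoef) : coefIntegral a b = coefIntegral b a :=
  integral_comm _ _

theorem coefIntegral_sh (k : ℤ) (a b : OpCoef) :
    coefIntegral (sh k a) (sh k b) = coefIntegral a b := by
  simp only [coefIntegral, sh_snd, integral_shift]

theorem coefIntegral_zero_left (a : OpCoef) : coefIntegral 0 a = 0 := integral_zero_left _

theorem coefIntegral_zero_right (a : OpCoef) : coefIntegral a 0 = 0 := integral_zero_right _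

theorem coefIntegral_add_left (a a' b : OpCoef) :
    coefIntegral (a + a') b = coefIntegral a b + coefIntegral a' b := integral_add_left _ _ _

/-- The polynomial part of `c` moves across by `integral_smul`, its `𝓕`-part by `integral_mul`. With
`a` and `b` vanishing at `u = 0`, no products of pure polynomials arise, so no information is lost
in `snd`. -/
theorem coefIntegral_mul {a b : OpCoef} (ha : a.fst = 0) (hb : b.fst = 0) (c : OpCoef) :
    coefIntegral (a * c) b = coefIntegral a (c * b) := by
  rw [coefIntegral, coefIntegral, Unitization.snd_mul, Unitization.snd_mul, ha, hb]
  rw [zero_smul, zero_add, add_zero, integral_add_left, integral_add_right,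
    integral_smul, integral_mul]

theorem pairing_finite (A B : Op) :
    (Function.support fun j => coefIntegral (A j) (sh j (B (-j)))).Finite := by
  obtain ⟨N, hN⟩ := A.exists_bound
  obtain ⟨N', hN'⟩ := B.exists_bound
  refine (Set.finite_Icc (-N') N).subset fun j hj => ⟨?_, ?_⟩
  · by_contra h
    exact hj (by simp only [hN' (-j) (by omega), map_zero, coefIntegral_zero_right])
  · by_contra h
    exact hj (by simp only [hN j (by omega), coefIntegral_zero_left])

/-- The terms of index `j` and `-j` differ by a shift of `n` by `j`, under which the sum over `n` is
invariant. -/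
theorem pairing_comm (A B : Op) : pairing A B = pairing B A := by
  rw [pairing, pairing, ← finsum_comp_equiv (Equiv.neg ℤ)]
  refine finsum_congr fun j => ?_
  rw [Equiv.neg_apply, neg_neg, ← coefIntegral_sh j, sh_sh, add_neg_cancel, sh_zero,
    coefIntegral_comm]

theorem pairing_add_left (A A' B : Op) : pairing (A + A') B = pairing A B + pairing A' B := by
  rw [pairing, pairing, pairing, ← finsum_add_distrib (pairing_finite A B) (pairing_finite A' B)]
  exact finsum_congr fun j => by rw [add_apply, coefIntegral_add_left]

/-- The pairing as an additive map in the first argument. -/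
def pairingHom (B : Op) : Op →+ Functional :=
  AddMonoidHom.mk' (fun A => pairing A B) fun A A' => pairing_add_left A A' B

theorem pairing_sub_left (A A' B : Op) : pairing (A - A') B = pairing A B - pairing A' B :=
  map_sub (pairingHom B) A A'

theorem pairing_sub_right (A B B' : Op) : pairing A (B - B') = pairing A B - pairing A B' := by
  rw [pairing_comm, pairing_sub_left, pairing_comm, pairing_comm B']

/-- Associativity inside the trace; with `pairing_comm` it gives cyclicity. The outer factors must
vanish at `u = 0`, while `C` is arbitrary, so that `A₁` may be used for it. -/
theorem pairing_mul {A B : Op} (hA : A ∈ vanishing) (hB : B ∈ vanishing) (C : Op) :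
    pairing (A * C) B = pairing A (C * B) := by
  have e1 : pairing (A * C) B = ∑ᶠ i, ∑ᶠ j, coefIntegral (A j)
      (sh j (C (i - j)) * sh (j + (i - j)) (B (-(j + (i - j))))) := by
    refine finsum_congr fun i => ?_
    have := AddMonoidHom.map_finsum (AddMonoidHom.mk'
      (fun a => coefIntegral a (sh i (B (-i)))) fun a a' => coefIntegral_add_left a a' _)
      (mul_finite A C i)
    rw [mul_apply]
    refine this.trans (finsum_congr fun j => ?_)
    rw [add_sub_cancel]
    exact coefIntegral_mul (hA j) (by rw [sh_fst, hB, map_zero]) _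
  have e2 : pairing A (C * B) = ∑ᶠ j, ∑ᶠ l, coefIntegral (A j)
      (sh j (C l) * sh (j + l) (B (-(j + l)))) := by
    refine finsum_congr fun j => ?_
    have fin : (Function.support fun l => sh j (C l * sh l (B (-j - l)))).Finite :=
      (mul_finite C B (-j)).subset fun l hl h0 => hl ((congrArg (sh j) h0).trans (map_zero _))
    have := AddMonoidHom.map_finsum (AddMonoidHom.mk'
      (fun a => coefIntegral a (A j)) fun a a' => coefIntegral_add_left a a' _) fin
    rw [mul_apply, sh_finsum j (mul_finite C B (-j)), coefIntegral_comm]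
    refine this.trans (finsum_congr fun l => ?_)
    change coefIntegral _ _ = _
    rw [coefIntegral_comm, map_mul, sh_sh, neg_add']
  rw [e1, e2]
  let T : ℤ → ℤ → Functional := fun j l =>
    coefIntegral (A j) (sh j (C l) * sh (j + l) (B (-(j + l))))
  refine finsum_finsum_sub T
    (triple_finite A C B 0 T (fun j l h0 => ?_) (fun j l h0 => ?_) (fun j l h0 => ?_))
  · simp only [T]; rw [h0, coefIntegral_zero_left]
  · simp only [T]; rw [h0, map_zero, zero_mul, coefIntegral_zero_right]
  · rw [zero_sub] at h0
    simp only [T]; rw [h0, map_zero, mul_zero, coefIntegral_zero_right]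

theorem pairing_der {A B : Op} : pairing (der dxDer A) B = -pairing A (der dxDer B) := by
  rw [pairing, pairing, ← finsum_neg_distrib]
  refine finsum_congr fun j => ?_
  rw [der_apply, der_apply, ← dxDer.comm_shift, coefIntegral, coefIntegral, dxDer_snd, dxDer_snd,
    integral_dx]

/-- The part with `∂` is skew by integration by parts, the commutator with `A₁` by cyclicity of the
trace. -/
theorem pairing_mder {A B : Op} (hA : A ∈ vanishing) (hB : B ∈ vanishing) :
    pairing (mder h A) B = -pairing A (mder h B) := by
  rw [mder_def, mder_def, pairing_sub_left, pairing_sub_right, pairing_sub_left, pairing_sub_right,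
    pairing_der, pairing_comm (lam h * A), ← pairing_mul hB hA, pairing_comm (B * lam h),
    pairing_mul hA hB]
  abel

theorem pairing_mono (A : Op) (a : OpCoef) : pairing A (mono 0 a) = coefIntegral (A 0) a := by
  rw [pairing, finsum_eq_single _ 0]
  · rw [neg_zero, mono_apply, if_pos rfl, sh_zero]
  · intro j hj
    rw [mono_apply, if_neg (by omega), map_zero, coefIntegral_zero_right]

/-- The derivative of `γ_C` is self-adjoint. -/
theorem IsAdmissible.integral_gateaux_covariant (hh : h ≠ 0) (hC : IsAdmissible h C) (f g : Fn) :
    integral (Fn.gateaux (covariant C) f) g = integral f (Fn.gateaux (covariant C) g) := by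
  obtain ⟨X, hX, -, eX⟩ := exists_variation hh f
  obtain ⟨Y, hY, -, eY⟩ := exists_variation hh g
  have hf := mono_inr_mem_vanishing 0 f
  rw [Fn.gateaux, Fn.gateaux, hC.along_covariant hh 0 hX eX, hC.along_covariant hh 0 hY eY]
  have e1 : integral ((X * C - C * X) 0).snd g =
      pairing (X * C - C * X) (mono 0 (Unitization.inr g)) := by
    rw [pairing_mono, coefIntegral, Unitization.snd_inr]
  have e2 : integral f ((Y * C - C * Y) 0).snd =
      pairing (mono 0 (Unitization.inr f)) (Y * C - C * Y) := by
    rw [pairing_comm, pairing_mono, coefIntegral, Unitization.snd_inr, integral_comm]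
  have hXC : X * C - C * X ∈ vanishing :=
    sub_mem (mul_mem_vanishing_left hX C) (mul_mem_vanishing_right C hX)
  -- Since `f = [∂ - A₁, X]` and `g = [∂ - A₁, Y]`, skewness gives `⟨[f, C], Y⟩ = -⟨[X, C], g⟩`;
  -- cyclicity then moves `C` over to `Y`.
  have e3 := pairing_mder (h := h) hXC hY
  rw [mder_comm, eX, hC.mder_eq, mul_zero, zero_mul, sub_self, add_zero, eY] at e3
  rw [e1, e2, ← neg_inj, ← e3, pairing_sub_left, pairing_sub_right, pairing_mul hf hY,
    pairing_comm (C * _), ← pairing_mul hY hf, pairing_comm (Y * C)]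
  abel

end Op

end
end DDKP

namespace DDKP
noncomputable section

/-! ## Calculus of functionals -/

namespace Fn

theorem dxInv_add (f g : Fn) : dxInv (f + g) = dxInv f + dxInv g :=
  dx_injective (by rw [dx_dxInv, dx_add, dx_dxInv, dx_dxInv])

theorem dx_smul_of_const {c : Coef} (hc : coefDx c = 0) (f : Fn) : dx (c • f) = c • dx f := by
  rw [dx_smul, hc, zero_smul, zero_add]

theorem dxInv_smul_of_const {c : Coef} (hc : coefDx c = 0) (f : Fn) :
    dxInv (c • f) = c • dxInv f :=
  dx_injective (by rw [dx_dxInv, dx_smul_of_const hc, dx_dxInv])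

theorem eq_deltaInv {f g : Fn} (h : shift 1 f - f = g) : f = deltaInv g := by
  refine sub_eq_zero.1 (eq_zero_of_shift_one_sub ?_)
  rw [shift_sub, sub_sub_sub_comm, h, shift_one_sub_deltaInv, sub_self]

theorem deltaInv_add (f g : Fn) : deltaInv (f + g) = deltaInv f + deltaInv g :=
  (eq_deltaInv (by
    rw [shift_add, add_sub_add_comm, shift_one_sub_deltaInv, shift_one_sub_deltaInv])).symm

theorem deltaInv_smul_of_const {c : Coef} (hc : coefShift 1 c = c) (f : Fn) :
    deltaInv (c • f) = c • deltaInv f :=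
  (eq_deltaInv (by rw [shift_smul, hc, ← smul_sub, shift_one_sub_deltaInv])).symm

theorem coefDx_C (r : ℝ) : coefDx (MvPolynomial.C r) = 0 := by simp [coefDx]

theorem coefShift_C (k : ℤ) (r : ℝ) : coefShift k (MvPolynomial.C r) = MvPolynomial.C r := by
  simp [coefShift, MvPolynomial.algebraMap_eq]

theorem coefDx_ct : coefDx ct = 0 := by simp [coefDx]

theorem coefShift_ct (k : ℤ) : coefShift k ct = ct := by simp [coefShift, shiftVar]

theorem coefDt_ct : coefDt ct = 1 := by simp [coefDt]

/-- The real linear maps of `𝓕` that are used below. -/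
def dxLin : Fn →ₗ[ℝ] Fn := ⟨⟨dx, dx_add⟩, fun r f => dx_smul_of_const (coefDx_C r) f⟩

def dxInvLin : Fn →ₗ[ℝ] Fn := ⟨⟨dxInv, dxInv_add⟩, fun r f => dxInv_smul_of_const (coefDx_C r) f⟩

def shiftLin (k : ℤ) : Fn →ₗ[ℝ] Fn :=
  ⟨⟨shift k, shift_add k⟩, fun r f => by
    change shift k (_ • f) = _
    rw [real_smul_def, shift_smul, coefShift_C]; rfl⟩

def deltaInvLin : Fn →ₗ[ℝ] Fn :=
  ⟨⟨deltaInv, deltaInv_add⟩, fun r f => deltaInv_smul_of_const (coefShift_C 1 r) f⟩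

def smulLin (c : Coef) : Fn →ₗ[ℝ] Fn :=
  ⟨⟨fun f => c • f, smul_add c⟩, fun r f => by
    simp only [real_smul_def, RingHom.id_apply]; rw [smul_comm]⟩

theorem real_smul_mul (r : ℝ) (f g : Fn) : (r • f) * g = r • (f * g) := by
  rw [real_smul_def, real_smul_def, smul_mul_assoc]

theorem mul_real_smul (r : ℝ) (f g : Fn) : f * (r • g) = r • (f * g) := by
  rw [mul_comm, real_smul_mul, mul_comm]

/-! ### Dependence of the derivative on the direction -/

theorem along_add_direction (b : ℝ) (g g' f : Fn) :
    along b (g + g') f = along b g f + along 0 g' f := by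
  refine ind (p := fun f => along b (g + g') f = along b g f + along 0 g' f) (fun p => ?_) f
  change alongExpr b (g + g') p = alongExpr b g p + alongExpr 0 g' p
  induction p with
  | u => rfl
  | zero => exact (add_zero _).symm
  | add p q hp hq => simp only [alongExpr, hp, hq]; abel
  | smul c p hp => simp only [alongExpr, hp, smul_add, zero_smul]; abel
  | mul p q hp hq => simp only [alongExpr, hp, hq, add_mul, mul_add]; abel
  | dx p hp => simp only [alongExpr, hp, dx_add]
  | dxInv p hp => simp only [alongExpr, hp, dxInv_add]
  | shift k p hp => simp only [alongExpr, hp, shift_add]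
  | deltaInv p hp => simp only [alongExpr, hp, deltaInv_add]

/-- Such a `c` commutes with `∂`, `∂⁻¹`, `E` and `Δ⁻¹`. It may contain the time, because with `b =
0` the time is not varied; `c = t` is one of the uses. -/
theorem along_smul_direction {c : Coef} (hx : coefDx c = 0) (hn : ∀ k, coefShift k c = c)
    (g f : Fn) : along 0 (c • g) f = c • along 0 g f := by
  refine ind (p := fun f => along 0 (c • g) f = c • along 0 g f) (fun p => ?_) f
  change alongExpr 0 (c • g) p = c • alongExpr 0 g p
  induction p with
  | u => rfl
  | zero => exact (smul_zero c).symm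
  | add p q hp hq => simp only [alongExpr, hp, hq, smul_add]
  | smul d p hp => simp only [alongExpr, hp, zero_smul, zero_add]; rw [smul_comm]
  | mul p q hp hq => simp only [alongExpr, hp, hq, smul_add, smul_mul_assoc, mul_smul_comm]
  | dx p hp => simp only [alongExpr, hp, dx_smul_of_const hx]
  | dxInv p hp => simp only [alongExpr, hp, dxInv_smul_of_const hx]
  | shift k p hp => simp only [alongExpr, hp, shift_smul, hn]
  | deltaInv p hp => simp only [alongExpr, hp, deltaInv_smul_of_const (hn 1)]

theorem along_real_smul_direction (r : ℝ) (g f : Fn) : along 0 (r • g) f = r • along 0 g f :=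
  along_smul_direction (coefDx_C r) (fun k => coefShift_C k r) g f

/-- Both derivatives are derivations compatible with every operation, hence so is their commutator.
It annihilates the coefficients, as `b` and `b'` are constants, and is determined by its value on
`u`. -/
theorem along_comm (b b' : ℝ) (g g' f : Fn) :
    along b g (along b' g' f) - along b' g' (along b g f) =
      along 0 (along b g g' - along b' g' g) f := by
  set k := along b g g' - along b' g' g with hk
  refine ind (p := fun f => along b g (along b' g' f) - along b' g' (along b g f) = along 0 k f)
    (fun p => ?_) f
  change along b g (alongExpr b' g' p) - along b' g' (alongExpr b g p) = alongExpr 0 k p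
  have mk_eq : ∀ b g p, along b g (mk p) = alongExpr b g p := fun _ _ _ => rfl
  induction p with
  | u => rfl
  | zero => simp [alongExpr]
  | add p q hp hq => simp only [alongExpr, map_add, ← hp, ← hq]; abel
  | smul c p hp =>
    simp only [alongExpr, map_add, along_smul, ← hp, mk_eq, Derivation.map_smul, zero_smul,
      smul_sub, smul_comm b b']
    abel
  | mul p q hp hq =>
    simp only [alongExpr, map_add, along_mul, ← hp, ← hq, mk_eq, sub_mul, mul_sub]
    abel
  | dx p hp => simp only [alongExpr, along_dx, ← hp, dx_sub]
  | dxInv p hp =>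
    simp only [alongExpr, along_dxInv, ← hp]; exact (map_sub dxInvLin _ _).symm
  | shift k p hp => simp only [alongExpr, along_shift, ← hp, shift_sub]
  | deltaInv p hp =>
    simp only [alongExpr, along_deltaInv, ← hp]; exact (map_sub deltaInvLin _ _).symm

/-! ### Homogeneous functions -/

/-- The functions that are homogeneous of degree `d + 1` in `u`. -/
def homogeneous (d : ℕ) : Submodule ℝ Fn where
  carrier := {f | along 0 u f = ((d : ℝ) + 1) • f ∧ ∀ r : ℝ, subst (r • u) f = r ^ (d + 1) • f}
  add_mem' := by
    rintro f g ⟨hf, hf'⟩ ⟨hg, hg'⟩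
    refine ⟨by rw [map_add, hf, hg, smul_add], fun r => ?_⟩
    rw [smul_add, ← hf', ← hg']
    exact Quotient.inductionOn₂ f g fun _ _ => rfl
  zero_mem' := ⟨by rw [map_zero, smul_zero], fun r => by rw [smul_zero]; rfl⟩
  smul_mem' := by
    rintro c f ⟨hf, hf'⟩
    refine ⟨by rw [map_smul, hf, smul_comm], fun r => ?_⟩
    rw [smul_comm, ← hf']
    exact Quotient.inductionOn f fun _ => rfl

theorem homogeneous_along {d : ℕ} {f : Fn} (hf : f ∈ homogeneous d) :
    along 0 u f = ((d : ℝ) + 1) • f := hf.1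

theorem homogeneous_subst {d : ℕ} {f : Fn} (hf : f ∈ homogeneous d) (r : ℝ) :
    subst (r • u) f = r ^ (d + 1) • f := hf.2 r

theorem map_mem_homogeneous {T : Fn →ₗ[ℝ] Fn} (h1 : ∀ f, along 0 u (T f) = T (along 0 u f))
    (h2 : ∀ v f, subst v (T f) = T (subst v f)) {d : ℕ} {f : Fn} (hf : f ∈ homogeneous d) :
    T f ∈ homogeneous d :=
  ⟨by rw [h1, homogeneous_along hf, map_smul], fun r => by
    rw [h2, homogeneous_subst hf, map_smul]⟩

theorem map_mem_iSup_homogeneous {T : Fn →ₗ[ℝ] Fn}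
    (h1 : ∀ f, along 0 u (T f) = T (along 0 u f))
    (h2 : ∀ v f, subst v (T f) = T (subst v f)) {f : Fn} (hf : f ∈ ⨆ d, homogeneous d) :
    T f ∈ ⨆ d, homogeneous d := by
  refine Submodule.iSup_induction homogeneous (motive := fun f => T f ∈ ⨆ d, homogeneous d) hf
    (fun d f hf => ?_) ?_ fun f g hf hg => ?_
  · exact Submodule.mem_iSup_of_mem d (map_mem_homogeneous h1 h2 hf)
  · rw [map_zero]; exact zero_mem _
  · rw [map_add]; exact add_mem hf hg

theorem mul_mem_homogeneous {d e : ℕ} {f g : Fn} (hf : f ∈ homogeneous d)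
    (hg : g ∈ homogeneous e) : f * g ∈ homogeneous (d + e + 1) := by
  refine ⟨?_, fun r => ?_⟩
  · rw [along_mul, homogeneous_along hf, homogeneous_along hg, real_smul_mul, mul_real_smul,
      ← add_smul]
    congr 1
    push_cast; ring
  · have e1 : subst (r • u) (f * g) = subst (r • u) f * subst (r • u) g :=
      Quotient.inductionOn₂ f g fun _ _ => rfl
    rw [e1, homogeneous_subst hf, homogeneous_subst hg, real_smul_mul, mul_real_smul, smul_smul]
    congr 1
    ring

theorem mul_mem_iSup_homogeneous {f g : Fn} (hf : f ∈ ⨆ d, homogeneous d)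
    (hg : g ∈ ⨆ d, homogeneous d) : f * g ∈ ⨆ d, homogeneous d := by
  refine Submodule.iSup_induction homogeneous (motive := fun f => f * g ∈ ⨆ d, homogeneous d) hf
    (fun d f hf => ?_) ?_ fun f f' hf hf' => ?_
  · refine Submodule.iSup_induction homogeneous (motive := fun g => f * g ∈ ⨆ d, homogeneous d) hg
      (fun e g hg => ?_) ?_ fun g g' hg hg' => ?_
    · exact Submodule.mem_iSup_of_mem _ (mul_mem_homogeneous hf hg)
    · rw [mul_zero]; exact zero_mem _
    · rw [mul_add]; exact add_mem hg hg'
  · rw [zero_mul]; exact zero_mem _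
  · rw [add_mul]; exact add_mem hf hf'

/-- Every operation is linear and preserves the degree in `u`, except multiplication, which adds
degrees. -/
theorem mem_iSup_homogeneous (f : Fn) : f ∈ ⨆ d, homogeneous d := by
  refine ind (p := fun f => f ∈ ⨆ d, homogeneous d) (fun p => ?_) f
  induction p with
  | u =>
    refine Submodule.mem_iSup_of_mem 0 ⟨?_, fun r => ?_⟩
    · change u = _
      rw [Nat.cast_zero, zero_add, one_smul]; rfl
    · rw [zero_add, pow_one]; rfl
  | zero => exact zero_mem _
  | add p q hp hq => exact add_mem hp hq
  | smul c p hp =>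
    exact map_mem_iSup_homogeneous (T := smulLin c)
      (fun f => by
        change along 0 u (c • f) = c • _
        rw [along_smul, zero_smul, zero_smul, zero_add])
      (fun v f => Quotient.inductionOn f fun _ => rfl) hp
  | mul p q hp hq => exact mul_mem_iSup_homogeneous hp hq
  | dx p hp =>
    exact map_mem_iSup_homogeneous (T := dxLin) (along_dx 0 u)
      (fun v f => Quotient.inductionOn f fun _ => rfl) hp
  | dxInv p hp =>
    exact map_mem_iSup_homogeneous (T := dxInvLin) (along_dxInv 0 u)
      (fun v f => Quotient.inductionOn f fun _ => rfl) hp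
  | shift k p hp =>
    exact map_mem_iSup_homogeneous (T := shiftLin k) (along_shift 0 u k)
      (fun v f => Quotient.inductionOn f fun _ => rfl) hp
  | deltaInv p hp =>
    exact map_mem_iSup_homogeneous (T := deltaInvLin) (along_deltaInv 0 u)
      (fun v f => Quotient.inductionOn f fun _ => rfl) hp

theorem homogeneous_induction {p : Fn → Prop} (h0 : p 0) (hadd : ∀ f g, p f → p g → p (f + g))
    (hom : ∀ d, ∀ f ∈ homogeneous d, p f) (f : Fn) : p f :=
  Submodule.iSup_induction homogeneous (motive := p) (mem_iSup_homogeneous f) hom h0 hadd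

theorem exists_homogeneous_sum (f : Fn) :
    ∃ φ : ℕ →₀ Fn, (∀ d, φ d ∈ homogeneous d) ∧ ∑ d ∈ φ.support, φ d = f :=
  (Submodule.mem_iSup_iff_exists_finsupp homogeneous f).1 (mem_iSup_homogeneous f)

end Fn

/-! ### Derivatives of functionals -/

namespace Functional

theorem induction {p : Functional → Prop} (hadd : ∀ I J, p I → p J → p (I + J))
    (hint : ∀ f g, p (integral f g)) (I : Functional) : p I := by
  refine Submodule.Quotient.induction_on _ I fun z => ?_
  induction z with
  | zero => rw [← TensorProduct.zero_tmul Fn (0 : Fn)]; exact hint 0 0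
  | tmul f g => exact hint f g
  | add x y hx hy => exact hadd _ _ hx hy

theorem along_integral (b : ℝ) (g f k : Fn) : along b g (integral f k) =
    integral (Fn.along b g f) k + integral f (Fn.along b g k) := rfl

theorem along_inner (b : ℝ) (h : ℝ) (g f k : Fn) : along b g (inner h f k) =
    inner h (Fn.along b g f) k + inner h f (Fn.along b g k) := by
  rw [inner, map_smul, along_integral, smul_add]; rfl

theorem timeMul_integral (f g : Fn) : timeMul (integral f g) = integral (ct • f) g := rfl

theorem timeMul_inner (h : ℝ) (f g : Fn) : timeMul (inner h f g) = inner h (ct • f) g := by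
  rw [inner, map_smul, timeMul_integral]; rfl

theorem along_timeMul (b : ℝ) (g : Fn) (I : Functional) :
    along b g (timeMul I) = b • I + timeMul (along b g I) := by
  induction I using induction with
  | hadd I J hI hJ => rw [map_add, map_add, hI, hJ, map_add, map_add, smul_add]; abel
  | hint f k =>
    have e : (b • (1 : Coef)) • f = b • f := by
      rw [MvPolynomial.smul_eq_C_mul, mul_one]; rfl
    rw [timeMul_integral, along_integral, Fn.along_smul, Fn.coefDt_ct, along_integral, map_add,
      timeMul_integral, timeMul_integral, integral_add_left, e, integral_real_smul_left]
    abel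

theorem along_add_direction (b : ℝ) (g g' : Fn) (I : Functional) :
    along b (g + g') I = along b g I + along 0 g' I := by
  induction I using induction with
  | hadd I J hI hJ => rw [map_add, hI, hJ, map_add, map_add]; abel
  | hint f k =>
    simp only [along_integral, Fn.along_add_direction, integral_add_left, integral_add_right]
    abel

theorem along_real_smul_direction (r : ℝ) (g : Fn) (I : Functional) :
    along 0 (r • g) I = r • along 0 g I := by
  induction I using induction with
  | hadd I J hI hJ => rw [map_add, hI, hJ, map_add, smul_add]
  | hint f k =>
    simp only [along_integral, Fn.along_real_smul_direction, integral_real_smul_left,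
      integral_real_smul_right, smul_add]

theorem along_comm (b b' : ℝ) (g g' : Fn) (I : Functional) :
    along b g (along b' g' I) - along b' g' (along b g I) =
      along 0 (Fn.along b g g' - Fn.along b' g' g) I := by
  induction I using induction with
  | hadd I J hI hJ => simp only [map_add, ← hI, ← hJ]; abel
  | hint f k =>
    rw [along_integral 0, ← Fn.along_comm, ← Fn.along_comm]
    simp only [along_integral, map_add, sub_eq_add_neg, integral_add_left, integral_add_right,
      integral_neg_left, integral_neg_right]
    abel

/-! ### The Euler operator -/

/-- The derivative along `u`. -/
def euler : Module.End ℝ Functional := along 0 Fn.u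

theorem euler_apply (I : Functional) : euler I = along 0 Fn.u I := rfl

/-- A sum of eigenvectors of the Euler operator with eigenvalues different from `μ` is not an
eigenvector for `μ`. -/
theorem eq_zero_of_euler_eq {s : Set ℝ} {I : Functional} {μ : ℝ}
    (hI : I ∈ ⨆ ν ∈ s, euler.eigenspace ν) (hμ : μ ∉ s) (h : euler I = μ • I) : I = 0 := by
  have h1 := (Module.End.eigenspaces_iSupIndep euler) μ
  refine Submodule.disjoint_def.1 h1 I (Module.End.mem_eigenspace_iff.2 h) ?_
  have le : ⨆ ν ∈ s, euler.eigenspace ν ≤ ⨆ ν, ⨆ _ : ν ≠ μ, euler.eigenspace ν :=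
    iSup_mono fun ν => iSup_le fun hν => le_iSup_of_le (fun e => hμ (e ▸ hν)) le_rfl
  exact le hI

theorem euler_integral {d e : ℕ} {f g : Fn} (hf : f ∈ Fn.homogeneous d)
    (hg : g ∈ Fn.homogeneous e) :
    euler (integral f g) = ((d : ℝ) + e + 2) • integral f g := by
  rw [euler_apply, along_integral, Fn.homogeneous_along hf, Fn.homogeneous_along hg,
    integral_real_smul_left, integral_real_smul_right, ← add_smul]
  congr 1
  ring

/-- An integrand is a product of two functions without constant term, so its degree is at least two.
Consequently a functional annihilated by the Euler operator is zero. -/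
theorem mem_iSup_eigenspace (I : Functional) : I ∈ ⨆ ν ∈ Set.Ioi (0 : ℝ), euler.eigenspace ν := by
  induction I using induction with
  | hadd I J hI hJ => exact add_mem hI hJ
  | hint f g =>
    refine Fn.homogeneous_induction (p := fun f => integral f g ∈ _) ?_ (fun f f' hf hf' => ?_)
      (fun d f hf => ?_) f
    · rw [integral_zero_left]; exact zero_mem _
    · rw [integral_add_left]; exact add_mem hf hf'
    refine Fn.homogeneous_induction (p := fun g => integral f g ∈ _) ?_ (fun g g' hg hg' => ?_)
      (fun e g hg => ?_) g
    · rw [integral_zero_right]; exact zero_mem _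
    · rw [integral_add_right]; exact add_mem hg hg'
    · exact Submodule.mem_iSup_of_mem ((d : ℝ) + e + 2) (Submodule.mem_iSup_of_mem
        (Set.mem_Ioi.2 (by positivity)) (Module.End.mem_eigenspace_iff.2 (euler_integral hf hg)))

theorem eq_zero_of_euler_eq_zero {I : Functional} (h : euler I = 0) : I = 0 :=
  eq_zero_of_euler_eq (μ := 0) (mem_iSup_eigenspace I) (by simp) (by rw [h, zero_smul])

/-! ### Gradients -/

/-- The inner product as a bilinear map. -/
def innerBilin (h : ℝ) : Fn →ₗ[ℝ] Fn →ₗ[ℝ] Functional :=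
  LinearMap.mk₂ ℝ (inner h)
    (fun f f' g => by rw [inner, integral_add_left, smul_add]; rfl)
    (fun r f g => by rw [inner, integral_real_smul_left, smul_comm]; rfl)
    (fun f g g' => by rw [inner, integral_add_right, smul_add]; rfl)
    (fun r f g => by rw [inner, integral_real_smul_right, smul_comm]; rfl)

theorem inner_eq (h : ℝ) (f g : Fn) : inner h f g = innerBilin h f g := rfl

theorem inner_comm (h : ℝ) (f g : Fn) : inner h f g = inner h g f := by
  rw [inner, inner, integral_comm]

/-- `γ` is the gradient of `I`. -/
def IsGradient (h : ℝ) (I : Functional) (γ : Fn) : Prop := ∀ g, along 0 g I = inner h γ g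

theorem IsGradient.add {h : ℝ} {I J : Functional} {γ δ : Fn} (hI : IsGradient h I γ)
    (hJ : IsGradient h J δ) : IsGradient h (I + J) (γ + δ) := fun g => by
  rw [map_add, hI, hJ, inner_eq, inner_eq, inner_eq, map_add, LinearMap.add_apply]

theorem IsGradient.smul {h : ℝ} {I : Functional} {γ : Fn} (hI : IsGradient h I γ) (r : ℝ) :
    IsGradient h (r • I) (r • γ) := fun g => by
  rw [map_smul, hI, inner_eq, inner_eq, map_smul, LinearMap.smul_apply]

theorem IsGradient.sub {h : ℝ} {I J : Functional} {γ δ : Fn} (hI : IsGradient h I γ)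
    (hJ : IsGradient h J δ) : IsGradient h (I - J) (γ - δ) := fun g => by
  rw [map_sub, hI, hJ, inner_eq, inner_eq, inner_eq, map_sub, LinearMap.sub_apply]

/-- A functional is determined by its gradient. -/
theorem IsGradient.unique {h : ℝ} {I J : Functional} {γ : Fn} (hI : IsGradient h I γ)
    (hJ : IsGradient h J γ) : I = J :=
  sub_eq_zero.1 (eq_zero_of_euler_eq_zero (by rw [euler_apply, map_sub, hI, hJ, sub_self]))

/-- Differentiating along a function of degree `e + 1` replaces one factor `u` by `e + 1` of them,
raising the degree by `e`. -/
theorem euler_along {e : ℕ} {g : Fn} (hg : g ∈ Fn.homogeneous e) (I : Functional) :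
    euler (along 0 g I) = along 0 g (euler I) + (e : ℝ) • along 0 g I := by
  have := along_comm 0 0 Fn.u g I
  rw [Fn.homogeneous_along hg, Fn.along_u] at this
  rw [← sub_eq_iff_eq_add', euler_apply, euler_apply, this, ← along_real_smul_direction]
  congr 2
  rw [add_smul, one_smul, add_sub_cancel_right]

theorem u_mem_homogeneous : Fn.u ∈ Fn.homogeneous 0 :=
  ⟨by rw [Fn.along_u, Nat.cast_zero, zero_add, one_smul], fun r => by
    rw [zero_add, pow_one]; rfl⟩

theorem euler_inner {h : ℝ} {d e : ℕ} {f g : Fn} (hf : f ∈ Fn.homogeneous d)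
    (hg : g ∈ Fn.homogeneous e) : euler (inner h f g) = ((d : ℝ) + e + 2) • inner h f g := by
  rw [inner, map_smul, euler_integral hf hg, smul_comm]

/-- A covariant with self-adjoint derivative is the gradient of its potential. -/
theorem exists_isPotential_isGradient (h : ℝ) {γ : Fn}
    (hγ : ∀ f g, inner h (Fn.gateaux γ f) g = inner h f (Fn.gateaux γ g)) :
    ∃ v, IsPotential h γ v ∧ IsGradient h v γ := by
  obtain ⟨φ, hφ, hs⟩ := Fn.exists_homogeneous_sum γ
  -- The component `φ d` has degree `d + 1`, and `1 / (d + 2)` is the integral of `λ ^ (d + 1)` over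
  -- `[0, 1]`.
  let v : ℕ → Functional := fun d => (1 / ((d : ℝ) + 2)) • inner h (φ d) Fn.u
  have hv : ∀ d, euler (v d) = ((d : ℝ) + 2) • v d := fun d => by
    rw [map_smul, euler_inner (hφ d) u_mem_homogeneous, Nat.cast_zero, add_zero, smul_comm]
  have hv' : ∀ d : ℕ, ((d : ℝ) + 2) • v d = inner h (φ d) Fn.u := fun d => by
    rw [smul_smul, mul_one_div_cancel (by positivity), one_smul]
  refine ⟨∑ d ∈ φ.support, v d, fun ℓ => ?_, fun g => ?_⟩
  · have e : (fun r : ℝ => ℓ (inner h (Fn.subst (r • Fn.u) γ) Fn.u)) =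
        fun r => ∑ d ∈ φ.support, r ^ (d + 1) * ℓ (inner h (φ d) Fn.u) := by
      funext r
      have e1 : Fn.subst (r • Fn.u) γ = ∑ d ∈ φ.support, r ^ (d + 1) • φ d := by
        let S : Fn →+ Fn := AddMonoidHom.mk' (Fn.subst (r • Fn.u)) fun f g =>
          Quotient.inductionOn₂ f g fun _ _ => rfl
        rw [← hs]
        exact (map_sum S _ _).trans
          (Finset.sum_congr rfl fun d _ => Fn.homogeneous_subst (hφ d) r)
      rw [e1, inner_eq, map_sum, LinearMap.sum_apply, map_sum]
      refine Finset.sum_congr rfl fun d _ => ?_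
      rw [map_smul, LinearMap.smul_apply, map_smul, smul_eq_mul, inner_eq]
    rw [e]
    refine ⟨Continuous.intervalIntegrable (by fun_prop) _ _, ?_⟩
    rw [intervalIntegral.integral_finsetSum
      fun d _ => Continuous.intervalIntegrable (by fun_prop) _ _, map_sum]
    refine Finset.sum_congr rfl fun d _ => ?_
    rw [intervalIntegral.integral_mul_const, integral_pow, map_smul, smul_eq_mul]
    congr 1
    push_cast
    rw [one_pow, zero_pow (by omega), sub_zero, add_assoc, one_add_one_eq_two]
  · refine Fn.homogeneous_induction (p := fun g => along 0 g (∑ d ∈ φ.support, v d) = inner h γ g)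
      ?_ (fun g g' hg hg' => ?_) (fun e g hg => ?_) g
    · have := along_real_smul_direction 0 0 (∑ d ∈ φ.support, v d)
      rw [zero_smul, zero_smul] at this
      rw [this, inner_eq, map_zero]
    · rw [along_add_direction, hg, hg', inner_eq, inner_eq, inner_eq, map_add]
    -- For `g` of degree `e + 1`, the error is a sum of eigenvectors with eigenvalues `d + e + 2 >
    -- e`, whereas self-adjointness of `γ'` shows that the Euler operator multiplies it by `e`.
    -- Hence it is zero.
    rw [← sub_eq_zero]
    refine eq_zero_of_euler_eq (s := Set.Ioi (e : ℝ)) (μ := e) ?_ (by simp) ?_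
    · have e1 : along 0 g (∑ d ∈ φ.support, v d) - inner h γ g =
          ∑ d ∈ φ.support, (along 0 g (v d) - inner h (φ d) g) := by
        rw [Finset.sum_sub_distrib, map_sum]
        congr 1
        nth_rewrite 1 [← hs]
        rw [inner_eq, map_sum, LinearMap.sum_apply]
        rfl
      rw [e1]
      refine sum_mem fun d _ => Submodule.mem_iSup_of_mem ((d : ℝ) + e + 2)
        (Submodule.mem_iSup_of_mem (Set.mem_Ioi.2 ?_) (Module.End.mem_eigenspace_iff.2 ?_))
      · have : (0 : ℝ) ≤ d := Nat.cast_nonneg d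
        linarith
      · rw [map_sub, euler_along hg, hv, map_smul, euler_inner (hφ d) hg, smul_sub, ← add_smul]
        congr 2
        ring
    · have e2 : euler (∑ d ∈ φ.support, v d) = inner h γ Fn.u := by
        rw [map_sum]
        rw [← hs]
        rw [inner_eq, map_sum, LinearMap.sum_apply]
        exact Finset.sum_congr rfl fun d _ => by rw [hv, hv', inner_eq]
      have e3 : euler (inner h γ g) =
          inner h (Fn.gateaux γ Fn.u) g + ((e : ℝ) + 1) • inner h γ g := by
        rw [euler_apply, along_inner, Fn.homogeneous_along hg, inner_eq h γ, map_smul]; rfl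
      have e4 : along 0 g (inner h γ Fn.u) = inner h (Fn.gateaux γ Fn.u) g + inner h γ g := by
        rw [along_inner, Fn.along_u, ← Fn.gateaux, hγ, inner_comm h g]
      rw [map_sub, euler_along hg, e2, e3, e4, smul_sub, add_smul, one_smul]
      abel

theorem IsPotential.unique {h : ℝ} {γ : Fn} {v w : Functional} (hv : IsPotential h γ v)
    (hw : IsPotential h γ w) : v = w := by
  -- Linear forms separate the points of a real vector space.
  rw [← sub_eq_zero, ← Module.forall_dual_apply_eq_zero_iff ℝ]
  intro ℓ
  rw [map_sub, sub_eq_zero, ← (hv ℓ).2, (hw ℓ).2]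

theorem isPotential_potential {h : ℝ} {γ : Fn} {v : Functional} (hv : IsPotential h γ v) :
    IsPotential h γ (potential h γ) :=
  Classical.epsilon_spec (p := IsPotential h γ) ⟨v, hv⟩

/-- The gradient of `(∂ α, β)` for two gradients `α`, `β`. -/
theorem isGradient_inner_dx (h : ℝ) {α β : Fn}
    (hα : ∀ f g, inner h (Fn.gateaux α f) g = inner h f (Fn.gateaux α g))
    (hβ : ∀ f g, inner h (Fn.gateaux β f) g = inner h f (Fn.gateaux β g)) :
    IsGradient h (inner h (Fn.dx α) β)
      (Fn.gateaux β (Fn.dx α) - Fn.gateaux α (Fn.dx β)) := fun g => by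
  have e : ∀ f k, inner h (Fn.dx f) k = -inner h f (Fn.dx k) := fun f k => by
    rw [inner, integral_dx, smul_neg]; rfl
  rw [along_inner, Fn.along_dx, e, ← Fn.gateaux, hα, ← Fn.gateaux, ← hβ,
    inner_eq h (_ - _), map_sub, LinearMap.sub_apply, ← inner_eq, ← inner_eq, inner_comm h g]
  abel

end Functional

end
end DDKP

namespace DDKP
noncomputable section

namespace Op

open OpCoef

/-! ### Commutation relations of the Lax and the Orlov-Schulman operators -/

/-- Multiplication by real numbers. -/
def constHom : ℝ →+* Op where
  toFun r := mono 0 (const r)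
  map_one' := by
    rw [const, map_one, Unitization.inl_one]; rfl
  map_zero' := by rw [const, map_zero, Unitization.inl_zero, mono_zero]
  map_add' r s := by rw [const, map_add, Unitization.inl_add, mono_add]; rfl
  map_mul' r s := by
    rw [mono_mul_mono, sh_const, const, map_mul, Unitization.inl_mul, add_zero]; rfl

instance : Algebra ℝ Op := constHom.toAlgebra' const_mul_comm

theorem smul_eq (r : ℝ) (A : Op) : r • A = mono 0 (const r) * A := Algebra.smul_def r A

theorem covariant_smul (r : ℝ) (C : Op) : covariant (r • C) = r • covariant C := by
  rw [smul_eq, covariant_const_mul]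

theorem IsAdmissible.lax {h : ℝ} {L : Op} (hL : L - freeLax h ∈ vanishing)
    (h0 : mder h L = 0) : IsAdmissible h L := by
  have e : ∀ k, (L k).fst = (freeLax h k).fst := fun k => by
    rw [← sub_eq_zero, ← fst_sub, ← sub_apply]; exact hL k
  refine ⟨h0, fun k hk => ?_, fun k => ?_⟩
  · rw [e, freeLax_apply_eq_zero h (Or.inl hk)]; rfl
  · rw [e, freeLax, sub_apply, mono_apply, mono_apply]
    split_ifs <;> simp [coefDt]

theorem IsAdmissible.orlov {h : ℝ} {G : Op} (hG : G - freeOrlov h ∈ vanishing)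
    (h0 : mder h G = 0) : IsAdmissible h G := by
  have e : ∀ k, (G k).fst = (freeOrlov h k).fst := fun k => by
    rw [← sub_eq_zero, ← fst_sub, ← sub_apply]; exact hG k
  refine ⟨h0, fun k hk => ?_, fun k => ?_⟩
  · rw [e, freeOrlov_apply_eq_zero h (Or.inl hk)]; rfl
  · rw [e, freeOrlov, add_apply, mono_apply, mono_apply]
    split_ifs <;> simp [coefDt]

section Commutators

variable {h : ℝ} {L G : Op}

/-- `[·, Γ]` is a derivation with value `h L + 1` on `L`. For `l = 0` the truncated exponent is
harmless because of the factor `l`. -/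
theorem pow_comm_orlov (hc : L * G - G * L = h • L + 1) (l : ℕ) :
    L ^ l * G - G * L ^ l = (l : ℝ) • (h • L ^ l + L ^ (l - 1)) := by
  induction l with
  | zero => simp
  | succ l ih =>
    have e : L ^ (l + 1) * G - G * L ^ (l + 1) =
        (L ^ l * G - G * L ^ l) * L + L ^ l * (L * G - G * L) := by
      rw [pow_succ]; noncomm_ring
    rw [e, ih, hc, add_tsub_cancel_right]
    rcases l with _ | l
    · simp
    · rw [add_tsub_cancel_right, smul_mul_assoc, add_mul, smul_mul_assoc, ← pow_succ, ← pow_succ,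
        mul_add, mul_smul_comm, ← pow_succ, mul_one]
      push_cast
      module

theorem pow_comm_orlov_mul_pow (hc : L * G - G * L = h • L + 1) (l r : ℕ) :
    L ^ l * (G * L ^ r) - G * L ^ r * L ^ l =
      (l : ℝ) • (h • L ^ (l + r) + L ^ (l + r - 1)) := by
  have e : L ^ l * (G * L ^ r) - G * L ^ r * L ^ l = (L ^ l * G - G * L ^ l) * L ^ r := by
    rw [mul_assoc G, ← pow_add, add_comm r, pow_add]; noncomm_ring
  rw [e, pow_comm_orlov hc]
  rcases l with _ | l
  · simp
  · rw [show l + 1 + r - 1 = l + r by omega, add_tsub_cancel_right, smul_mul_assoc, add_mul,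
      smul_mul_assoc, ← pow_add, ← pow_add]

/-- The commutator splits into `Γ [L^l, Γ L^r] - Γ [L^r, Γ L^l]`, since powers of `L` commute. The
exponent `l + r - 1` is truncated only for `l = r = 0`, where the factor `l - r` is zero. -/
theorem orlov_mul_pow_comm (hc : L * G - G * L = h • L + 1) (l r : ℕ) :
    G * L ^ l * (G * L ^ r) - G * L ^ r * (G * L ^ l) =
      ((l : ℝ) - r) • (h • (G * L ^ (l + r)) + G * L ^ (l + r - 1)) := by
  have e1 : L ^ l * L ^ r = L ^ r * L ^ l := by rw [← pow_add, ← pow_add, add_comm]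
  have e : G * L ^ l * (G * L ^ r) - G * L ^ r * (G * L ^ l) =
      G * (L ^ l * (G * L ^ r) - G * L ^ r * L ^ l) -
        G * (L ^ r * (G * L ^ l) - G * L ^ l * L ^ r) := by
    simp only [mul_sub, mul_assoc, e1]; abel
  rw [e, pow_comm_orlov_mul_pow hc, pow_comm_orlov_mul_pow hc, add_comm r l, ← mul_sub,
    ← sub_smul, mul_smul_comm, mul_add, mul_smul_comm]

end Commutators

/-- The coefficient of `E ^ 0` of the Orlov-Schulman operator. -/
theorem orlov_zeroth {h : ℝ} (hh : h ≠ 0) {G : Op} (hpos : ∀ k, 0 < k → G k = freeOrlov h k)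
    (h0 : mder h G = 0) : covariant G = h • cx • Fn.u := by
  have h1 : G 1 = Unitization.inl cx := by
    rw [hpos 1 one_pos, freeOrlov, add_apply, mono_apply, mono_apply, if_pos rfl,
      if_neg one_ne_zero, add_zero]
  -- The component of order one of `[∂ - A₁, Γ] = 0` reads `h⁻¹ Δ γ_Γ = x Δ u` in `𝓕`, and `Δ`
  -- commutes with `x`.
  have e := congrArg (fun a : OpCoef => a.snd) (mder_apply h G 1)
  rw [h0, h1, sub_self] at e
  simp only [zero_apply, snd_sub, Unitization.snd_mul, const_fst, const_snd, fst_sub, sh_fst,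
    sh_snd, Unitization.fst_inr, Unitization.snd_inr, Unitization.fst_inl, Unitization.snd_inl,
    Unitization.snd_zero, dxDer_snd, Fn.dx_zero, map_zero, sub_zero, smul_zero,
    mul_zero, zero_mul, zero_sub, add_zero, zero_add, ← Fn.real_smul_def] at e
  have e2 : Fn.shift 1 (covariant G) - covariant G = h • (Fn.shift 1 (cx • Fn.u) - cx • Fn.u) := by
    have e3 : h⁻¹ • (Fn.shift 1 (covariant G) - covariant G) = cx • (Fn.shift 1 Fn.u - Fn.u) := by
      rw [← sub_eq_zero, covariant, smul_sub cx, ← neg_eq_zero, e, smul_sub cx]; abel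
    rw [Fn.shift_smul, show coefShift 1 cx = cx by simp [coefShift, shiftVar], ← smul_sub, ← e3,
      smul_inv_smul₀ hh]
  refine sub_eq_zero.1 (Fn.eq_zero_of_shift_one_sub ?_)
  have e4 : Fn.shift 1 (h • cx • Fn.u) = h • Fn.shift 1 (cx • Fn.u) := (Fn.shiftLin 1).map_smul h (cx • Fn.u)
  rw [Fn.shift_sub, sub_sub_sub_comm, e2, e4, smul_sub, sub_self]

end Op

open Op Functional

/-! ## The hierarchies -/

/-- `ℓ` and `Γ` are the operators whose powers and products generate the flows of `L` and `B`. -/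
structure Generates (h : ℝ) (L : PDO) (B : ℕ → PDO) (ℓ Γ : Op) : Prop where
  lax : IsAdmissible h ℓ
  orlov : IsAdmissible h Γ
  comm : ℓ * Γ - Γ * ℓ = h • ℓ + 1
  covariant_lax : covariant ℓ = Fn.u
  covariant_orlov : covariant Γ = h • cx • Fn.u
  flowK_eq : ∀ m, flowK L m = flow (ℓ ^ m)
  flowSigma_eq : ∀ m, flowSigma L B (m + 1) = flow (Γ * ℓ ^ m)

/-! ### Gradients of pairings of flows with covariants -/

section Admissible

variable {h : ℝ} {C D : Op}

theorem inner_gateaux_covariant (hh : h ≠ 0) (hC : IsAdmissible h C) (f g : Fn) :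
    inner h (Fn.gateaux (covariant C) f) g = inner h f (Fn.gateaux (covariant C) g) := by
  rw [inner, inner, hC.integral_gateaux_covariant hh]

/-- The gradient of `(∂ α, β)` is `β'[∂ α] - α'[∂ β]` for gradients `α`, `β`, and for the covariants
of `C` and `D` this is the covariant of a commutator. Relations between functionals thereby become
relations between operators. -/
theorem isGradient_inner_flow (hh : h ≠ 0) (hC : IsAdmissible h C) (hD : IsAdmissible h D) :
    IsGradient h (inner h (flow C) (covariant D)) (covariant (D * C - C * D)) := by
  rw [← gateaux_covariant_sub hh hD hC]
  exact isGradient_inner_dx h (inner_gateaux_covariant hh hC) (inner_gateaux_covariant hh hD)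

theorem inner_covariant_flow (C D : Op) :
    inner h (covariant C) (flow D) = -inner h (flow C) (covariant D) := by
  rw [inner, inner, flow, flow, integral_dx, smul_neg, neg_neg]

theorem Functional.IsGradient.zero (h : ℝ) : IsGradient h 0 0 := fun g => by
  rw [map_zero, inner_eq, map_zero]; rfl

theorem Functional.IsGradient.neg {I : Functional} {γ : Fn} (hI : IsGradient h I γ) :
    IsGradient h (-I) (-γ) := by
  have := (IsGradient.zero h).sub hI
  rwa [zero_sub, zero_sub] at this

/-- A functional whose gradient does not contain the time does not contain the time. -/
theorem Functional.IsGradient.explicitDt_eq_zero {I : Functional} {γ : Fn} (hI : IsGradient h I γ)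
    (hγ : Fn.explicitDt γ = 0) : Functional.explicitDt I = 0 := by
  refine eq_zero_of_euler_eq_zero ?_
  -- The explicit time derivative commutes with the Euler operator. So `euler` of the time
  -- derivative of `I` is the time derivative of `(γ, u)`, which is zero.
  have e := along_comm 1 0 0 Fn.u I
  have e0 : Functional.along 0 0 I = 0 := by rw [hI, inner_eq, map_zero]
  rw [map_zero, Fn.along_u, sub_zero, e0, hI, sub_eq_zero] at e
  rw [euler_apply, Functional.explicitDt, ← e, along_inner, Fn.along_u, ← Fn.explicitDt, hγ,
    inner_eq, inner_eq, map_zero, map_zero]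
  simp

end Admissible

/-! ### Gradients of the Hamiltonians -/

namespace Generates

variable {h : ℝ} {L : PDO} {B : ℕ → PDO} {ℓ Γ : Op}

theorem gam_eq (H : Generates h L B ℓ Γ) (m : ℕ) : gam L m = covariant (ℓ ^ m) := by
  rw [gam, H.flowK_eq, flow, Fn.dxInv_dx]

theorem omg_eq (H : Generates h L B ℓ Γ) (m : ℕ) : omg L B (m + 1) = covariant (Γ * ℓ ^ m) := by
  rw [omg, H.flowSigma_eq, flow, Fn.dxInv_dx]

theorem pow (H : Generates h L B ℓ Γ) (m : ℕ) : IsAdmissible h (ℓ ^ m) := H.lax.pow m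

theorem orlov_mul_pow (H : Generates h L B ℓ Γ) (m : ℕ) : IsAdmissible h (Γ * ℓ ^ m) :=
  H.orlov.mul (H.lax.pow m)

theorem isGradient_K_omg (hh : h ≠ 0) (H : Generates h L B ℓ Γ) (l r : ℕ) :
    IsGradient h (inner h (flow (ℓ ^ l)) (covariant (Γ * ℓ ^ r)))
      (-((l : ℝ) • (h • covariant (ℓ ^ (l + r)) + covariant (ℓ ^ (l + r - 1))))) := by
  have e := isGradient_inner_flow hh (H.pow l) (H.orlov_mul_pow r)
  rw [covariant_sub, ← neg_sub, ← covariant_sub, pow_comm_orlov_mul_pow H.comm, covariant_smul,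
    covariant_add, covariant_smul] at e
  exact e

theorem isGradient_sigma_omg (hh : h ≠ 0) (H : Generates h L B ℓ Γ) (l r : ℕ) :
    IsGradient h (inner h (flow (Γ * ℓ ^ l)) (covariant (Γ * ℓ ^ r)))
      (-(((l : ℝ) - r) • (h • covariant (Γ * ℓ ^ (l + r)) +
        covariant (Γ * ℓ ^ (l + r - 1))))) := by
  have e := isGradient_inner_flow hh (H.orlov_mul_pow l) (H.orlov_mul_pow r)
  rw [covariant_sub, ← neg_sub, ← covariant_sub, orlov_mul_pow_comm H.comm, covariant_smul,
    covariant_add, covariant_smul] at e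
  exact e

/-- Powers of one operator commute, so the gradient is zero. -/
theorem inner_K_gam (hh : h ≠ 0) (H : Generates h L B ℓ Γ) (l r : ℕ) :
    inner h (flow (ℓ ^ l)) (covariant (ℓ ^ r)) = 0 := by
  have e := isGradient_inner_flow hh (H.pow l) (H.pow r)
  have e1 : ℓ ^ r * ℓ ^ l - ℓ ^ l * ℓ ^ r = 0 := by
    rw [← pow_add, ← pow_add, add_comm, sub_self]
  rw [e1] at e
  exact e.unique (IsGradient.zero h)

/-- The gradient of `(γ_(m+1), σ₂)` is `(m + 1) (h γ_(m+2) + γ_(m+1))`, from the commutator of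
`L^(m+1)` with `Γ L`. The recursion for `H` is this relation solved for `γ_(m+2)`. -/
theorem isGradient_hamH (hh : h ≠ 0) (H : Generates h L B ℓ Γ) :
    ∀ m, IsGradient h (hamH h L B m) (covariant (ℓ ^ m))
  | 0 => IsGradient.zero h
  | 1 => fun g => by
    rw [hamH, pow_one, H.covariant_lax, map_smul, along_inner, Fn.along_u, inner_comm h g,
      ← two_smul ℝ (inner h Fn.u g), smul_smul]
    norm_num
  | m + 2 => by
    have e := (H.isGradient_K_omg hh (m + 1) 1).neg
    rw [neg_neg, ← inner_covariant_flow, ← H.gam_eq, ← H.flowSigma_eq] at e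
    have e1 := ((e.smul (1 / ((m : ℝ) + 1))).sub (H.isGradient_hamH hh (m + 1))).smul h⁻¹
    have e2 : h⁻¹ • ((1 / ((m : ℝ) + 1)) • (((m + 1 : ℕ) : ℝ) •
        (h • covariant (ℓ ^ (m + 1 + 1)) + covariant (ℓ ^ (m + 1 + 1 - 1)))) -
          covariant (ℓ ^ (m + 1))) = covariant (ℓ ^ (m + 2)) := by
      rw [smul_smul (1 / ((m : ℝ) + 1)), Nat.cast_succ, one_div_mul_cancel (by positivity),
        one_smul, add_tsub_cancel_right, add_sub_cancel_right, inv_smul_smul₀ hh]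
    rw [e2] at e1
    exact e1

theorem isPotential_hamJ_three (hh : h ≠ 0) (H : Generates h L B ℓ Γ) :
    IsPotential h (omg L B 3) (hamJ h L B 3) := by
  obtain ⟨v, hv, -⟩ := exists_isPotential_isGradient h
    (inner_gateaux_covariant hh (H.orlov_mul_pow 2))
  rw [← H.omg_eq] at hv
  exact isPotential_potential hv

/-- Here `m` counts powers of `L`, so `J` has the gradient `ω_(m+1)`, and `a = m - 1` is the factor
in the commutator of `Γ L^m` with `Γ L`. It is zero for `m = 1`, which is why `J₃` cannot be reached
by the recursion. -/
theorem isGradient_hamJ_step (hh : h ≠ 0) (H : Generates h L B ℓ Γ) (m : ℕ) {a : ℝ} (ha : a ≠ 0)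
    (ham : a = (m : ℝ) - 1) {J : Functional} (hJ : IsGradient h J (covariant (Γ * ℓ ^ m))) :
    IsGradient h (h⁻¹ • ((1 / a) • inner h (omg L B (m + 1)) (flowSigma L B 2) - J))
      (covariant (Γ * ℓ ^ (m + 1))) := by
  have e := (H.isGradient_sigma_omg hh m 1).neg
  rw [neg_neg, ← inner_covariant_flow, ← H.omg_eq, ← H.flowSigma_eq] at e
  have e1 := ((e.smul (1 / a)).sub hJ).smul h⁻¹
  rw [Nat.cast_one, ← ham, smul_smul (1 / a), one_div_mul_cancel ha, one_smul,
    add_tsub_cancel_right, add_sub_cancel_right, inv_smul_smul₀ hh] at e1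
  exact e1

/-- The recursion starts twice: at `J₁`, from the explicit `γ_Γ = h x u`, and again at `J₃`, which
is the potential of the self-adjoint covariant `ω₃`. -/
theorem isGradient_hamJ (hh : h ≠ 0) (H : Generates h L B ℓ Γ) :
    ∀ m, IsGradient h (hamJ h L B (m + 1)) (covariant (Γ * ℓ ^ m))
  | 0 => fun g => by
    have e2 : inner h (cx • g) Fn.u = inner h (cx • Fn.u) g := by
      rw [inner_comm, inner, inner, integral_smul]
    rw [hamJ, pow_zero, mul_one, H.covariant_orlov, map_smul, along_inner, Fn.along_smul,
      zero_smul, zero_smul, zero_add, Fn.along_u, e2, ← two_smul ℝ (inner h (cx • Fn.u) g),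
      smul_smul, inner_eq h (h • _), map_smul, LinearMap.smul_apply, ← inner_eq,
      div_mul_cancel₀ h two_ne_zero]
  | 1 => by
    rw [hamJ]
    exact H.isGradient_hamJ_step hh 0 (by norm_num) (by norm_num) (H.isGradient_hamJ hh 0)
  | 2 => by
    obtain ⟨v, hv, hv'⟩ := exists_isPotential_isGradient h
      (inner_gateaux_covariant hh (H.orlov_mul_pow 2))
    rw [← H.omg_eq] at hv
    rwa [(H.isPotential_hamJ_three hh).unique hv]
  | m + 3 => by
    rw [hamJ]
    exact H.isGradient_hamJ_step hh (m + 2) (by positivity) (by push_cast; ring)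
      (H.isGradient_hamJ hh (m + 2))

end Generates

end
end DDKP

namespace DDKP
noncomputable section

open Op Functional

/-! ### Explicit time in Lie products and in the inner product -/

namespace Fn

theorem lie_add_right (f g g' : Fn) : lie f (g + g') = lie f g + lie f g' := by
  rw [lie, lie, lie, gateaux, gateaux, gateaux, gateaux, gateaux, gateaux, along_add_direction,
    map_add]
  abel

theorem lie_real_smul_right (r : ℝ) (f g : Fn) : lie f (r • g) = r • lie f g := by
  rw [lie, lie, gateaux, gateaux, gateaux, gateaux, along_real_smul_direction, map_smul, smul_sub]

theorem lie_ct_smul_right (f g : Fn) : lie f (ct • g) = ct • lie f g := by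
  rw [lie, lie, gateaux, gateaux, gateaux, gateaux,
    along_smul_direction coefDx_ct coefShift_ct, along_smul, zero_smul, zero_smul, zero_add,
    smul_sub]

theorem explicitDt_ct_smul (f : Fn) : explicitDt (ct • f) = f + ct • explicitDt f := by
  rw [explicitDt, along_smul, coefDt_ct, one_smul, one_smul]; rfl

end Fn

namespace Functional

theorem inner_ct_smul_left (h : ℝ) (f g : Fn) : inner h (ct • f) g = timeMul (inner h f g) :=
  (timeMul_inner h f g).symm

theorem inner_ct_smul_right (h : ℝ) (f g : Fn) : inner h f (ct • g) = timeMul (inner h f g) := by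
  rw [inner_comm, inner_ct_smul_left, inner_comm]

theorem inner_add_left (h : ℝ) (f f' g : Fn) :
    inner h (f + f') g = inner h f g + inner h f' g := by
  simp only [inner_eq, map_add, LinearMap.add_apply]

theorem inner_add_right (h : ℝ) (f g g' : Fn) :
    inner h f (g + g') = inner h f g + inner h f g' := by
  simp only [inner_eq, map_add]

theorem inner_smul_left (h r : ℝ) (f g : Fn) : inner h (r • f) g = r • inner h f g := by
  simp only [inner_eq, map_smul, LinearMap.smul_apply]

theorem inner_smul_right (h r : ℝ) (f g : Fn) : inner h f (r • g) = r • inner h f g := by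
  simp only [inner_eq, map_smul]

end Functional

/-- The criterion for a conserved covariant of `u_t = ∂ γ` with `γ'` self-adjoint. -/
theorem isConservedCovariant_dxInv {h : ℝ} {γ κ : Fn}
    (hγ : ∀ f g, inner h (Fn.gateaux γ f) g = inner h f (Fn.gateaux γ g))
    (hκ : IsSymmetry (Fn.dx γ) κ) : IsConservedCovariant h (Fn.dx γ) (Fn.dxInv κ) := by
  -- The adjoint of `K' = ∂ γ'` is `-γ' ∂`, as `∂` is skew and `γ'` self-adjoint.
  let S : Fn →ₗ[ℝ] Fn :=
    { toFun := fun f => -Fn.gateaux γ (Fn.dx f)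
      map_add' := fun f g => by
        rw [Fn.dx_add, Fn.gateaux, Fn.along_add_direction, neg_add]; rfl
      map_smul' := fun r f => by
        rw [show Fn.dx (r • f) = r • Fn.dx f from Fn.dxLin.map_smul r f, Fn.gateaux,
          Fn.along_real_smul_direction, ← smul_neg]; rfl }
  -- Applying the injective `∂` to the equation of a conserved covariant gives the symmetry equation
  -- for `κ`.
  refine ⟨S, fun f g => ?_, Fn.dx_injective ?_⟩
  · change inner h _ g = inner h f (-Fn.gateaux γ (Fn.dx g))
    rw [inner_eq h f, map_neg, ← inner_eq, ← hγ, Fn.gateaux, Fn.along_dx, inner, integral_dx,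
      smul_neg]
    rfl
  · change _ = Fn.dx (_ + -Fn.gateaux γ (Fn.dx (Fn.dxInv κ)))
    rw [Fn.dx_dxInv, Fn.dx_neg, Fn.explicitDt, Fn.along_dxInv, Fn.dx_dxInv, ← Fn.explicitDt, hκ,
      Fn.lie, Fn.dx_add, Fn.dx_neg, ← gateaux_dx, ← gateaux_dx, Fn.dx_dxInv]
    abel

/-! ### Symmetries, conserved quantities and their pairings -/

namespace Generates

variable {h : ℝ} {L : PDO} {B : ℕ → PDO} {ℓ Γ : Op}

theorem isSymmetry_flowK (hh : h ≠ 0) (H : Generates h L B ℓ Γ) (s l : ℕ) :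
    IsSymmetry (flowK L s) (flowK L l) := by
  rw [IsSymmetry, H.flowK_eq, H.flowK_eq, lie_flow hh (H.pow s) (H.pow l),
    (H.pow l).explicitDt_flow hh, ← pow_add, ← pow_add, add_comm, sub_self]
  exact Fn.dx_zero.symm

theorem lie_flowK_flowSigma (hh : h ≠ 0) (H : Generates h L B ℓ Γ) (s r : ℕ) :
    Fn.lie (flowK L s) (flowSigma L B (r + 1)) =
      (s : ℝ) • (h • flowK L (s + r) + flowK L (s + r - 1)) := by
  rw [H.flowK_eq, H.flowK_eq, H.flowK_eq, H.flowSigma_eq,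
    lie_flow hh (H.pow s) (H.orlov_mul_pow r), pow_comm_orlov_mul_pow H.comm, flow,
    covariant_smul, covariant_add, covariant_smul]
  have e : ∀ (r : ℝ) (f : Fn), Fn.dx (r • f) = r • Fn.dx f := Fn.dxLin.map_smul
  rw [e, Fn.dx_add, e]
  rfl

theorem tau_succ (s r : ℕ) : tau h L B s (r + 1) =
    (s : ℝ) • ct • (h • flowK L (s + r) + flowK L (s + r - 1)) + flowSigma L B (r + 1) := rfl

/-- The coefficient of `t` in `τ` is `⟦K_s, σ⟧`, so the explicit time derivative equals the Lie
product with `σ`. The term with `t` itself commutes with `K_s`. -/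
theorem isSymmetry_tau (hh : h ≠ 0) (H : Generates h L B ℓ Γ) (s r : ℕ) :
    IsSymmetry (flowK L s) (tau h L B s (r + 1)) := by
  have e0 : ∀ m, Fn.explicitDt (flowK L m) = 0 := fun m => by
    rw [H.flowK_eq, (H.pow m).explicitDt_flow hh]
  have e1 : ∀ m, Fn.lie (flowK L s) (flowK L m) = 0 := fun m => by
    rw [← H.isSymmetry_flowK hh s m, e0]
  have e2 : Fn.explicitDt (h • flowK L (s + r) + flowK L (s + r - 1)) = 0 := by
    rw [Fn.explicitDt, map_add, map_smul, ← Fn.explicitDt, ← Fn.explicitDt, e0, e0, smul_zero,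
      add_zero]
  have e3 : Fn.explicitDt (flowSigma L B (r + 1)) = 0 := by
    rw [H.flowSigma_eq, (H.orlov_mul_pow r).explicitDt_flow hh]
  rw [IsSymmetry, tau_succ, Fn.lie_add_right, H.lie_flowK_flowSigma hh, Fn.lie_real_smul_right,
    Fn.lie_ct_smul_right, Fn.lie_add_right, Fn.lie_real_smul_right, e1, e1, smul_zero, add_zero,
    smul_zero, smul_zero, zero_add, Fn.explicitDt, map_add, map_smul, ← Fn.explicitDt,
    ← Fn.explicitDt, e3, Fn.explicitDt_ct_smul, e2, smul_zero, add_zero, add_zero]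

theorem isConservedCovariant_dxInv (hh : h ≠ 0) (H : Generates h L B ℓ Γ) (s : ℕ) {κ : Fn}
    (hκ : IsSymmetry (flowK L s) κ) : IsConservedCovariant h (flowK L s) (Fn.dxInv κ) := by
  rw [H.flowK_eq] at hκ ⊢
  exact DDKP.isConservedCovariant_dxInv (inner_gateaux_covariant hh (H.pow s)) hκ

theorem theta_succ (s r : ℕ) : theta h L B s (r + 1) =
    (s : ℝ) • ct • (h • gam L (s + r) + gam L (s + r - 1)) + omg L B (r + 1) := by
  have e : ∀ (r : ℝ) (f : Fn), Fn.dxInv (r • f) = r • Fn.dxInv f := Fn.dxInvLin.map_smul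
  rw [theta, tau_succ, Fn.dxInv_add, e, Fn.dxInv_smul_of_const Fn.coefDx_ct, Fn.dxInv_add, e]
  rfl

theorem isGradient_hamH' (hh : h ≠ 0) (H : Generates h L B ℓ Γ) (m : ℕ) :
    IsGradient h (hamH h L B m) (gam L m) := by
  rw [H.gam_eq]; exact H.isGradient_hamH hh m

theorem isGradient_hamJ' (hh : h ≠ 0) (H : Generates h L B ℓ Γ) (m : ℕ) :
    IsGradient h (hamJ h L B (m + 1)) (omg L B (m + 1)) := by
  rw [H.omg_eq]; exact H.isGradient_hamJ hh m

theorem inner_flowK_gam (hh : h ≠ 0) (H : Generates h L B ℓ Γ) (l r : ℕ) :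
    inner h (flowK L l) (gam L r) = 0 := by
  rw [H.flowK_eq, H.gam_eq, H.inner_K_gam hh]

theorem inner_flowK_omg (hh : h ≠ 0) (H : Generates h L B ℓ Γ) (l r : ℕ) :
    inner h (flowK L l) (omg L B (r + 1)) =
      -((l : ℝ) • (h • hamH h L B (l + r) + hamH h L B (l + r - 1))) := by
  rw [H.flowK_eq, H.omg_eq]
  exact (H.isGradient_K_omg hh l r).unique
    ((((H.isGradient_hamH hh _).smul h).add (H.isGradient_hamH hh _)).smul _).neg

theorem inner_flowSigma_gam (H : Generates h L B ℓ Γ) (l r : ℕ) :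
    inner h (flowSigma L B (r + 1)) (gam L l) = -inner h (flowK L l) (omg L B (r + 1)) := by
  rw [H.flowK_eq, H.omg_eq, H.flowSigma_eq, H.gam_eq, ← inner_covariant_flow, inner_comm]

theorem inner_flowSigma_omg (hh : h ≠ 0) (H : Generates h L B ℓ Γ) (l r : ℕ) :
    inner h (flowSigma L B (l + 1)) (omg L B (r + 1)) =
      -(((l : ℝ) - r) • (h • hamJ h L B (l + r + 1) + hamJ h L B (l + r))) := by
  rw [H.flowSigma_eq, H.omg_eq]
  refine (H.isGradient_sigma_omg hh l r).unique ?_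
  have e := (H.isGradient_hamJ hh (l + r)).smul h
  -- For `l = r = 0` the lower Hamiltonian is `J₀ = 0`, which is not matched with a covariant; the
  -- factor `l - r` removes that term.
  rcases Nat.eq_zero_or_pos (l + r) with h0 | h0
  · obtain ⟨rfl, rfl⟩ : l = 0 ∧ r = 0 := by omega
    rw [sub_self, zero_smul, zero_smul]
    exact (IsGradient.zero h).neg
  · have e2 := H.isGradient_hamJ hh (l + r - 1)
    rw [Nat.sub_add_cancel h0] at e2
    exact ((e.add e2).smul _).neg

theorem conI_succ (s r : ℕ) : conI h L B s (r + 1) =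
    (s : ℝ) • timeMul (h • hamH h L B (s + r) + hamH h L B (s + r - 1)) + hamJ h L B (r + 1) :=
  rfl

theorem explicitDt_gam (hh : h ≠ 0) (H : Generates h L B ℓ Γ) (m : ℕ) :
    Fn.explicitDt (gam L m) = 0 := by
  rw [H.gam_eq, (H.pow m).explicitDt_covariant hh]

theorem isConserved_hamH (hh : h ≠ 0) (H : Generates h L B ℓ Γ) (s l : ℕ) :
    IsConserved (flowK L s) (hamH h L B l) := by
  rw [IsConserved, (H.isGradient_hamH' hh l).explicitDt_eq_zero (H.explicitDt_gam hh l),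
    Functional.gateaux, H.isGradient_hamH' hh, inner_comm, H.inner_flowK_gam hh, add_zero]

/-- The explicit derivative gives `s (h H + H)`, and `(K_s, ω)` from the derivative of `J` along the
flow gives its negative. The term with `t` is conserved by itself. -/
theorem isConserved_conI (hh : h ≠ 0) (H : Generates h L B ℓ Γ) (s r : ℕ) :
    IsConserved (flowK L s) (conI h L B s (r + 1)) := by
  have e1 : Functional.explicitDt (hamJ h L B (r + 1)) = 0 :=
    (H.isGradient_hamJ' hh r).explicitDt_eq_zero (by
      rw [H.omg_eq, (H.orlov_mul_pow r).explicitDt_covariant hh])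
  have e2 := ((H.isGradient_hamH' hh (s + r)).smul h).add (H.isGradient_hamH' hh (s + r - 1))
  have e3 := e2.explicitDt_eq_zero (by
    rw [Fn.explicitDt, map_add, map_smul, ← Fn.explicitDt, ← Fn.explicitDt, H.explicitDt_gam hh,
      H.explicitDt_gam hh, smul_zero, add_zero])
  have e4 : Functional.along 0 (flowK L s) (h • hamH h L B (s + r) + hamH h L B (s + r - 1)) = 0 := by
    rw [e2, inner_comm, inner_add_right, inner_smul_right, H.inner_flowK_gam hh,
      H.inner_flowK_gam hh, smul_zero, add_zero]
  have e5 : Functional.along 0 (flowK L s) (hamJ h L B (r + 1)) =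
      -((s : ℝ) • (h • hamH h L B (s + r) + hamH h L B (s + r - 1))) := by
    rw [H.isGradient_hamJ' hh, inner_comm, H.inner_flowK_omg hh]
  rw [IsConserved, conI_succ]
  generalize h • hamH h L B (s + r) + hamH h L B (s + r - 1) = I at *
  rw [Functional.explicitDt, Functional.gateaux, map_add, map_add, map_smul, map_smul,
    along_timeMul, along_timeMul, ← Functional.explicitDt, ← Functional.explicitDt, e1, e3, e4, e5]
  simp

theorem inner_flowK_theta (hh : h ≠ 0) (H : Generates h L B ℓ Γ) (s l r : ℕ) :
    inner h (flowK L l) (theta h L B s (r + 1)) = inner h (flowK L l) (omg L B (r + 1)) := by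
  rw [theta_succ, inner_add_right, inner_smul_right, inner_ct_smul_right, inner_add_right,
    inner_smul_right, H.inner_flowK_gam hh, H.inner_flowK_gam hh]
  simp

theorem inner_tau_gam (hh : h ≠ 0) (H : Generates h L B ℓ Γ) (s l r : ℕ) :
    inner h (tau h L B s (r + 1)) (gam L l) = -inner h (flowK L l) (omg L B (r + 1)) := by
  rw [tau_succ, inner_add_left, inner_smul_left, inner_ct_smul_left, inner_add_left,
    inner_smul_left, H.inner_flowK_gam hh, H.inner_flowK_gam hh, H.inner_flowSigma_gam]
  simp

/-- The `t²` terms vanish because `(K, γ) = 0`. In the terms linear in `t` the pairings `(K, ω)` and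
`(σ, γ)` have opposite signs, so the factors `s + l` and `s + r`, and likewise `s + l - 1` and `s +
r - 1`, leave only `l - r`. -/
theorem inner_tau_theta (hh : h ≠ 0) (H : Generates h L B ℓ Γ) {s : ℕ} (hs : 1 ≤ s) (l r : ℕ) :
    inner h (tau h L B s (l + 1)) (theta h L B s (r + 1)) =
      -(((l : ℝ) - r) • (h • conI h L B s (l + r + 1) + conI h L B s (l + r))) := by
  -- With `s ≥ 1` the indices `s + l - 1` and `s + r - 1` are not truncated.
  obtain ⟨s, rfl⟩ := Nat.exists_eq_add_of_le' hs
  have e : inner h (tau h L B (s + 1) (l + 1)) (theta h L B (s + 1) (r + 1)) =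
      -(((l : ℝ) - r) • (((s + 1 : ℕ) : ℝ) • timeMul
        (h • (h • hamH h L B (s + 1 + (l + r)) + hamH h L B (s + (l + r))) +
          (h • hamH h L B (s + (l + r)) + hamH h L B (s + (l + r) - 1))) +
        (h • hamJ h L B (l + r + 1) + hamJ h L B (l + r)))) := by
    rw [tau_succ, theta_succ]
    simp only [inner_add_left, inner_add_right, inner_smul_left, inner_smul_right,
      inner_ct_smul_left, inner_ct_smul_right, H.inner_flowK_gam hh, H.inner_flowSigma_gam,
      H.inner_flowK_omg hh, H.inner_flowSigma_omg hh]
    rw [show s + 1 + l - 1 = s + l by omega, show s + 1 + r - 1 = s + r by omega,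
      show s + 1 + l + r = s + 1 + (l + r) by omega, show s + 1 + r + l = s + 1 + (l + r) by omega,
      show s + l + r = s + (l + r) by omega, show s + r + l = s + (l + r) by omega,
      show s + 1 + (l + r) - 1 = s + (l + r) by omega]
    simp only [map_add, map_neg, map_smul, map_zero]
    push_cast
    module
  rw [e, conI_succ]
  rcases Nat.eq_zero_or_pos (l + r) with h0 | h0
  · obtain ⟨rfl, rfl⟩ : l = 0 ∧ r = 0 := by omega
    simp
  · obtain ⟨q, hq⟩ := Nat.exists_eq_add_of_le' h0
    rw [hq, conI_succ, show s + 1 + (q + 1) - 1 = s + (q + 1) by omega,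
      show s + 1 + q = s + (q + 1) by omega]
    simp only [map_add, map_smul]
    module

end Generates

end
end DDKP

namespace DDKP
noncomputable section

open Op OpCoef

/-! ## Expansions in powers of `Δ` and of `E` -/

/-- The coefficient of `E ^ j` in `Δ ^ k`. -/
def deltaCoeff (k j : ℤ) : ℤ :=
  if j ≤ k then (-1) ^ (k - j).toNat * Ring.choose k (k - j).toNat else 0

/-- The coefficient of `Δ ^ j` in `E ^ k`. -/
def shiftCoeff (k j : ℤ) : ℤ := if j ≤ k then Ring.choose k (k - j).toNat else 0

theorem deltaCoeff_sub (k : ℤ) (n : ℕ) : deltaCoeff k (k - n) = (-1) ^ n * Ring.choose k n := by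
  rw [deltaCoeff, if_pos (by omega), sub_sub_cancel, Int.toNat_natCast]

theorem deltaCoeff_eq_zero {k j : ℤ} (h : k < j) : deltaCoeff k j = 0 := if_neg (not_le.2 h)

theorem shiftCoeff_sub (k : ℤ) (n : ℕ) : shiftCoeff k (k - n) = Ring.choose k n := by
  rw [shiftCoeff, if_pos (by omega), sub_sub_cancel, Int.toNat_natCast]

theorem shiftCoeff_eq_zero {k j : ℤ} (h : k < j) : shiftCoeff k j = 0 := if_neg (not_le.2 h)

theorem deltaCoeff_self (k : ℤ) : deltaCoeff k k = 1 := by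
  have := deltaCoeff_sub k 0
  simpa using this

theorem deltaCoeff_eq_zero_of_nonneg {k j : ℤ} (hk : 0 ≤ k) (hj : j < 0) : deltaCoeff k j = 0 := by
  obtain ⟨n, rfl⟩ := Int.eq_ofNat_of_zero_le hk
  rw [deltaCoeff, if_pos (by omega), Ring.choose_natCast, Nat.choose_eq_zero_of_lt (by omega),
    Nat.cast_zero, mul_zero]

theorem deltaCoeff_zero_left (j : ℤ) : deltaCoeff 0 j = if j = 0 then 1 else 0 := by
  by_cases h : j ≤ 0
  · obtain ⟨n, hn⟩ := Int.eq_ofNat_of_zero_le (neg_nonneg.2 h)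
    obtain rfl : j = 0 - n := by omega
    rw [deltaCoeff_sub, Ring.choose_zero_ite]
    rcases n with _ | n
    · simp
    · rw [if_neg (by omega), mul_zero, if_neg (by omega)]
  · rw [deltaCoeff_eq_zero (by omega), if_neg (by omega)]

/-- Pascal's rule, from `Δ ^ (k + 1) = Δ ^ k (E - 1)`, valid for negative `k` too. -/
theorem deltaCoeff_succ (k j : ℤ) :
    deltaCoeff (k + 1) j = deltaCoeff k (j - 1) - deltaCoeff k j := by
  rcases lt_trichotomy j (k + 1) with h | rfl | h
  · obtain ⟨n, rfl⟩ : ∃ n : ℕ, j = k - n := ⟨(k - j).toNat, by omega⟩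
    rw [show k - (n : ℤ) = k + 1 - ((n + 1 : ℕ) : ℤ) by push_cast; ring, deltaCoeff_sub,
      show k + 1 - ((n + 1 : ℕ) : ℤ) - 1 = k - ((n + 1 : ℕ) : ℤ) by push_cast; ring,
      show k + 1 - ((n + 1 : ℕ) : ℤ) = k - (n : ℤ) by push_cast; ring, deltaCoeff_sub,
      deltaCoeff_sub, Ring.choose_succ_succ]
    ring
  · rw [deltaCoeff_self, add_sub_cancel_right, deltaCoeff_self, deltaCoeff_eq_zero (by omega),
      sub_zero]
  · rw [deltaCoeff_eq_zero h, deltaCoeff_eq_zero (by omega), deltaCoeff_eq_zero (by omega),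
      sub_self]

theorem choose_mul_choose_sub (k : ℤ) {i d : ℕ} (h : i ≤ d) :
    Ring.choose k i * Ring.choose (k - i) (d - i) = d.choose i * Ring.choose k d := by
  rw [← Ring.choose_smul_choose k h, nsmul_eq_mul]

theorem sum_Icc_eq_sum_range {M : Type*} [AddCommMonoid M] {m k : ℤ} {d : ℕ} (hd : k - m = d)
    (f : ℤ → M) : ∑ j ∈ Finset.Icc m k, f j = ∑ i ∈ Finset.range (d + 1), f (k - i) := by
  refine (Finset.sum_bij (fun (i : ℕ) _ => k - (i : ℤ)) (fun i hi => ?_) (fun i _ i' _ e => ?_)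
    (fun j hj => ?_) fun i _ => rfl).symm
  · rw [Finset.mem_range] at hi
    rw [Finset.mem_Icc]; omega
  · omega
  · rw [Finset.mem_Icc] at hj
    exact ⟨(k - j).toNat, by rw [Finset.mem_range]; omega, by omega⟩

/-- The products of binomials combine into one factor times an alternating sum of a full row of
binomials, which is zero unless the row is `d = 0`. Hence the expansions of `Δ ^ k` in `E` and of `E
^ k` in `Δ` are inverse to each other. -/
theorem sum_deltaCoeff_mul_shiftCoeff {m k : ℤ} (h : m ≤ k) :
    ∑ j ∈ Finset.Icc m k, shiftCoeff j m * deltaCoeff k j = if k = m then 1 else 0 := by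
  obtain ⟨d, hd⟩ := Int.eq_ofNat_of_zero_le (sub_nonneg.2 h)
  rw [sum_Icc_eq_sum_range hd]
  have e : ∀ i ∈ Finset.range (d + 1), shiftCoeff (k - i) m * deltaCoeff k (k - i) =
      (-1) ^ i * d.choose i * Ring.choose k d := by
    intro i hi
    have hi' : i ≤ d := Nat.lt_succ_iff.1 (Finset.mem_range.1 hi)
    rw [show m = k - i - ((d - i : ℕ) : ℤ) by push_cast [hi']; omega, shiftCoeff_sub,
      deltaCoeff_sub, mul_assoc, ← choose_mul_choose_sub k hi']
    ring
  rw [Finset.sum_congr rfl e, ← Finset.sum_mul, Int.alternating_sum_range_choose]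
  by_cases h0 : d = 0
  · subst h0; rw [if_pos rfl, if_pos (by omega)]; simp
  · rw [if_neg h0, if_neg (by omega), zero_mul]

theorem sum_shiftCoeff_mul_deltaCoeff {m k : ℤ} (h : m ≤ k) :
    ∑ j ∈ Finset.Icc m k, deltaCoeff j m * shiftCoeff k j = if k = m then 1 else 0 := by
  obtain ⟨d, hd⟩ := Int.eq_ofNat_of_zero_le (sub_nonneg.2 h)
  rw [sum_Icc_eq_sum_range hd]
  have e : ∀ i ∈ Finset.range (d + 1), deltaCoeff (k - i) m * shiftCoeff k (k - i) =
      (-1) ^ d * ((-1) ^ i * d.choose i * Ring.choose k d) := by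
    intro i hi
    have hi' : i ≤ d := Nat.lt_succ_iff.1 (Finset.mem_range.1 hi)
    rw [show m = k - i - ((d - i : ℕ) : ℤ) by push_cast [hi']; omega, shiftCoeff_sub,
      deltaCoeff_sub, mul_assoc ((-1) ^ i), ← choose_mul_choose_sub k hi']
    obtain ⟨n, rfl⟩ := Nat.exists_eq_add_of_le hi'
    rw [Nat.add_sub_cancel_left, pow_add]
    have : ((-1 : ℤ) ^ i) * (-1) ^ i = 1 := by rw [← mul_pow]; simp
    linear_combination (-(-1) ^ n * Ring.choose k i * Ring.choose (k - i) n) * this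
  rw [Finset.sum_congr rfl e, ← Finset.mul_sum, ← Finset.sum_mul,
    Int.alternating_sum_range_choose]
  by_cases h0 : d = 0
  · subst h0; rw [if_pos rfl, if_pos (by omega)]; simp
  · rw [if_neg h0, if_neg (by omega), zero_mul, mul_zero]

/-- `Δ ^ (a + b) = Δ ^ a Δ ^ b`. -/
theorem deltaCoeff_add (a b j : ℤ) {m N : ℤ} (hm : m ≤ j - b) (hN : a ≤ N) :
    deltaCoeff (a + b) j = ∑ p ∈ Finset.Icc m N, deltaCoeff a p * deltaCoeff b (j - p) := by
  have zero : ∀ p, p ∉ Finset.Icc (j - b) a → deltaCoeff a p * deltaCoeff b (j - p) = 0 := by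
    intro p hp
    rw [Finset.mem_Icc, not_and_or, not_le, not_le] at hp
    rcases hp with hp | hp
    · rw [deltaCoeff_eq_zero (by omega : b < j - p), mul_zero]
    · rw [deltaCoeff_eq_zero hp, zero_mul]
  have e : ∑ p ∈ Finset.Icc m N, deltaCoeff a p * deltaCoeff b (j - p) =
      ∑ p ∈ Finset.Icc (j - b) a, deltaCoeff a p * deltaCoeff b (j - p) :=
    (Finset.sum_subset (Finset.Icc_subset_Icc hm hN) fun p _ hp => zero p hp).symm
  rw [e]
  by_cases h : j ≤ a + b
  · obtain ⟨n, hn⟩ := Int.eq_ofNat_of_zero_le (sub_nonneg.2 h)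
    obtain rfl : j = a + b - n := by omega
    -- For `j = a + b - n` this is Vandermonde's identity with integer upper entries; the signs
    -- multiply correctly.
    rw [sum_Icc_eq_sum_range (show a - (a + b - n - b) = n by ring), deltaCoeff_sub,
      Ring.add_choose_eq n (Commute.all a b), Finset.Nat.sum_antidiagonal_eq_sum_range_succ_mk,
      Finset.mul_sum]
    refine Finset.sum_congr rfl fun i hi => ?_
    have hi' : i ≤ n := Nat.lt_succ_iff.1 (Finset.mem_range.1 hi)
    rw [deltaCoeff_sub, show a + b - n - (a - i) = b - ((n - i : ℕ) : ℤ) by push_cast [hi']; ring,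
      deltaCoeff_sub]
    obtain ⟨d, rfl⟩ := Nat.exists_eq_add_of_le hi'
    rw [Nat.add_sub_cancel_left, pow_add]
    ring
  · rw [deltaCoeff_eq_zero (by omega), Finset.Icc_eq_empty (by omega), Finset.sum_empty]

/-- `Δ` on coefficients. -/
def deltaEnd : Module.End ℤ OpCoef :=
  (sh 1).toAddMonoidHom.toIntLinearMap - 1

theorem delta_iterate (i : ℕ) (b : OpCoef) : delta^[i] b = (deltaEnd ^ i) b := by
  rw [Module.End.pow_apply]; rfl

/-- This compares the coefficients of `E ^ p` in the composition rule for `Δ ^ s b`. With `p = s -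
d` the product of binomials is `C(d, i) C(s, d)`, and the sum becomes the expansion of `(Δ - E) ^ d
= (-1) ^ d` on coefficients. -/
theorem sum_choose_deltaCoeff (s p : ℤ) (b : OpCoef) {T : ℕ} (hT : s - p < T) :
    ∑ i ∈ Finset.range T, (Ring.choose s i * deltaCoeff (s - i) p) •
      delta^[i] (shift (s - i) b) = deltaCoeff s p • sh p b := by
  by_cases h : p ≤ s
  · obtain ⟨d, hd⟩ := Int.eq_ofNat_of_zero_le (sub_nonneg.2 h)
    obtain rfl : p = s - d := by omega
    have hs : Finset.range (d + 1) ⊆ Finset.range T := Finset.range_subset_range.2 (by omega)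
    rw [← Finset.sum_subset hs fun i _ hi => by
      rw [Finset.mem_range] at hi
      rw [deltaCoeff_eq_zero (by omega), mul_zero, zero_smul]]
    let ε : Module.End ℤ OpCoef := (sh 1).toAddMonoidHom.toIntLinearMap
    have hε : ∀ (n : ℕ) c, (ε ^ n) c = sh n c := by
      intro n
      induction n with
      | zero => intro c; simp
      | succ n ih =>
        intro c
        rw [pow_succ', Module.End.mul_apply, ih]
        change sh 1 (sh n c) = _
        rw [sh_sh, add_comm]; rfl
    have comm : Commute deltaEnd (-ε) := by
      have : deltaEnd = ε - 1 := rfl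
      rw [this]
      exact ((Commute.refl ε).sub_left (Commute.one_left ε)).neg_right
    have key := comm.add_pow d
    rw [show deltaEnd + -ε = -1 by change ε - 1 + -ε = -1; abel] at key
    have key2 := congrArg (fun f : Module.End ℤ OpCoef => f (sh (s - d) b)) key
    simp only [LinearMap.sum_apply] at key2
    have hneg : ∀ n : ℕ, ((-1 : Module.End ℤ OpCoef) ^ n) = ((-1 : ℤ) ^ n) • 1 := by
      intro n
      rcases Nat.even_or_odd n with hn | hn
      · rw [hn.neg_one_pow, hn.neg_one_pow, one_smul]
      · rw [hn.neg_one_pow, hn.neg_one_pow, neg_smul, one_smul]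
    rw [hneg] at key2
    rw [deltaCoeff_sub, mul_comm, mul_smul]
    have e0 : ((-1 : ℤ) ^ d) • sh (s - d) b =
        (((-1 : ℤ) ^ d) • (1 : Module.End ℤ OpCoef)) (sh (s - d) b) := rfl
    rw [e0, key2, Finset.smul_sum]
    refine Finset.sum_congr rfl fun i hi => ?_
    have hi' : i ≤ d := Nat.lt_succ_iff.1 (Finset.mem_range.1 hi)
    rw [show s - (d : ℤ) = s - i - ((d - i : ℕ) : ℤ) by push_cast [hi']; ring, deltaCoeff_sub,
      mul_left_comm, choose_mul_choose_sub s hi', delta_iterate, shift_eq, neg_pow ε, hneg,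
      Module.End.mul_apply, Module.End.mul_apply, Module.End.mul_apply, Module.End.natCast_apply,
      LinearMap.smul_apply, Module.End.one_apply, map_nsmul, map_zsmul, hε,
      map_nsmul, sh_sh]
    rw [← natCast_zsmul, smul_smul, smul_smul, add_sub_cancel]
    congr 1
    ring
  · rw [deltaCoeff_eq_zero (by omega), zero_smul]
    refine Finset.sum_eq_zero fun i _ => ?_
    rw [deltaCoeff_eq_zero (by omega), mul_zero, zero_smul]

end
end DDKP

namespace DDKP
noncomputable section

open Op OpCoef

namespace Op

/-- The operator `∑ₖ A k Δ ^ k` expanded in powers of `E`. -/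
def ofDelta (A : Op) : Op := ⟨fun j => ∑ᶠ k, deltaCoeff k j • A k, by
  obtain ⟨N, hN⟩ := A.exists_bound
  refine ⟨N, fun j hj => finsum_eq_zero_of_forall_eq_zero fun k => ?_⟩
  rcases lt_or_ge k j with h | h
  · rw [deltaCoeff_eq_zero h, zero_smul]
  · rw [hN k (by omega), smul_zero]⟩

theorem ofDelta_apply_eq_sum {A : Op} {N : ℤ} (hN : ∀ k, N < k → A k = 0) {m j : ℤ}
    (hm : m ≤ j) : ofDelta A j = ∑ k ∈ Finset.Icc m N, deltaCoeff k j • A k := by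
  refine finsum_eq_sum_of_support_subset _ fun k hk => ?_
  rw [Finset.coe_Icc]
  by_contra h
  rw [Set.mem_Icc, not_and_or, not_le, not_le] at h
  rcases h with h | h
  · exact hk (by simp only [deltaCoeff_eq_zero (lt_of_lt_of_le h hm), zero_smul])
  · exact hk (by simp only [hN k h, smul_zero])

/-- The operator `∑ₖ A k E ^ k` expanded in powers of `Δ`. -/
def toDelta (A : Op) : Op := ⟨fun j => ∑ᶠ k, shiftCoeff k j • A k, by
  obtain ⟨N, hN⟩ := A.exists_bound
  refine ⟨N, fun j hj => finsum_eq_zero_of_forall_eq_zero fun k => ?_⟩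
  rcases lt_or_ge k j with h | h
  · rw [shiftCoeff_eq_zero h, zero_smul]
  · rw [hN k (by omega), smul_zero]⟩

theorem toDelta_apply_eq_sum {A : Op} {N : ℤ} (hN : ∀ k, N < k → A k = 0) {m j : ℤ}
    (hm : m ≤ j) : toDelta A j = ∑ k ∈ Finset.Icc m N, shiftCoeff k j • A k := by
  refine finsum_eq_sum_of_support_subset _ fun k hk => ?_
  rw [Finset.coe_Icc]
  by_contra h
  rw [Set.mem_Icc, not_and_or, not_le, not_le] at h
  rcases h with h | h
  · exact hk (by simp only [shiftCoeff_eq_zero (lt_of_lt_of_le h hm), zero_smul])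
  · exact hk (by simp only [hN k h, smul_zero])

theorem ofDelta_eq_zero_of_lt {A : Op} {N : ℤ} (hN : ∀ k, N < k → A k = 0) {j : ℤ}
    (hj : N < j) : ofDelta A j = 0 := by
  rw [ofDelta_apply_eq_sum hN le_rfl, Finset.Icc_eq_empty (by omega), Finset.sum_empty]

theorem toDelta_eq_zero_of_lt {A : Op} {N : ℤ} (hN : ∀ k, N < k → A k = 0) {j : ℤ}
    (hj : N < j) : toDelta A j = 0 := by
  rw [toDelta_apply_eq_sum hN le_rfl, Finset.Icc_eq_empty (by omega), Finset.sum_empty]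

theorem sum_ite_Icc {m N : ℤ} {A : Op} (hN : ∀ k, N < k → A k = 0) (c : ℤ → ℤ)
    (hc : ∀ k, m ≤ k → c k = if k = m then 1 else 0) :
    ∑ k ∈ Finset.Icc m N, c k • A k = A m := by
  rcases lt_or_ge N m with h | h
  · rw [Finset.Icc_eq_empty (by omega), Finset.sum_empty, hN m h]
  · rw [Finset.sum_eq_single m]
    · rw [hc m le_rfl, if_pos rfl, one_smul]
    · intro k hk hkm
      rw [hc k (Finset.mem_Icc.1 hk).1, if_neg hkm, zero_smul]
    · exact fun h' => absurd (Finset.mem_Icc.2 ⟨le_rfl, h⟩) h'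

theorem toDelta_ofDelta (A : Op) : toDelta (ofDelta A) = A := by
  ext1 m
  obtain ⟨N, hN⟩ := A.exists_bound
  rw [toDelta_apply_eq_sum (fun k hk => ofDelta_eq_zero_of_lt hN hk) (le_refl m)]
  have e : ∀ j ∈ Finset.Icc m N, shiftCoeff j m • ofDelta A j =
      ∑ k ∈ Finset.Icc m N, (shiftCoeff j m * deltaCoeff k j) • A k := by
    intro j hj
    rw [ofDelta_apply_eq_sum hN (Finset.mem_Icc.1 hj).1, Finset.smul_sum]
    exact Finset.sum_congr rfl fun k _ => smul_smul _ _ _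
  rw [Finset.sum_congr rfl e, Finset.sum_comm]
  simp only [← Finset.sum_smul]
  have e2 : ∀ k ∈ Finset.Icc m N, ∑ j ∈ Finset.Icc m N, shiftCoeff j m * deltaCoeff k j =
      if k = m then 1 else 0 := by
    intro k hk
    rw [Finset.mem_Icc] at hk
    rw [← sum_deltaCoeff_mul_shiftCoeff hk.1]
    refine (Finset.sum_subset (Finset.Icc_subset_Icc le_rfl hk.2) fun j hj hj' => ?_).symm
    rw [Finset.mem_Icc] at hj hj'
    rw [deltaCoeff_eq_zero (by omega), mul_zero]
  rw [Finset.sum_congr rfl fun k hk => by rw [e2 k hk]]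
  exact sum_ite_Icc hN _ fun k _ => rfl

theorem ofDelta_toDelta (A : Op) : ofDelta (toDelta A) = A := by
  ext1 m
  obtain ⟨N, hN⟩ := A.exists_bound
  rw [ofDelta_apply_eq_sum (fun k hk => toDelta_eq_zero_of_lt hN hk) (le_refl m)]
  have e : ∀ j ∈ Finset.Icc m N, deltaCoeff j m • toDelta A j =
      ∑ k ∈ Finset.Icc m N, (deltaCoeff j m * shiftCoeff k j) • A k := by
    intro j hj
    rw [toDelta_apply_eq_sum hN (Finset.mem_Icc.1 hj).1, Finset.smul_sum]
    exact Finset.sum_congr rfl fun k _ => smul_smul _ _ _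
  rw [Finset.sum_congr rfl e, Finset.sum_comm]
  simp only [← Finset.sum_smul]
  have e2 : ∀ k ∈ Finset.Icc m N, ∑ j ∈ Finset.Icc m N, deltaCoeff j m * shiftCoeff k j =
      if k = m then 1 else 0 := by
    intro k hk
    rw [Finset.mem_Icc] at hk
    rw [← sum_shiftCoeff_mul_deltaCoeff hk.1]
    refine (Finset.sum_subset (Finset.Icc_subset_Icc le_rfl hk.2) fun j hj hj' => ?_).symm
    rw [Finset.mem_Icc] at hj hj'
    rw [shiftCoeff_eq_zero (by omega), mul_zero]
  rw [Finset.sum_congr rfl fun k hk => by rw [e2 k hk]]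
  exact sum_ite_Icc hN _ fun k _ => rfl

theorem ofDelta_sub (A B : Op) : ofDelta (A - B) = ofDelta A - ofDelta B := by
  ext1 j
  obtain ⟨N, hN⟩ := A.exists_bound
  obtain ⟨N', hN'⟩ := B.exists_bound
  have hA : ∀ k, max N N' < k → A k = 0 := fun k hk => hN k ((le_max_left _ _).trans_lt hk)
  have hB : ∀ k, max N N' < k → B k = 0 := fun k hk => hN' k ((le_max_right _ _).trans_lt hk)
  rw [sub_apply, ofDelta_apply_eq_sum hA (le_refl j), ofDelta_apply_eq_sum hB (le_refl j),
    ofDelta_apply_eq_sum (A := A - B) (fun k hk => by rw [sub_apply, hA k hk, hB k hk, sub_zero])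
      (le_refl j), ← Finset.sum_sub_distrib]
  exact Finset.sum_congr rfl fun k _ => by rw [sub_apply, smul_sub]

theorem ofDelta_der (δ : ShiftDerivation) (A : Op) : ofDelta (der δ A) = der δ (ofDelta A) := by
  ext1 j
  obtain ⟨N, hN⟩ := A.exists_bound
  rw [der_apply, ofDelta_apply_eq_sum hN (le_refl j), ofDelta_apply_eq_sum (A := der δ A)
    (fun k hk => by rw [der_apply, hN k hk, map_zero]) (le_refl j), map_sum]
  exact Finset.sum_congr rfl fun k _ => by rw [map_zsmul, der_apply]

/-- For `k ≥ 0` the expansion of `Δ ^ k` has no negative powers of `E`, and for `k < 0` it has only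
negative ones. -/
theorem ofDelta_posPart (A : Op) : ofDelta (posPart A) = posPart (ofDelta A) := by
  ext1 j
  obtain ⟨N, hN⟩ := A.exists_bound
  rw [posPart_apply, ofDelta_apply_eq_sum (A := posPart A)
    (fun k hk => by rw [posPart_apply, hN k hk, ite_self]) (le_refl j)]
  split_ifs with h
  · rw [ofDelta_apply_eq_sum hN (le_refl j)]
    refine Finset.sum_congr rfl fun k hk => ?_
    rw [posPart_apply, if_pos (h.trans (Finset.mem_Icc.1 hk).1)]
  · refine Finset.sum_eq_zero fun k _ => ?_
    rw [posPart_apply]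
    split_ifs with hk
    · rw [deltaCoeff_eq_zero_of_nonneg hk (not_le.1 h), zero_smul]
    · rw [smul_zero]

theorem ofDelta_mem_vanishing {A : Op} : ofDelta A ∈ vanishing ↔ A ∈ vanishing := by
  have fst_zsmul : ∀ (n : ℤ) (a : OpCoef), a.fst = 0 → (n • a).fst = 0 := fun n a h => by
    rw [Unitization.fst_smul, h, smul_zero]
  have fst_sum : ∀ (s : Finset ℤ) (f : ℤ → OpCoef), (∀ k ∈ s, (f k).fst = 0) →
      (∑ k ∈ s, f k).fst = 0 := fun s f h =>
    (map_sum (Unitization.fstHom Coef Fn : OpCoef →+* Coef) f s).trans (Finset.sum_eq_zero h)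
  obtain ⟨N, hN⟩ := A.exists_bound
  refine ⟨fun h k => ?_, fun h k => ?_⟩
  · rw [← toDelta_ofDelta A, toDelta_apply_eq_sum (fun k hk => ofDelta_eq_zero_of_lt hN hk) le_rfl]
    exact fst_sum _ _ fun j _ => fst_zsmul _ _ (h j)
  · rw [ofDelta_apply_eq_sum hN le_rfl]
    exact fst_sum _ _ fun j _ => fst_zsmul _ _ (h j)

theorem ofDelta_injective : Function.Injective ofDelta :=
  Function.LeftInverse.injective toDelta_ofDelta

theorem ofDelta_mono (m : ℤ) (a : OpCoef) (j : ℤ) :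
    ofDelta (mono m a) j = deltaCoeff m j • a := by
  change ∑ᶠ k, _ = _
  rw [finsum_eq_single _ m, mono_apply, if_pos rfl]
  intro k hk
  rw [mono_apply, if_neg hk, smul_zero]

/-- `Δ`. -/
def deltaOp : Op := mono 1 1 - mono 0 1

theorem deltaOp_pow_apply (m : ℕ) (j : ℤ) : (deltaOp ^ m) j = deltaCoeff m j • 1 := by
  induction m generalizing j with
  | zero =>
    rw [pow_zero, one_def, mono_apply, Nat.cast_zero, deltaCoeff_zero_left]
    split_ifs <;> simp
  | succ m ih =>
    have e : deltaOp ^ (m + 1) = deltaOp ^ m * mono 1 1 - deltaOp ^ m := by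
      rw [pow_succ, show deltaOp = mono 1 1 - 1 from rfl, mul_sub, mul_one]
    rw [e, sub_apply, mul_mono_apply, ih, ih, map_one, mul_one, ← sub_smul, Nat.cast_succ, deltaCoeff_succ]

theorem ofDelta_mono_natCast (m : ℕ) (a : OpCoef) :
    ofDelta (mono m a) = mono 0 a * deltaOp ^ m := by
  ext1 j
  rw [ofDelta_mono, mono_mul_apply, sh_zero, sub_zero, deltaOp_pow_apply, mul_smul_comm, mul_one]

/-- The composition of operators given by their expansions in powers of `Δ`. -/
theorem comp_eq_sum {A B : Op} {N N' : ℤ} (hA : ∀ k, N < k → A k = 0)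
    (hB : ∀ k, N' < k → B k = 0) {j m : ℤ} (hm : j ≤ m) :
    PDO.comp A.toFun B.toFun m = ∑ s ∈ Finset.Icc (j - N') N,
      ∑ i ∈ Finset.range (N + N' - j + 1).toNat, Ring.choose s i •
        (A s * OpCoef.delta^[i] (OpCoef.shift (s - i) (B (m - s + i)))) := by
  have hz : ∀ (i : ℕ) k, OpCoef.delta^[i] (OpCoef.shift k 0) = 0 := fun i k => by
    rw [delta_iterate, shift_eq, map_zero, map_zero]
  rw [← Finset.sum_product']
  refine finsum_eq_sum_of_support_subset _ ?_
  rintro ⟨s, i⟩ h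
  rw [Finset.coe_product, Set.mem_prod, Finset.mem_coe, Finset.mem_coe, Finset.mem_Icc,
    Finset.mem_range]
  have h1 : s ≤ N := by
    by_contra h'
    exact h (by simp only [hA s (by omega), zero_mul, smul_zero])
  have h2 : m - s + i ≤ N' := by
    by_contra h'
    exact h (by simp only [hB (m - s + i) (by omega), hz, mul_zero, smul_zero])
  dsimp only
  omega

theorem comp_eq_zero {A B : Op} {N N' : ℤ} (hA : ∀ k, N < k → A k = 0)
    (hB : ∀ k, N' < k → B k = 0) {m : ℤ} (hm : N + N' < m) :
    PDO.comp A.toFun B.toFun m = 0 := by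
  rw [comp_eq_sum hA hB le_rfl]
  rw [Finset.Icc_eq_empty (by omega), Finset.sum_empty]

/-- The composition as an operation on operators of bounded order. -/
def compDelta (A B : Op) : Op := ⟨PDO.comp A.toFun B.toFun, by
  obtain ⟨N, hN⟩ := A.exists_bound
  obtain ⟨N', hN'⟩ := B.exists_bound
  exact ⟨N + N', fun k hk => comp_eq_zero hN hN' hk⟩⟩

/-- Both sides become finite sums over the same boxes. The composition rule is translated by
`sum_choose_deltaCoeff`, and the remaining power of `Δ` is split by `deltaCoeff_add`. -/
theorem ofDelta_compDelta (A B : Op) : ofDelta (compDelta A B) = ofDelta A * ofDelta B := by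
  obtain ⟨N, hN⟩ := A.exists_bound
  obtain ⟨N', hN'⟩ := B.exists_bound
  have hz : ∀ (i : ℕ) k, OpCoef.delta^[i] (OpCoef.shift k 0) = 0 := fun i k => by
    rw [delta_iterate, shift_eq, map_zero, map_zero]
  ext1 j
  set S := Finset.Icc (j - N') N with hS
  set Q := Finset.Icc (j - N) N' with hQ
  set T := (N + N' - j + 1).toNat with hT
  let X : ℤ → ℕ → ℤ → OpCoef := fun s i q => OpCoef.delta^[i] (OpCoef.shift (s - i) (B q))
  have e1 : ofDelta (compDelta A B) j = ∑ s ∈ S, ∑ i ∈ Finset.range T,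
      ∑ m ∈ Finset.Icc j (N + N'),
        deltaCoeff m j • Ring.choose s i • (A s * X s i (m - s + i)) := by
    rw [ofDelta_apply_eq_sum (A := compDelta A B) (fun k hk => comp_eq_zero hN hN' hk) (le_refl j)]
    have : ∀ m ∈ Finset.Icc j (N + N'), deltaCoeff m j • compDelta A B m =
        ∑ s ∈ S, ∑ i ∈ Finset.range T,
          deltaCoeff m j • Ring.choose s i • (A s * X s i (m - s + i)) := by
      intro m hm
      have h1 : compDelta A B m = _ := comp_eq_sum hN hN' (Finset.mem_Icc.1 hm).1
      simp only [h1, Finset.smul_sum]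
      rfl
    rw [Finset.sum_congr rfl this, Finset.sum_comm]
    exact Finset.sum_congr rfl fun s _ => Finset.sum_comm
  -- Change of variable `q = m - s + i`, the order of the term of `B`; outside the two ranges the
  -- summands are zero.
  have e2 : ∀ s ∈ S, ∀ i ∈ Finset.range T, ∑ m ∈ Finset.Icc j (N + N'),
      deltaCoeff m j • Ring.choose s i • (A s * X s i (m - s + i)) =
      ∑ q ∈ Q, deltaCoeff (q + s - i) j • Ring.choose s i • (A s * X s i q) := by
    intro s hs i _
    rw [hS, Finset.mem_Icc] at hs
    rw [← finsum_eq_sum_of_support_subset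
      (fun m => deltaCoeff m j • Ring.choose s i • (A s * X s i (m - s + i))),
      ← finsum_eq_sum_of_support_subset
      (fun q => deltaCoeff (q + s - i) j • Ring.choose s i • (A s * X s i q)),
      ← finsum_comp_equiv (Equiv.addRight ((s : ℤ) - i))]
    · refine finsum_congr fun q => ?_
      simp only [Equiv.coe_addRight]
      rw [show q + (s - (i : ℤ)) = q + s - i by ring, show q + s - (i : ℤ) - s + i = q by ring]
    · intro q hq
      rw [hQ, Finset.coe_Icc, Set.mem_Icc]
      constructor
      · by_contra h
        exact hq (by simp only [deltaCoeff_eq_zero (by omega : q + s - i < j), zero_smul])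
      · by_contra h
        exact hq (by simp only [X, hN' q (by omega), hz, mul_zero, smul_zero])
    · intro m hm
      rw [Finset.coe_Icc, Set.mem_Icc]
      constructor
      · by_contra h
        exact hm (by simp only [deltaCoeff_eq_zero (by omega : m < j), zero_smul])
      · by_contra h
        exact hm (by simp only [X, hN' (m - s + i) (by omega), hz, mul_zero, smul_zero])
  have e3 : ∀ s ∈ S, ∑ i ∈ Finset.range T,
      ∑ q ∈ Q, deltaCoeff (q + s - i) j • Ring.choose s i • (A s * X s i q) =
      ∑ q ∈ Q, ∑ p ∈ S, (deltaCoeff q (j - p) * deltaCoeff s p) • (A s * sh p (B q)) := by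
    intro s hs
    rw [Finset.sum_comm]
    refine Finset.sum_congr rfl fun q hq => ?_
    rw [hS, Finset.mem_Icc] at hs
    rw [hQ, Finset.mem_Icc] at hq
    -- Splitting `Δ ^ (s - i + q) = Δ ^ (s - i) Δ ^ q` isolates the factor to which the composition
    -- rule applies.
    have e4 : ∀ i ∈ Finset.range T,
        deltaCoeff (q + s - i) j • Ring.choose s i • (A s * X s i q) =
        ∑ p ∈ S, deltaCoeff q (j - p) •
          (A s * ((Ring.choose s i * deltaCoeff (s - i) p) • X s i q)) := by
      intro i _
      rw [show q + s - (i : ℤ) = s - i + q by ring, deltaCoeff_add (s - i) q j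
        (m := j - N') (N := N) (by omega) (by omega), Finset.sum_smul]
      refine Finset.sum_congr rfl fun p _ => ?_
      rw [mul_smul_comm, smul_smul, smul_smul]
      congr 1
      ring
    rw [Finset.sum_congr rfl e4, Finset.sum_comm]
    refine Finset.sum_congr rfl fun p hp => ?_
    rw [hS, Finset.mem_Icc] at hp
    rw [← Finset.smul_sum, ← Finset.mul_sum, sum_choose_deltaCoeff s p (B q) (by omega),
      mul_smul_comm, smul_smul]
  have e5 : (ofDelta A * ofDelta B) j = ∑ p ∈ S, ofDelta A p * sh p (ofDelta B (j - p)) := by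
    rw [mul_apply]
    refine finsum_eq_sum_of_support_subset _ fun p hp => ?_
    rw [hS, Finset.coe_Icc]
    by_contra h
    exact hp (mul_term_eq_zero (fun k hk => ofDelta_eq_zero_of_lt hN hk)
      (fun k hk => ofDelta_eq_zero_of_lt hN' hk) h)
  rw [e1, Finset.sum_congr rfl fun s hs => Finset.sum_congr rfl (e2 s hs),
    Finset.sum_congr rfl e3, e5]
  have e6 : ∀ p ∈ S, ofDelta A p * sh p (ofDelta B (j - p)) =
      ∑ s ∈ S, ∑ q ∈ Q, (deltaCoeff q (j - p) * deltaCoeff s p) • (A s * sh p (B q)) := by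
    intro p hp
    rw [hS, Finset.mem_Icc] at hp
    rw [ofDelta_apply_eq_sum hN hp.1, ofDelta_apply_eq_sum hN' (show j - N ≤ j - p by omega),
      map_sum, Finset.sum_mul_sum]
    refine Finset.sum_congr rfl fun s _ => Finset.sum_congr rfl fun q _ => ?_
    rw [map_zsmul, smul_mul_assoc, mul_smul_comm, smul_smul, mul_comm]
  rw [Finset.sum_congr rfl e6]
  exact (Finset.sum_congr rfl fun s _ => Finset.sum_comm).trans Finset.sum_comm

end Op

end
end DDKP

namespace DDKP
noncomputable section

open Op OpCoef

/-! ### Operators in powers of `Δ` as elements of the ring of shift operators -/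

namespace PDO

/-- The order of `a` is bounded above. -/
def IsBounded (a : PDO) : Prop := ∃ N : ℤ, ∀ k, N < k → a k = 0

/-- The expansion in powers of `E` of an operator of bounded order. -/
def toOp (a : PDO) (ha : a.IsBounded) : Op := ofDelta ⟨a, ha⟩

/-- The expansion in powers of `Δ`. -/
def ofOp (A : Op) : PDO := (toDelta A).toFun

theorem isBounded_ofOp (A : Op) : (ofOp A).IsBounded := (toDelta A).exists_bound

theorem toOp_ofOp (A : Op) : (ofOp A).toOp (isBounded_ofOp A) = A := ofDelta_toDelta A

variable {a b : PDO}

theorem toOp_injective {ha : a.IsBounded} {hb : b.IsBounded} (h : a.toOp ha = b.toOp hb) :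
    a = b := congrArg Op.toFun (ofDelta_injective h)

theorem IsBounded.comp (ha : a.IsBounded) (hb : b.IsBounded) : (a.comp b).IsBounded :=
  (compDelta ⟨a, ha⟩ ⟨b, hb⟩).exists_bound

theorem toOp_comp (ha : a.IsBounded) (hb : b.IsBounded) :
    (a.comp b).toOp (ha.comp hb) = a.toOp ha * b.toOp hb :=
  ofDelta_compDelta ⟨a, ha⟩ ⟨b, hb⟩

theorem IsBounded.sub (ha : a.IsBounded) (hb : b.IsBounded) : (a - b).IsBounded := by
  obtain ⟨N, hN⟩ := ha
  obtain ⟨N', hN'⟩ := hb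
  refine ⟨max N N', fun k hk => ?_⟩
  change a k - b k = 0
  rw [hN k ((le_max_left _ _).trans_lt hk), hN' k ((le_max_right _ _).trans_lt hk), sub_zero]

theorem toOp_sub (ha : a.IsBounded) (hb : b.IsBounded) :
    (a - b).toOp (ha.sub hb) = a.toOp ha - b.toOp hb := by
  rw [toOp, toOp, toOp, ← ofDelta_sub]
  congr 1
  ext1 k
  rw [sub_apply]; rfl

theorem IsBounded.add (ha : a.IsBounded) (hb : b.IsBounded) : (a + b).IsBounded := by
  obtain ⟨N, hN⟩ := ha
  obtain ⟨N', hN'⟩ := hb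
  refine ⟨max N N', fun k hk => ?_⟩
  change a k + b k = 0
  rw [hN k ((le_max_left _ _).trans_lt hk), hN' k ((le_max_right _ _).trans_lt hk), add_zero]

theorem toOp_add (ha : a.IsBounded) (hb : b.IsBounded) :
    (a + b).toOp (ha.add hb) = a.toOp ha + b.toOp hb := by
  have e := toOp_sub (ha.add hb) hb
  rw [← sub_eq_iff_eq_add, ← e]
  congr 1
  exact add_sub_cancel_right a b

theorem IsBounded.comm (ha : a.IsBounded) (hb : b.IsBounded) : (PDO.comm a b).IsBounded :=
  (ha.comp hb).sub (hb.comp ha)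

theorem toOp_comm (ha : a.IsBounded) (hb : b.IsBounded) : (PDO.comm a b).toOp (ha.comm hb) =
    a.toOp ha * b.toOp hb - b.toOp hb * a.toOp ha := by
  rw [← toOp_comp, ← toOp_comp, ← toOp_sub]; rfl

theorem IsBounded.pos (ha : a.IsBounded) : a.pos.IsBounded :=
  (posPart ⟨a, ha⟩).exists_bound

theorem toOp_pos (ha : a.IsBounded) : a.pos.toOp ha.pos = posPart (a.toOp ha) :=
  ofDelta_posPart ⟨a, ha⟩

theorem IsBounded.dx (ha : a.IsBounded) : a.dx.IsBounded := (der dxDer ⟨a, ha⟩).exists_bound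

theorem toOp_dx (ha : a.IsBounded) : a.dx.toOp ha.dx = der dxDer (a.toOp ha) :=
  ofDelta_der dxDer ⟨a, ha⟩

/-- The operator `c Δ ^ m`. -/
def single (m : ℤ) (c : OpCoef) : PDO := (mono m c).toFun

theorem isBounded_single (m : ℤ) (c : OpCoef) : (single m c).IsBounded := (mono m c).exists_bound

theorem toOp_single (m : ℕ) (c : OpCoef) :
    (single m c).toOp (isBounded_single m c) = mono 0 c * deltaOp ^ m := ofDelta_mono_natCast m c

theorem isBounded_ofCoef (c : OpCoef) : (ofCoef c).IsBounded := isBounded_single 0 c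

theorem toOp_ofCoef (c : OpCoef) : (ofCoef c).toOp (isBounded_ofCoef c) = mono 0 c := by
  have := toOp_single 0 c
  rw [pow_zero, mul_one] at this
  exact this

theorem IsBounded.pow (ha : a.IsBounded) : ∀ m, (a.pow m).IsBounded
  | 0 => isBounded_ofCoef 1
  | m + 1 => (ha.pow m).comp ha

theorem toOp_pow (ha : a.IsBounded) : ∀ m, (a.pow m).toOp (ha.pow m) = a.toOp ha ^ m
  | 0 => toOp_ofCoef 1
  | m + 1 => by rw [pow_succ, ← toOp_pow ha m, ← toOp_comp]; rfl

theorem realSmul_eq (r : ℝ) (k : ℤ) : realSmul r a k = const r * a k :=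
  OpCoef.ext (by simp [realSmul]) (by simp [realSmul])

theorem IsBounded.realSmul (ha : a.IsBounded) (r : ℝ) : (PDO.realSmul r a).IsBounded := by
  obtain ⟨N, hN⟩ := ha
  exact ⟨N, fun k hk => by rw [realSmul_eq, hN k hk, mul_zero]⟩

theorem toOp_realSmul (ha : a.IsBounded) (r : ℝ) :
    (PDO.realSmul r a).toOp (ha.realSmul r) = r • a.toOp ha := by
  ext1 j
  obtain ⟨N, hN⟩ := id ha
  rw [smul_eq, mono_mul_apply, sh_zero, sub_zero, toOp, toOp,
    ofDelta_apply_eq_sum (A := ⟨a, ha⟩) hN (le_refl j),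
    ofDelta_apply_eq_sum (A := ⟨PDO.realSmul r a, ha.realSmul r⟩) (N := N)
      (fun k hk => by change PDO.realSmul r a k = 0; rw [realSmul_eq, hN k hk, mul_zero])
      (le_refl j), Finset.mul_sum]
  refine Finset.sum_congr rfl fun k _ => ?_
  rw [mul_smul_comm]
  exact congrArg _ (realSmul_eq r k)

theorem toOp_eq_zero_of_lt (ha : a.IsBounded) {N : ℤ} (hN : ∀ k, N < k → a k = 0) :
    ∀ k, N < k → a.toOp ha k = 0 := fun _ hk => ofDelta_eq_zero_of_lt (A := ⟨a, ha⟩) hN hk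

theorem eq_zero_of_toOp_eq_zero (ha : a.IsBounded) {N : ℤ} (hN : ∀ k, N < k → a.toOp ha k = 0) :
    ∀ k, N < k → a k = 0 := fun k hk => by
  have e := congrArg (fun A : Op => A k) (toDelta_ofDelta ⟨a, ha⟩)
  exact e.symm.trans (toDelta_eq_zero_of_lt hN hk)

theorem toOp_top (ha : a.IsBounded) {N : ℤ} (hN : ∀ k, N < k → a k = 0) : a.toOp ha N = a N := by
  rw [toOp, ofDelta_apply_eq_sum (A := ⟨a, ha⟩) hN le_rfl, Finset.Icc_self, Finset.sum_singleton,
    deltaCoeff_self, one_smul]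

/-- `Δ = E - 1` brings the leading coefficient into order zero; negative powers of `Δ` do not reach
it. -/
theorem toOp_apply_zero (ha : a.IsBounded) (hN : ∀ k, 1 < k → a k = 0) :
    a.toOp ha 0 = a 0 - a 1 := by
  have e : deltaCoeff 1 0 = -1 := by
    have := deltaCoeff_succ 0 0
    rwa [zero_add, deltaCoeff_zero_left, deltaCoeff_zero_left] at this
  rw [toOp, ofDelta_apply_eq_sum (A := ⟨a, ha⟩) hN le_rfl,
    show Finset.Icc (0 : ℤ) 1 = {0, 1} from rfl, Finset.sum_pair zero_ne_one, deltaCoeff_self,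
    e, one_smul, neg_smul, one_smul, sub_eq_add_neg]

theorem toOp_difference (ha : a.IsBounded) :
    (∀ k < 0, a.toOp ha k = 0) ↔ ∀ k < 0, a k = 0 := by
  refine ⟨fun h k hk => ?_, fun h => ?_⟩
  · have e : a.pos = a := toOp_injective (ha := ha.pos) (hb := ha) (by
      rw [toOp_pos ha, posPart_eq_self h])
    rw [← e]
    exact if_neg (not_le.2 hk)
  · have e : a.pos = a := by
      funext k
      change (if 0 ≤ k then a k else 0) = a k
      split_ifs with hk
      · rfl
      · exact (h k (not_le.1 hk)).symm
    intro k hk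
    have e2 := toOp_pos ha
    simp only [e] at e2
    rw [e2, posPart_apply, if_neg (not_le.2 hk)]

theorem toOp_sub_mem_vanishing (ha : a.IsBounded) (hb : b.IsBounded) :
    a.toOp ha - b.toOp hb ∈ vanishing ↔ ∀ k, (a k).fst = (b k).fst := by
  rw [← toOp_sub, toOp, ofDelta_mem_vanishing, mem_vanishing]
  refine forall_congr' fun k => ?_
  change (a k - b k).fst = 0 ↔ _
  rw [fst_sub, sub_eq_zero]

end PDO

open PDO

theorem mul_apply_add {A B : Op} {N N' : ℤ} (hA : ∀ k, N < k → A k = 0)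
    (hB : ∀ k, N' < k → B k = 0) : (A * B) (N + N') = A N * sh N (B N') := by
  rw [Op.mul_apply, finsum_eq_single _ N, add_sub_cancel_left]
  intro j hj
  rcases lt_or_gt_of_ne hj with h | h
  · rw [hB _ (by omega), map_zero, mul_zero]
  · rw [hA j h, zero_mul]

theorem freeLax_eq_smul (h : ℝ) : freeLax h = h⁻¹ • deltaOp := by
  rw [smul_eq, deltaOp, mul_sub, mono_mul_mono, mono_mul_mono, map_one, mul_one, zero_add,
    add_zero]; rfl

theorem toOp_single_one (h : ℝ) :
    (single 1 (const h⁻¹)).toOp (isBounded_single 1 _) = freeLax h := by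
  have := toOp_single 1 (const h⁻¹)
  rw [pow_one, ← smul_eq, ← freeLax_eq_smul] at this
  exact this

theorem freeLax_apply_one (h : ℝ) : freeLax h 1 = const h⁻¹ := by
  rw [freeLax, sub_apply, mono_apply, mono_apply, if_pos rfl, if_neg one_ne_zero, sub_zero]

theorem freeLax_apply_zero (h : ℝ) : freeLax h 0 = -const h⁻¹ := by
  rw [freeLax, sub_apply, mono_apply, mono_apply, if_pos rfl, if_neg zero_ne_one, zero_sub]

/-! ### The Lax operator in powers of `Δ` and of `E` -/

section Lax

variable {h : ℝ} {L : PDO}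

theorem IsBounded.opA (hb : L.IsBounded) (m : ℕ) : (DDKP.opA L m).IsBounded := (hb.pow m).pos

theorem toOp_opA (hb : L.IsBounded) (m : ℕ) :
    (opA L m).toOp (IsBounded.opA hb m) = posPart (L.toOp hb ^ m) := by
  rw [← toOp_pow, ← toOp_pos]; rfl

/-- The expansion in powers of `E` of the Lax operator. -/
structure IsLaxOp (h : ℝ) (ℓ : Op) : Prop where
  mem : ℓ - freeLax h ∈ vanishing
  pos : ∀ k, 0 < k → ℓ k = freeLax h k
  zeroth : (ℓ 0).snd = Fn.u
  mder_eq : mder h ℓ = 0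

theorem posPart_eq_lam {ℓ : Op} (hmem : ℓ - freeLax h ∈ vanishing)
    (hpos : ∀ k, 0 < k → ℓ k = freeLax h k) (hz : (ℓ 0).snd = Fn.u) : posPart ℓ = lam h := by
  ext1 k
  rw [posPart_apply, lam, add_apply, mono_apply]
  rcases lt_trichotomy k 0 with hk | rfl | hk
  · rw [if_neg (by omega), freeLax_apply_eq_zero h (Or.inl hk), if_neg hk.ne, add_zero]
  · rw [if_pos le_rfl, if_pos rfl]
    have e := hmem 0
    rw [sub_apply, fst_sub, sub_eq_zero] at e
    exact OpCoef.ext (by rw [e]; simp) (by rw [hz, freeLax_apply_zero]; simp)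
  · rw [if_pos hk.le, if_neg hk.ne', add_zero, hpos k hk]

theorem toOp_fst_iff (hb : L.IsBounded) : L.toOp hb - freeLax h ∈ vanishing ↔
    ∀ k, (L k).fst = if k = 1 then MvPolynomial.C h⁻¹ else 0 := by
  rw [← toOp_single_one, toOp_sub_mem_vanishing]
  refine forall_congr' fun k => ?_
  change _ = (if k = 1 then const h⁻¹ else 0 : OpCoef).fst ↔ _
  split_ifs <;> rfl

theorem toOp_opA_one (hb : L.IsBounded) (hmem : L.toOp hb - freeLax h ∈ vanishing)
    (hpos : ∀ k, 0 < k → L.toOp hb k = freeLax h k) (hz : (L.toOp hb 0).snd = Fn.u) :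
    (opA L 1).toOp (IsBounded.opA hb 1) = lam h := by
  rw [toOp_opA hb, pow_one, posPart_eq_lam hmem hpos hz]

theorem IsLax.isBounded (H : IsLax h L) : L.IsBounded := ⟨1, H.order⟩

theorem IsLax.isLaxOp (H : IsLax h L) : IsLaxOp h (L.toOp H.isBounded) := by
  have hmem : L.toOp H.isBounded - freeLax h ∈ vanishing := by
    rw [toOp_fst_iff]
    intro k
    rcases lt_trichotomy k 1 with hk | rfl | hk
    · rw [if_neg hk.ne]
      rcases (Int.lt_add_one_iff.1 (by simpa using hk) : k ≤ 0).lt_or_eq with hk | rfl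
      · exact H.lower k hk
      · rw [H.zeroth]; rfl
    · rw [if_pos rfl, H.lead]; rfl
    · rw [if_neg hk.ne', H.order k hk]; rfl
  have hpos : ∀ k, 0 < k → L.toOp H.isBounded k = freeLax h k := by
    intro k hk
    rcases (show 1 ≤ k from hk).eq_or_lt with rfl | hk
    · rw [toOp_top _ H.order, H.lead, freeLax_apply_one]; rfl
    · rw [toOp_eq_zero_of_lt _ H.order k hk, freeLax_apply_eq_zero h (Or.inr hk)]
  have hz : (L.toOp H.isBounded 0).snd = Fn.u := by
    rw [toOp_apply_zero _ H.order, H.zeroth, H.lead]; simp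
  have hA := toOp_opA_one H.isBounded hmem hpos hz
  refine ⟨hmem, hpos, hz, ?_⟩
  have e3 : L.dx.toOp H.isBounded.dx = (PDO.comm (opA L 1) L).toOp
      ((IsBounded.opA H.isBounded 1).comm H.isBounded) := by
    congr 1; exact H.lax
  rw [toOp_dx H.isBounded, toOp_comm (IsBounded.opA H.isBounded 1) H.isBounded, hA] at e3
  rw [mder_def, e3, sub_self]

theorem IsLaxOp.isLax {ℓ : Op} (H : IsLaxOp h ℓ) : IsLax h (ofOp ℓ) := by
  have hb := isBounded_ofOp ℓ
  have e : (ofOp ℓ).toOp hb = ℓ := toOp_ofOp ℓ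
  have order : ∀ k, 1 < k → ofOp ℓ k = 0 := eq_zero_of_toOp_eq_zero hb fun k hk => by
    rw [e, H.pos k (by omega), freeLax_apply_eq_zero h (Or.inr hk)]
  have lead : ofOp ℓ 1 = const h⁻¹ := by
    rw [← toOp_top hb order, e, H.pos 1 one_pos, freeLax_apply_one]
  have hfst := (toOp_fst_iff hb).1 (by rw [e]; exact H.mem)
  refine ⟨order, lead, ?_, fun k hk => ?_, ?_⟩
  · refine OpCoef.ext ((hfst 0).trans (by simp)) ?_
    have e2 := toOp_apply_zero hb order
    rw [e, lead] at e2
    rw [Unitization.snd_inr, ← H.zeroth, e2, snd_sub, const_snd, sub_zero]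
  · rw [hfst k, if_neg (by omega)]
  · refine toOp_injective (ha := hb.dx) (hb := (IsBounded.opA hb 1).comm hb) ?_
    have hA := toOp_opA_one (h := h) hb (by rw [e]; exact H.mem) (by rw [e]; exact H.pos)
      (by rw [e]; exact H.zeroth)
    rw [toOp_dx hb, toOp_comm (IsBounded.opA hb 1) hb, hA, e, ← sub_eq_zero]
    exact H.mder_eq

theorem exists_isLaxOp (hh : h ≠ 0) : ∃ ℓ, IsLaxOp h ℓ := by
  obtain ⟨ℓ, h1, h2, h3⟩ := exists_lax hh
  exact ⟨ℓ, h1, h2, lax_zeroth hh h1 h2 h3, h3⟩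

theorem IsLaxOp.unique (hh : h ≠ 0) {ℓ ℓ' : Op} (H : IsLaxOp h ℓ) (H' : IsLaxOp h ℓ') :
    ℓ = ℓ' := by
  have e := eq_of_mder_eq hh H.mem H'.mem (by rw [map_sub, map_sub, H.mder_eq, H'.mder_eq])
  exact sub_left_injective e

theorem existsUnique_isLax (hh : h ≠ 0) : ∃! L, IsLax h L := by
  obtain ⟨ℓ, hℓ⟩ := exists_isLaxOp hh
  exact ⟨ofOp ℓ, hℓ.isLax, fun L' H' => toOp_injective (hb := isBounded_ofOp ℓ)
    ((H'.isLaxOp.unique hh hℓ).trans (toOp_ofOp ℓ).symm)⟩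

end Lax

/-! ### The operators of the non-isospectral Lax triads -/

section Nonisospectral

variable {h : ℝ} {ℓ Γ : Op}

/-- `B_m|_{u = 0}`. -/
def freeB (h : ℝ) (m : ℕ) : PDO :=
  single (m + 1 : ℕ) (Unitization.inl (MvPolynomial.C ((h⁻¹) ^ m) * cx)) +
    single m (Unitization.inl (MvPolynomial.C ((h⁻¹) ^ m) * (cx + MvPolynomial.C h * cn)))

theorem isBounded_freeB (h : ℝ) (m : ℕ) : (freeB h m).IsBounded :=
  (isBounded_single _ _).add (isBounded_single _ _)

theorem freeB_fst (h : ℝ) (m : ℕ) (k : ℤ) : (freeB h m k).fst =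
    if k = (m + 1 : ℕ) then MvPolynomial.C ((h⁻¹) ^ (m + 1 - 1)) * cx
    else if k = ((m + 1 : ℕ) : ℤ) - 1 then
      MvPolynomial.C ((h⁻¹) ^ (m + 1 - 1)) * (cx + MvPolynomial.C h * cn)
    else 0 := by
  change ((if k = (m + 1 : ℕ) then _ else 0 : OpCoef) + (if k = m then _ else 0 : OpCoef)).fst = _
  rw [add_tsub_cancel_right, Nat.cast_succ, add_sub_cancel_right]
  by_cases h1 : k = m + 1
  · rw [if_pos h1, if_pos h1, if_neg (by omega)]; simp
  · rw [if_neg h1, if_neg h1]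
    split_ifs <;> simp

theorem freeOrlov_eq (h : ℝ) : freeOrlov h = mono 0 (Unitization.inl cx) * deltaOp +
    mono 0 (Unitization.inl (cx + MvPolynomial.C h * cn)) := by
  rw [freeOrlov, deltaOp, mul_sub, mono_mul_mono, mono_mul_mono, map_one, mul_one,
    zero_add, add_zero, Unitization.inl_add, mono_add]
  abel

/-- With `x Δ + x + h n = x E + h n`, the prescribed value of `B_(m+1)` at `u = 0` factors as the
free Orlov-Schulman operator times a power of the free Lax operator. This is why `(Γ L^m)₊` has the
right value at `u = 0`. -/
theorem toOp_freeB (h : ℝ) (m : ℕ) :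
    (freeB h m).toOp (isBounded_freeB h m) = freeOrlov h * freeLax h ^ m := by
  have e : ∀ (r : ℝ) (c : Coef), mono 0 (Unitization.inl (MvPolynomial.C r * c)) =
      r • mono 0 (Unitization.inl c) := fun r c => by
    rw [smul_eq, mono_mul_mono, sh_zero, const, Unitization.inl_mul, add_zero]
  have e2 := toOp_add (isBounded_single ((m + 1 : ℕ) : ℤ)
    (Unitization.inl (MvPolynomial.C ((h⁻¹) ^ m) * cx))) (isBounded_single (m : ℤ)
      (Unitization.inl (MvPolynomial.C ((h⁻¹) ^ m) * (cx + MvPolynomial.C h * cn))))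
  refine e2.trans ?_
  rw [toOp_single, toOp_single, e, e, freeLax_eq_smul, smul_pow, freeOrlov_eq, add_mul,
    mul_smul_comm, mul_assoc, ← pow_succ', mul_smul_comm, smul_mul_assoc, smul_mul_assoc]

/-- The expansion in powers of `E` of the operator `B_m`. -/
structure IsNonisospectralOp (h : ℝ) (ℓ : Op) (m : ℕ) (b : Op) : Prop where
  mem : b - freeOrlov h * freeLax h ^ m ∈ vanishing
  order : ∀ k : ℤ, ((m + 1 : ℕ) : ℤ) < k → b k = 0
  difference : ∀ k < 0, b k = 0
  lax : ∀ k, 0 < k → (b * ℓ - ℓ * b + h • ℓ ^ (m + 1) + ℓ ^ m) k = 0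

/-- An upper bound for the order does not depend on whether one expands in `Δ` or in `E`; in
particular the absence of positive powers is the same condition. -/
theorem isNonisospectral_iff {L B : PDO} (hL : L.IsBounded) (hB : B.IsBounded) (m : ℕ) :
    IsNonisospectral h L (m + 1) B ↔ IsNonisospectralOp h (L.toOp hL) m (B.toOp hB) := by
  have hlax : (∀ k : ℤ, 0 < k →
      (PDO.comm B L + PDO.realSmul h (PDO.pow L (m + 1)) + PDO.pow L (m + 1 - 1)) k = 0) ↔
      ∀ k : ℤ, 0 < k → (B.toOp hB * L.toOp hL - L.toOp hL * B.toOp hB +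
        h • L.toOp hL ^ (m + 1) + L.toOp hL ^ m) k = 0 := by
    have hb := ((hB.comm hL).add ((hL.pow (m + 1)).realSmul h)).add (hL.pow m)
    have e := toOp_add ((hB.comm hL).add ((hL.pow (m + 1)).realSmul h)) (hL.pow m)
    rw [toOp_add (hB.comm hL) ((hL.pow (m + 1)).realSmul h), toOp_comm hB hL,
      toOp_realSmul (hL.pow (m + 1)) h, toOp_pow hL, toOp_pow hL] at e
    rw [← e]
    exact ⟨fun H => toOp_eq_zero_of_lt hb H, fun H => eq_zero_of_toOp_eq_zero hb H⟩
  have hfst : (∀ k, (B k).fst = (freeB h m k).fst) ↔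
      B.toOp hB - freeOrlov h * freeLax h ^ m ∈ vanishing := by
    rw [← toOp_freeB, toOp_sub_mem_vanishing]
  simp only [freeB_fst] at hfst
  exact ⟨fun H => ⟨hfst.1 H.asymptotic, toOp_eq_zero_of_lt hB H.order,
      (toOp_difference hB).2 H.difference, hlax.1 H.lax⟩,
    fun H => ⟨eq_zero_of_toOp_eq_zero hB H.order, (toOp_difference hB).1 H.difference,
      hfst.2 H.mem, hlax.2 H.lax⟩⟩

/-- The expansion in powers of `E` of the Orlov-Schulman operator. -/
structure IsOrlovOp (h : ℝ) (Γ : Op) : Prop where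
  mem : Γ - freeOrlov h ∈ vanishing
  pos : ∀ k, 0 < k → Γ k = freeOrlov h k
  mder_eq : mder h Γ = 0

theorem IsLaxOp.apply_eq_zero (H : IsLaxOp h ℓ) : ∀ k, 1 < k → ℓ k = 0 := fun k hk => by
  rw [H.pos k (by omega), freeLax_apply_eq_zero h (Or.inr hk)]

theorem IsOrlovOp.apply_eq_zero (H : IsOrlovOp h Γ) : ∀ k, 1 < k → Γ k = 0 := fun k hk => by
  rw [H.pos k (by omega), freeOrlov_apply_eq_zero h (Or.inr hk)]

theorem posPart_sub (A B : Op) : posPart (A - B) = posPart A - posPart B := by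
  ext1 k
  rw [sub_apply, posPart_apply, posPart_apply, posPart_apply]
  split_ifs <;> simp

theorem posPart_mem_vanishing {A : Op} (hA : A ∈ vanishing) : posPart A ∈ vanishing := by
  intro k
  rw [posPart_apply]
  split_ifs
  · exact hA k
  · rfl

theorem comm_orlov_mul_pow (hc : ℓ * Γ - Γ * ℓ = h • ℓ + 1) (m : ℕ) :
    Γ * ℓ ^ m * ℓ - ℓ * (Γ * ℓ ^ m) = -(h • ℓ ^ (m + 1) + ℓ ^ m) := by
  have e : Γ * ℓ ^ m * ℓ - ℓ * (Γ * ℓ ^ m) = -((ℓ * Γ - Γ * ℓ) * ℓ ^ m) := by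
    rw [mul_assoc, ← pow_succ, pow_succ']; noncomm_ring
  rw [e, hc, add_mul, one_mul, smul_mul_assoc, ← pow_succ']

theorem comm_eq_of_add_eq {R : Type*} [Ring R] {a b c x y : R} (e : a + b = c)
    (e' : c * x - x * c = -y) : a * x - x * a + y = x * b - b * x := by
  subst e
  rw [← neg_neg y, ← e']
  noncomm_ring

/-- The commutator of `Γ L^m` with `L` cancels `h L^(m+1) + L^m` exactly. Only `[L, (Γ L^m)₋]`
remains, whose order is at most `1 - 1 = 0`. -/
theorem isNonisospectralOp_posPart (H : IsLaxOp h ℓ) (HΓ : IsOrlovOp h Γ)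
    (hc : ℓ * Γ - Γ * ℓ = h • ℓ + 1) (m : ℕ) :
    IsNonisospectralOp h ℓ m (posPart (Γ * ℓ ^ m)) := by
  refine ⟨?_, fun k hk => ?_, fun k hk => ?_, fun k hk => ?_⟩
  · have e : posPart (freeOrlov h * freeLax h ^ m) = freeOrlov h * freeLax h ^ m :=
      posPart_eq_self fun k hk => mul_apply_eq_zero_of_nonneg
        (fun k hk => freeOrlov_apply_eq_zero h (Or.inl hk))
        (pow_apply_eq_zero_of_nonneg (fun k hk => freeLax_apply_eq_zero h (Or.inl hk)) m) hk
    rw [← e, ← posPart_sub]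
    exact posPart_mem_vanishing
      (mul_sub_mul_mem_vanishing HΓ.mem (pow_sub_pow_mem_vanishing H.mem m))
  · rw [posPart_apply, mul_apply_of_lt HΓ.apply_eq_zero (pow_apply_of_lt H.apply_eq_zero m)
      (by push_cast at hk; omega), ite_self]
  · rw [posPart_apply, if_neg (not_le.2 hk)]
  · have e := comm_eq_of_add_eq (posPart_add_negPart (Γ * ℓ ^ m)) (comm_orlov_mul_pow hc m)
    rw [← add_assoc] at e
    have hn : ∀ k, -1 < k → negPart (Γ * ℓ ^ m) k = 0 := fun k hk => by
      rw [negPart_apply, if_pos (by omega)]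
    rw [e, sub_apply, mul_apply_of_lt H.apply_eq_zero hn (by omega),
      mul_apply_of_lt hn H.apply_eq_zero (by omega), sub_zero]

/-- If `D` has order at most `M ≥ 0`, the coefficient of order `M + 1` in `[D, L]` is `-h⁻¹ Δ D_M`.
It must be zero, so the order of `D` drops until no difference operator is left. -/
theorem eq_zero_of_comm_lax (hh : h ≠ 0) (H : IsLaxOp h ℓ) {D : Op} (hD : D ∈ vanishing)
    (hneg : ∀ k < 0, D k = 0) (hc : ∀ k, 0 < k → (D * ℓ - ℓ * D) k = 0) : D = 0 := by
  obtain ⟨N, hN⟩ := D.exists_bound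
  have step : ∀ M, (∀ k, M < k → D k = 0) → ∀ k, M - 1 < k → D k = 0 := by
    intro M hM k hk
    rcases (show M ≤ k by omega).eq_or_lt with rfl | hk
    swap
    · exact hM k hk
    rcases lt_or_ge M 0 with h0 | h0
    · exact hneg M h0
    have e := hc (M + 1) (by omega)
    rw [sub_apply, mul_apply_add hM H.apply_eq_zero, add_comm M 1,
      mul_apply_add H.apply_eq_zero hM, H.pos 1 one_pos, freeLax_apply_one, sh_const,
      mul_comm, ← mul_sub] at e
    have e1 := congrArg (fun a : OpCoef => a.snd) e
    have hf : (D M).fst = 0 := hD M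
    simp only [Unitization.snd_mul, const_fst, const_snd, snd_sub, sh_snd, smul_zero, zero_mul,
      add_zero, Unitization.snd_zero, ← Fn.real_smul_def] at e1
    have e2 := (smul_eq_zero_iff_right (inv_ne_zero hh)).1 e1
    rw [← neg_eq_zero, neg_sub] at e2
    exact OpCoef.ext hf (Fn.eq_zero_of_shift_one_sub e2)
  have all : ∀ n : ℕ, ∀ k, N - n < k → D k = 0 := by
    intro n
    induction n with
    | zero => simpa using hN
    | succ n ih =>
      have := step _ ih
      rwa [show N - (n : ℤ) - 1 = N - ((n + 1 : ℕ) : ℤ) by push_cast; ring] at this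
  ext1 k
  exact all (N - k + 1).toNat k (by omega)

theorem IsNonisospectralOp.unique (hh : h ≠ 0) (H : IsLaxOp h ℓ) {m : ℕ} {b b' : Op}
    (hb : IsNonisospectralOp h ℓ m b) (hb' : IsNonisospectralOp h ℓ m b') : b = b' := by
  refine sub_eq_zero.1 (eq_zero_of_comm_lax hh H ?_ (fun k hk => ?_) fun k hk => ?_)
  · have := sub_mem hb.mem hb'.mem
    rwa [sub_sub_sub_cancel_right] at this
  · rw [sub_apply, hb.difference k hk, hb'.difference k hk, sub_zero]
  · have e : (b - b') * ℓ - ℓ * (b - b') = (b * ℓ - ℓ * b + h • ℓ ^ (m + 1) + ℓ ^ m) -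
        (b' * ℓ - ℓ * b' + h • ℓ ^ (m + 1) + ℓ ^ m) := by noncomm_ring
    rw [e, sub_apply, hb.lax k hk, hb'.lax k hk, sub_zero]

theorem IsNonisospectral.isBounded {L B : PDO} {m : ℕ} (H : IsNonisospectral h L m B) :
    B.IsBounded := ⟨m, H.order⟩

theorem exists_isOrlovOp (hh : h ≠ 0) : ∃ Γ, IsOrlovOp h Γ := by
  obtain ⟨Γ, h1, h2, h3⟩ := exists_orlov hh
  exact ⟨Γ, h1, h2, h3⟩

theorem IsLaxOp.comm_orlov (hh : h ≠ 0) (H : IsLaxOp h ℓ) (HΓ : IsOrlovOp h Γ) :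
    ℓ * Γ - Γ * ℓ = h • ℓ + 1 := by
  rw [lax_comm_orlov hh H.mem H.mder_eq HΓ.mem HΓ.mder_eq, smul_eq]

theorem existsUnique_isNonisospectral (hh : h ≠ 0) {L : PDO} (H : IsLax h L) (m : ℕ) :
    ∃! B, IsNonisospectral h L (m + 1) B := by
  obtain ⟨Γ, HΓ⟩ := exists_isOrlovOp hh
  have hb := isNonisospectralOp_posPart H.isLaxOp HΓ (H.isLaxOp.comm_orlov hh HΓ) m
  rw [← toOp_ofOp (posPart _)] at hb
  refine ⟨_, (isNonisospectral_iff H.isBounded (isBounded_ofOp _) m).2 hb, fun B' HB' => ?_⟩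
  have hb' := (isNonisospectral_iff H.isBounded HB'.isBounded m).1 HB'
  exact toOp_injective (hb'.unique hh H.isLaxOp hb)

/-- Since `(L)₊` is `A₁`, the curvature is `[∂ - A₁, C₊]`, already known to be multiplication by the
flow of `C`. -/
theorem curvature_eq {L A : PDO} {C : Op} (H : IsLax h L) (hA : A.IsBounded)
    (hC : IsAdmissible h C) (e : A.toOp hA = posPart C) :
    curvature L A = PDO.ofCoef (Unitization.inr (flow C)) := by
  have H' := H.isLaxOp
  have hA1 := IsBounded.opA H.isBounded 1
  refine toOp_injective (ha := hA.dx.sub (hA1.comm hA)) (hb := isBounded_ofCoef _) ?_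
  have e1 := toOp_sub hA.dx (hA1.comm hA)
  rw [toOp_dx hA, toOp_comm hA1 hA, toOp_opA_one H.isBounded H'.mem H'.pos H'.zeroth, e] at e1
  rw [toOp_ofCoef, ← hC.mder_posPart]
  exact e1

theorem generates (hh : h ≠ 0) {L : PDO} {B : ℕ → PDO} (H : IsLax h L)
    (HΓ : IsOrlovOp h Γ) (HB : ∀ m, 1 ≤ m → IsNonisospectral h L m (B m)) :
    Generates h L B (L.toOp H.isBounded) Γ ∧ (∀ m, curvature L (opA L m) =
      PDO.ofCoef (Unitization.inr (flow (L.toOp H.isBounded ^ m)))) ∧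
    ∀ m, curvature L (B (m + 1)) =
      PDO.ofCoef (Unitization.inr (flow (Γ * L.toOp H.isBounded ^ m))) := by
  have H' := H.isLaxOp
  have hc := H'.comm_orlov hh HΓ
  have aℓ := IsAdmissible.lax H'.mem H'.mder_eq
  have aΓ := IsAdmissible.orlov HΓ.mem HΓ.mder_eq
  have h1 : ∀ m, curvature L (opA L m) =
      PDO.ofCoef (Unitization.inr (flow (L.toOp H.isBounded ^ m))) := fun m =>
    curvature_eq H (IsBounded.opA H.isBounded m) (aℓ.pow m) (toOp_opA H.isBounded m)
  have h2 : ∀ m, curvature L (B (m + 1)) =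
      PDO.ofCoef (Unitization.inr (flow (Γ * L.toOp H.isBounded ^ m))) := fun m => by
    have hb := HB (m + 1) (by omega)
    refine curvature_eq H hb.isBounded (aΓ.mul (aℓ.pow m)) ?_
    exact ((isNonisospectral_iff H.isBounded hb.isBounded m).1 hb).unique hh H'
      (isNonisospectralOp_posPart H' HΓ hc m)
  have e0 : ∀ f, (PDO.ofCoef (Unitization.inr f) 0).snd = f := fun f => rfl
  refine ⟨⟨aℓ, aΓ, hc, H'.zeroth, orlov_zeroth hh HΓ.pos HΓ.mder_eq, fun m => ?_, fun m => ?_⟩,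
    h1, h2⟩
  · rcases m with _ | m
    · rw [pow_zero, flow, covariant, one_def, mono_apply, if_pos rfl, Unitization.snd_one,
        Fn.dx_zero]; rfl
    · rw [flowK, h1, e0]
  · rw [flowSigma, h2, e0]

end Nonisospectral

end
end DDKP

theorem mainTheorem11 (h : ℝ) (hh : h ≠ 0) :
    -- the Lax operator and the operators of the non-isospectral Lax triads exist and are unique
    (∃! L : DDKP.PDO, DDKP.IsLax h L) ∧
    ∀ L : DDKP.PDO, DDKP.IsLax h L →
      (∀ m : ℕ, 1 ≤ m → ∃! B : DDKP.PDO, DDKP.IsNonisospectral h L m B) ∧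
      ∀ B : ℕ → DDKP.PDO, (∀ m : ℕ, 1 ≤ m → DDKP.IsNonisospectral h L m (B m)) →
        -- the right hand sides defining the flows are functions in `𝓕`
        (∀ m : ℕ, 1 ≤ m →
          DDKP.curvature L (DDKP.opA L m) =
            DDKP.PDO.ofCoef (Unitization.inr (DDKP.flowK L m)) ∧
          DDKP.curvature L (B m) =
            DDKP.PDO.ofCoef (Unitization.inr (DDKP.flowSigma L B m))) ∧
        -- the integral defining `J₃` exists
        DDKP.Functional.IsPotential h (DDKP.omg L B 3) (DDKP.hamJ h L B 3) ∧
        ∀ s l r : ℕ, 1 ≤ s → 1 ≤ l → 1 ≤ r →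
          -- symmetries, conserved covariants and conserved quantities of `u_t = K_s`
          DDKP.IsSymmetry (DDKP.flowK L s) (DDKP.flowK L l) ∧
          DDKP.IsSymmetry (DDKP.flowK L s) (DDKP.tau h L B s r) ∧
          DDKP.IsConservedCovariant h (DDKP.flowK L s) (DDKP.gam L l) ∧
          DDKP.IsConservedCovariant h (DDKP.flowK L s) (DDKP.theta h L B s r) ∧
          DDKP.theta h L B s r =
            (s : ℝ) • DDKP.ct • (h • DDKP.gam L (s + r - 1) + DDKP.gam L (s + r - 2))
              + DDKP.omg L B r ∧
          DDKP.IsConserved (DDKP.flowK L s) (DDKP.hamH h L B l) ∧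
          DDKP.IsConserved (DDKP.flowK L s) (DDKP.conI h L B s r) ∧
          -- the three relations
          DDKP.inner h (DDKP.flowK L l) (DDKP.gam L r) = 0 ∧
          DDKP.inner h (DDKP.flowK L l) (DDKP.theta h L B s r) =
            -DDKP.inner h (DDKP.tau h L B s r) (DDKP.gam L l) ∧
          DDKP.inner h (DDKP.flowK L l) (DDKP.theta h L B s r) =
            -((l : ℝ) • (h • DDKP.hamH h L B (l + r - 1) + DDKP.hamH h L B (l + r - 2))) ∧
          DDKP.inner h (DDKP.tau h L B s l) (DDKP.theta h L B s r) =
            -(((l : ℝ) - (r : ℝ)) •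
              (h • DDKP.conI h L B s (l + r - 1) + DDKP.conI h L B s (l + r - 2))) := by
  refine ⟨DDKP.existsUnique_isLax hh, fun L HL => ⟨fun m hm => ?_, fun B HB => ?_⟩⟩
  · obtain ⟨m, rfl⟩ := Nat.exists_eq_add_of_le' hm
    exact DDKP.existsUnique_isNonisospectral hh HL m
  obtain ⟨Γ, HΓ⟩ := DDKP.exists_isOrlovOp hh
  obtain ⟨H, h1, h2⟩ := DDKP.generates hh HL HΓ HB
  refine ⟨fun m hm => ?_, H.isPotential_hamJ_three hh, fun s l r hs hl hr => ?_⟩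
  · obtain ⟨m, rfl⟩ := Nat.exists_eq_add_of_le' hm
    exact ⟨by rw [h1, H.flowK_eq], by rw [h2, H.flowSigma_eq]⟩
  obtain ⟨l, rfl⟩ := Nat.exists_eq_add_of_le' hl
  obtain ⟨r, rfl⟩ := Nat.exists_eq_add_of_le' hr
  -- Flow indices exceed exponents of `L` by one in the non-isospectral hierarchy, so both
  -- subtractions here are exact except for matching the form `l + 1 + r - 1`.
  have e1 : l + 1 + (r + 1) - 1 = l + 1 + r := rfl
  have e2 : l + 1 + (r + 1) - 2 = l + 1 + r - 1 := rfl
  have e3 : l + 1 + r = l + r + 1 := by omega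
  have e4 : ((l + 1 : ℕ) : ℝ) - ((r + 1 : ℕ) : ℝ) = l - r := by push_cast; ring
  refine ⟨H.isSymmetry_flowK hh s _, H.isSymmetry_tau hh s r,
    H.isConservedCovariant_dxInv hh s (H.isSymmetry_flowK hh s _),
    H.isConservedCovariant_dxInv hh s (H.isSymmetry_tau hh s r),
    DDKP.Generates.theta_succ s r, H.isConserved_hamH hh s _, H.isConserved_conI hh s r,
    H.inner_flowK_gam hh _ _, ?_, ?_, ?_⟩
  · rw [H.inner_flowK_theta hh, H.inner_tau_gam hh, neg_neg]
  · rw [H.inner_flowK_theta hh, H.inner_flowK_omg hh, e1, e2]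
  · rw [H.inner_tau_theta hh hs, e4, e1, e2, e3, Nat.add_sub_cancel]
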